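/- **Setting.** For every $n$ let $p=p_n\ge 1$, let $\beta_0=\beta_{0,n}\in\mathbb R^{p}$, and let the data $Z^{(n)}=\{(X_i,Y_i)\}_{i=1}^n$ be i.i.d. copies of a random pair $(X,Y)\in\mathbb R^{p}\times\mathbb R$ whose law may depend on $n$. Write $P_0$ for the law of $Z^{(n)}$ and $\mathbb E_0$ for expectations under it, $\varepsilon_i=Y_i-X_i^\top\beta_0$, $\Omega_0=\mathbb E_0[X_iX_i^\top]$ (assumed invertible), $\Theta_0=\Omega_0^{-1}$, $\hat\Omega_n=n^{-1}\sum_{i=1}^nX_iX_i^\top$. For a vector, $\|\cdot\|_1$ and $\|\cdot\|_\infty$ are the $\ell_1$ and sup norms; for a matrix, $\|\cdot\|_\infty$ is the operator norm induced by the sup norm and $\|\cdot\|_{\max}$ the largest absolute entry. For a random variable $V$, $\|V\|_{\psi_2}=\inf\{t>0:\mathbb E_0[\exp(V^2/t^2)]\le2\}$, and for a random vector $\|V\|_{\psi_2}=\sup_{\|u\|_2=1}\|V^\top u\|_{\psi_2}$. Let $\Pi_\beta(\cdot\mid Z^{(n)})$ be an arbitrary (exact or approximate) posterior, that is, a probability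 measure on $\mathbb R^p$ depending measurably on $Z^{(n)}$, and let $\hat\Theta_n\in\mathbb R^{p\times p}$ and $\hat\beta_n\in\mathbb R^p$ be estimators, i.e. measurable functions of $Z^{(n)}$. The debiased posterior is the conditional law given $Z^{(n)}$ of $$\tilde\beta=\beta+\hat\Theta_n\sum_{i=1}^nW_{ni}X_i(Y_i-X_i^\top\beta),\qquad W_{ni}=\frac{\omega_i}{\sum_{k=1}^n\omega_k},$$ where $\beta\sim\Pi_\beta(\cdot\mid Z^{(n)})$ and $\omega_1,\dots,\omega_n$ are i.i.d. $\mathrm{Exp}(1)$, independent of $Z^{(n)}$ and, given $Z^{(n)}$, of $\beta$. For probability measures $P,Q$ on $\mathbb R$ let $d_{BL}(P,Q)=\sup|\int f\,dP-\int f\,dQ|$, the supremum over measurable $f$ with $\sup_x|f(x)|+\sup_{x\ne y}|f(x)-f(y)|/|x-y|\le1$. **Theorem.** Let $j=j_n\in\{1,\dots,p_n\}$ be a coordinate (fixed, or depending on $n$). Assume that there are positive sequences $\epsilon_n,\gamma_n,\delta_n\to0$ such that 1. for some constant $C>0$, $\mathbb E_0[\Pi_\beta(\|\beta-\beta_0\|_1\ge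 C\epsilon_n\mid Z^{(n)})]\to0$; 2. $\|\hat\Theta_n\hat\Omega_n-I_p\|_{\max}=O_{P_0}(\gamma_n)$ and $\|\hat\Theta_n-\Theta_0\|_\infty=O_{P_0}(\delta_n)$; 3. $\hat\beta_n=\beta_0+\Theta_0\frac1n\sum_{i=1}^nX_i\varepsilon_i+\Delta_n$ with $\|\Delta_n\|_\infty=o_{P_0}(n^{-1/2})$; 4. $\mathbb E_0[X_i\varepsilon_i]=0$, and $\|X_i\|_{\psi_2}$, $\|\varepsilon_i\|_{\psi_2}$ and $\mathbb E_0[|e_j^\top\Theta_0X_i\varepsilon_i|^3]$ are bounded uniformly in $n$; 5. $\sqrt n\,\epsilon_n\gamma_n\to0$ and $$\sqrt n\,(\epsilon_n\|\Theta_0\|_\infty+\delta_n)\Big(\sqrt{\tfrac{\log p}{n}}+\tfrac{\log^2n\,\log^2p}{n}\Big)\to0;$$ 6. if $p_n=1$ occurs, then $\|\Theta_0\|_\infty$ is bounded over those $n$ with $p_n=1$ (no condition when $p_n\ge2$). Then $$d_{BL}\Big(\mathcal L\big(\sqrt n(\tilde\beta_j-\hat\beta_{n,j})\mid Z^{(n)}\big),\,N(0,\sigma_{0,j}^2)\Big)\to0\quad\text{in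 }P_0\text{-probability},$$ where $\sigma_{0,j}^2=e_j^\top\Theta_0\,\mathbb E_0[X_iX_i^\top\varepsilon_i^2]\,\Theta_0e_j$. -/

import Mathlib

open MeasureTheory ProbabilityTheory Filter Topology
open scoped ENNReal NNReal Matrix

namespace DebiasedBayes

/-- One observation `(X, Y)` with a covariate vector `X ∈ ℝᵖ` and a response `Y ∈ ℝ`. -/
abbrev Obs (p : ℕ) : Type := (Fin p → ℝ) × ℝ

/-- The data `Z⁽ⁿ⁾ = (X₁, Y₁), …, (Xₙ, Yₙ)`. -/
abbrev Data (n p : ℕ) : Type := Fin n → Obs p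

/-- The law of an i.i.d. sample of size `n` from the law `P` of one observation. -/
noncomputable def sampleLaw {p : ℕ} (n : ℕ) (P : Measure (Obs p)) : Measure (Data n p) :=
  Measure.pi fun _ => P

/-- The regression error `Y - Xᵀβ`. -/
def err {p : ℕ} (β : Fin p → ℝ) (o : Obs p) : ℝ := o.2 - o.1 ⬝ᵥ β

/-- The population second moment matrix `Ω₀ = E[X Xᵀ]`. -/
noncomputable def popCov {p : ℕ} (P : Measure (Obs p)) : Matrix (Fin p) (Fin p) ℝ :=
  Matrix.of fun k l => ∫ o, o.1 k * o.1 l ∂P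

/-- The precision matrix `Θ₀ = Ω₀⁻¹`. -/
noncomputable def precision {p : ℕ} (P : Measure (Obs p)) : Matrix (Fin p) (Fin p) ℝ :=
  (popCov P)⁻¹

/-- The matrix `E[X Xᵀ ε²]` with `ε = Y - Xᵀβ`. -/
noncomputable def scoreCov {p : ℕ} (P : Measure (Obs p)) (β : Fin p → ℝ) :
    Matrix (Fin p) (Fin p) ℝ :=
  Matrix.of fun k l => ∫ o, o.1 k * o.1 l * err β o ^ 2 ∂P

/-- The sandwich variance `e_jᵀ Θ₀ E[X Xᵀ ε²] Θ₀ e_j`. -/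
noncomputable def sandwichVar {p : ℕ} (P : Measure (Obs p)) (β : Fin p → ℝ) (j : Fin p) : ℝ :=
  (precision P * scoreCov P β * precision P) j j

/-- The sample second moment matrix `n⁻¹ ∑ᵢ Xᵢ Xᵢᵀ`. -/
noncomputable def sampleCov {n p : ℕ} (z : Data n p) : Matrix (Fin p) (Fin p) ℝ :=
  Matrix.of fun k l => (n : ℝ)⁻¹ * ∑ i, (z i).1 k * (z i).1 l

/-- The sample score `n⁻¹ ∑ᵢ Xᵢ εᵢ` with `εᵢ = Yᵢ - Xᵢᵀβ`. -/
noncomputable def sampleScore {n p : ℕ} (β : Fin p → ℝ) (z : Data n p) : Fin p → ℝ :=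
  fun k => (n : ℝ)⁻¹ * ∑ i, (z i).1 k * err β (z i)

/-- The `ℓ¹` norm of a vector. (The norm `‖v‖` of `v : Fin p → ℝ` is the sup norm.) -/
def l1Norm {p : ℕ} (v : Fin p → ℝ) : ℝ := ∑ k, |v k|

/-- The operator norm of a matrix induced by the sup norm on vectors. -/
noncomputable def opNormInf {p : ℕ} (A : Matrix (Fin p) (Fin p) ℝ) : ℝ :=
  ‖LinearMap.toContinuousLinearMap (Matrix.mulVecLin A)‖

/-- The elementwise sup norm of a matrix. -/
noncomputable def maxNorm {p : ℕ} (A : Matrix (Fin p) (Fin p) ℝ) : ℝ := ⨆ k, ⨆ l, |A k l|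

/-- The sub-Gaussian norm `inf {t > 0 : E exp(Z² / t²) ≤ 2}`, equal to `∞` if there is no such
`t`. -/
noncomputable def psi2Norm {Ω : Type*} [MeasurableSpace Ω] (μ : Measure Ω) (Z : Ω → ℝ) : ℝ≥0∞ :=
  ⨅ (t : ℝ) (_ : 0 < t ∧ ∫⁻ ω, ENNReal.ofReal (Real.exp (Z ω ^ 2 / t ^ 2)) ∂μ ≤ 2),
    ENNReal.ofReal t

/-- The sub-Gaussian norm of a random vector: the supremum of the sub-Gaussian norms of `Zᵀu` over
all `u` of Euclidean norm one. -/
noncomputable def psi2NormVec {Ω : Type*} [MeasurableSpace Ω] {p : ℕ} (μ : Measure Ω)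
    (Z : Ω → Fin p → ℝ) : ℝ≥0∞ :=
  ⨆ (u : Fin p → ℝ) (_ : ∑ k, u k ^ 2 = 1), psi2Norm μ fun ω => Z ω ⬝ᵥ u

/-- The law of the Bayesian bootstrap weights `ωᵢ / ∑ₖ ωₖ` with `ω₁, …, ωₙ` i.i.d. standard
exponential. -/
noncomputable def bootstrapLaw (n : ℕ) : Measure (Fin n → ℝ) :=
  (Measure.pi fun _ : Fin n => expMeasure 1).map fun ω i => ω i / ∑ k, ω k

/-- The debiased draw `β + Θ̂ ∑ᵢ wᵢ Xᵢ (Yᵢ - Xᵢᵀβ)`. -/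
def debias {n p : ℕ} (z : Data n p) (Θ : Matrix (Fin p) (Fin p) ℝ) (β : Fin p → ℝ)
    (w : Fin n → ℝ) : Fin p → ℝ :=
  β + Θ *ᵥ fun k => ∑ i, w i * ((z i).1 k * err β (z i))

/-- The law of `√n (β̃_j - b_j)` given the data `z`, where `β̃` is the debiased draw, and the
initial draw `β` and the weights are drawn from the product of `post z` and the law of the Bayesian
bootstrap weights. -/
noncomputable def debiasedLaw {n p : ℕ} (post : Kernel (Data n p) (Fin p → ℝ))
    (Θ : Matrix (Fin p) (Fin p) ℝ) (b : Fin p → ℝ) (j : Fin p) (z : Data n p) : Measure ℝ :=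
  ((post z).prod (bootstrapLaw n)).map fun q => √(n : ℝ) * (debias z Θ q.1 q.2 j - b j)

/-- The bounded Lipschitz norm `sup |f| + sup_{x ≠ y} |f x - f y| / d(x, y)` (possibly `∞`). -/
noncomputable def blNorm {E : Type*} [MetricSpace E] (f : E → ℝ) : ℝ≥0∞ :=
  (⨆ x, ‖f x‖ₑ) + ⨆ (x : E) (y : E) (_ : x ≠ y), ‖f x - f y‖ₑ / edist x y

/-- The bounded Lipschitz distance of two probability measures. -/
noncomputable def dBL {E : Type*} [MetricSpace E] [MeasurableSpace E] (P Q : Measure E) : ℝ :=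
  sSup {r : ℝ | ∃ f : E → ℝ, Measurable f ∧ blNorm f ≤ 1 ∧ r = |∫ x, f x ∂P - ∫ x, f x ∂Q|}

/-- `Tₙ = O_P(rₙ)`, where `Tₙ` lives on a probability space that may change with `n`. -/
def IsBigOP {Ω : ℕ → Type*} [∀ n, MeasurableSpace (Ω n)] (μ : ∀ n, Measure (Ω n))
    (T : ∀ n, Ω n → ℝ) (r : ℕ → ℝ) : Prop :=
  ∀ η : ℝ≥0∞, 0 < η → ∃ M : ℝ, ∀ᶠ n in atTop, μ n {ω | M * r n < |T n ω|} ≤ η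

/-- `Tₙ = o_P(rₙ)`. With `rₙ = 1` this is convergence to zero in probability. -/
def IsLittleOP {Ω : ℕ → Type*} [∀ n, MeasurableSpace (Ω n)] (μ : ∀ n, Measure (Ω n))
    (T : ∀ n, Ω n → ℝ) (r : ℕ → ℝ) : Prop :=
  ∀ η : ℝ, 0 < η → Tendsto (fun n => μ n {ω | η * r n < |T n ω|}) atTop (𝓝 0)

end DebiasedBayes

open DebiasedBayes

/-! Write `ξᵢ` for the influence value `e_jᵀ Θ₀ Xᵢ εᵢ`, `wᵢ` for the normalized weights and `Ω̂_w`
for the second moment matrix with weights `w`. Substituting `Y - Xᵀβ = ε - Xᵀ(β - β₀)` gives the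
exact expansion `debias_sub_eq`. Its leading term has `j`-th coordinate `∑ (wᵢ - 1/n) ξᵢ`. The
remainders are `(Θ̂ - Θ₀)` applied to the weighted score, `(Θ̂Ω̂ - I)(β - β₀)`, `Θ̂(Ω̂_w - Ω̂)(β -
β₀)` and the error of the centering estimator. The draw `β` enters them only through `β - β₀`, which
is bounded by its `ℓ¹` norm times an entrywise maximum. The estimates are therefore uniform over
draws near `β₀`, and no property of the posterior beyond contraction is needed.

Leading term. After scaling by `√n`, replacing `∑ ωₖ` by `n` costs a product of two fluctuations of
order `√n`, hence `O(1/√n)`, and leaves `∑ (ξᵢ/√n)(ωᵢ - 1)`. Given the data this is a linear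
combination of independent centred variables of unit variance. Lindeberg replacement
(`HasTaylorBound.abs_integral_pi_sub_gaussian_le`), with test functions smoothed at scale `h`, puts
it within `4h + ρ h⁻² ∑ |ξᵢ|³ / n^(3/2)` of a normal law with variance `n⁻¹ ∑ ξᵢ²`. Markov's
inequality controls the cubic term. A truncated law of large numbers sends the variance to `E ξ²`,
which is the sandwich variance (`HasMomentBounds.sandwichVar_eq`).

Remainders. Coordinates of `X` and `ε` are sub-Gaussian, so the products `XₖXₗ` and `Xₖε` have
exponential moments. Chernoff bounds and a union bound show that the relevant maxima of averages
have order `r = √(L/n) + log² n · L²/n` with `L = log(p + 1)`. A product with `ω - 1` has too heavy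
a tail for this, so the data factor is first truncated at a level of order `log n + L`. The rate
conditions make every remainder `o(1/√n)`.

Gluing. `IsRegular` collects the required bounds on sample and weights. It fails with small joint
probability (`exists_measureReal_not_isRegular_le`), so by Fubini and Markov, for most data, its
conditional failure probability over the weights is small. For such data `exists_dBL_debiasedLaw_le`
bounds the distance deterministically. -/

namespace DebiasedBayes

/-! ### Moments of the standard exponential law -/

instance isProbabilityMeasure_expMeasure_one : IsProbabilityMeasure (expMeasure 1) :=
  isProbabilityMeasure_expMeasure one_pos

theorem expMeasure_one_eq :
    expMeasure 1 = (volume.restrict (Set.Ioi 0)).withDensity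
      fun x => ENNReal.ofReal (Real.exp (-x)) := by
  have h : gammaPDF 1 1 = (Set.Ici (0 : ℝ)).indicator fun x => ENNReal.ofReal (Real.exp (-x)) := by
    funext x
    by_cases hx : 0 ≤ x
    · simp [gammaPDF_of_nonneg hx, hx]
    · rw [gammaPDF_of_neg (not_le.mp hx)]
      simp [hx]
  rw [expMeasure, gammaMeasure, h, withDensity_indicator measurableSet_Ici,
    Measure.restrict_congr_set Ioi_ae_eq_Ici]

theorem integrable_expMeasure_one_iff {f : ℝ → ℝ} :
    Integrable f (expMeasure 1) ↔ IntegrableOn (fun x => Real.exp (-x) * f x) (Set.Ioi 0) := by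
  rw [expMeasure_one_eq, integrable_withDensity_iff_integrable_smul₀' (by fun_prop)
    (by simp)]
  simp only [ENNReal.toReal_ofReal (Real.exp_nonneg _), smul_eq_mul]
  rfl

theorem integral_expMeasure_one (f : ℝ → ℝ) :
    ∫ x, f x ∂(expMeasure 1) = ∫ x in Set.Ioi 0, Real.exp (-x) * f x := by
  rw [expMeasure_one_eq, integral_withDensity_eq_integral_toReal_smul₀ (by fun_prop) (by simp)]
  simp only [ENNReal.toReal_ofReal (Real.exp_nonneg _), smul_eq_mul]

theorem integrable_exp_mul_expMeasure_one {s : ℝ} (hs : s < 1) :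
    Integrable (fun x => Real.exp (s * x)) (expMeasure 1) := by
  rw [integrable_expMeasure_one_iff]
  have := exp_neg_integrableOn_Ioi (b := 1 - s) 0 (by linarith)
  refine this.congr_fun (fun x _ => ?_) measurableSet_Ioi
  simp only [← Real.exp_add]
  congr 1; ring

theorem integral_exp_mul_expMeasure_one {s : ℝ} (hs : s < 1) :
    ∫ x, Real.exp (s * x) ∂(expMeasure 1) = (1 - s)⁻¹ := by
  rw [integral_expMeasure_one]
  have := integral_exp_mul_Ioi (a := s - 1) (by linarith) 0
  have e : ∀ x : ℝ, Real.exp (-x) * Real.exp (s * x) = Real.exp ((s - 1) * x) := fun x => by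
    rw [← Real.exp_add]; congr 1; ring
  simp only [e, this]
  rw [mul_zero, Real.exp_zero, neg_div, one_div, ← inv_neg, neg_sub]

theorem integrable_pow_expMeasure_one (k : ℕ) :
    Integrable (fun x => x ^ k) (expMeasure 1) := by
  rw [integrable_expMeasure_one_iff]
  have := Real.GammaIntegral_convergent (s := k + 1) (by positivity)
  refine this.congr_fun (fun x _ => ?_) measurableSet_Ioi
  simp

theorem integral_pow_expMeasure_one (k : ℕ) :
    ∫ x, x ^ k ∂(expMeasure 1) = k.factorial := by
  rw [integral_expMeasure_one, ← Real.Gamma_nat_eq_factorial, Real.Gamma_eq_integral (by positivity)]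
  simp

theorem integrable_centred_expMeasure_one : Integrable (fun x => x - 1) (expMeasure 1) := by
  have h := (integrable_pow_expMeasure_one 1).sub (integrable_const 1)
  simp only [pow_one] at h
  exact h

theorem integral_centred_expMeasure_one : ∫ x, (x - 1) ∂(expMeasure 1) = 0 := by
  rw [integral_sub (by simpa using integrable_pow_expMeasure_one 1) (integrable_const _)]
  have := integral_pow_expMeasure_one 1
  simp only [pow_one] at this
  simp [this]

theorem integrable_centred_sq_expMeasure_one :
    Integrable (fun x => (x - 1) ^ 2) (expMeasure 1) := by
  have h : (fun x : ℝ => (x - 1) ^ 2) = fun x => x ^ 2 - 2 * x ^ 1 + 1 := by funext x; ring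
  rw [h]
  exact ((integrable_pow_expMeasure_one 2).sub
    ((integrable_pow_expMeasure_one 1).const_mul 2)).add (integrable_const 1)

theorem integral_centred_sq_expMeasure_one : ∫ x, (x - 1) ^ 2 ∂(expMeasure 1) = 1 := by
  have h : (fun x : ℝ => (x - 1) ^ 2) = fun x => (x ^ 2 - 2 * x ^ 1) + 1 := by funext x; ring
  have h2 : Integrable (fun x : ℝ => x ^ 2 - 2 * x ^ 1) (expMeasure 1) :=
    (integrable_pow_expMeasure_one 2).sub ((integrable_pow_expMeasure_one 1).const_mul 2)
  rw [h, integral_add h2 (integrable_const 1), integral_sub (integrable_pow_expMeasure_one 2)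
    ((integrable_pow_expMeasure_one 1).const_mul 2), integral_const_mul,
    integral_pow_expMeasure_one, integral_pow_expMeasure_one]
  norm_num [Nat.factorial]

theorem integrable_abs_centred_cube_expMeasure_one :
    Integrable (fun x => |x - 1| ^ 3) (expMeasure 1) := by
  have h : (fun x : ℝ => (x - 1) ^ 3) = fun x => x ^ 3 - 3 * x ^ 2 + 3 * x ^ 1 - 1 := by
    funext x; ring
  have := ((((integrable_pow_expMeasure_one 3).sub
    ((integrable_pow_expMeasure_one 2).const_mul 3))).add
    ((integrable_pow_expMeasure_one 1).const_mul 3)).sub (integrable_const 1)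
  have h2 : Integrable (fun x : ℝ => (x - 1) ^ 3) (expMeasure 1) := by rw [h]; exact this
  simpa [abs_pow] using h2.abs

/-- The left side is the moment generating function of a centred exponential variable. The claim
amounts to `(1 - x) exp (x + x²) ≥ 1`. The linear bound for `exp` gives `1 - x³`, enough when `x ≤
0`; for `x ≥ 0` the quadratic bound gives `1 + x²(1 - x - x² - x³)/2`, and the bracket is
nonnegative up to `1/2`. -/
theorem exp_neg_div_one_sub_le {x : ℝ} (hx : |x| ≤ 1 / 2) :
    Real.exp (-x) * (1 - x)⁻¹ ≤ Real.exp (x ^ 2) := by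
  have h1 := (abs_le.mp hx).1
  have h2 := (abs_le.mp hx).2
  have h3 : 0 < 1 - x := by linarith
  rw [← div_eq_mul_inv, div_le_iff₀ h3]
  have h4 : Real.exp (-x) = Real.exp (x ^ 2) * Real.exp (-(x + x ^ 2)) := by
    rw [← Real.exp_add]; congr 1; ring
  rw [h4]
  refine mul_le_mul_of_nonneg_left ?_ (Real.exp_nonneg _)
  rw [Real.exp_neg, inv_le_comm₀ (Real.exp_pos _) h3]
  rw [inv_le_iff_one_le_mul₀ h3]
  rcases le_total 0 x with hx0 | hx0
  · have := Real.quadratic_le_exp_of_nonneg (by positivity : 0 ≤ x + x ^ 2)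
    refine le_trans ?_ (mul_le_mul_of_nonneg_right this h3.le)
    have h5 : 0 ≤ 1 - x - x ^ 2 - x ^ 3 := by nlinarith [mul_nonneg hx0 hx0]
    nlinarith [mul_nonneg (sq_nonneg x) h5]
  · have := Real.add_one_le_exp (x + x ^ 2)
    refine le_trans ?_ (mul_le_mul_of_nonneg_right this h3.le)
    nlinarith [mul_nonneg (sq_nonneg x) (neg_nonneg.mpr hx0)]

theorem integral_exp_mul_centred_le {x : ℝ} (hx : |x| ≤ 1 / 2) :
    ∫ w, Real.exp (x * (w - 1)) ∂(expMeasure 1) ≤ Real.exp (x ^ 2) := by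
  have e : ∀ w : ℝ, Real.exp (x * (w - 1)) = Real.exp (-x) * Real.exp (x * w) := fun w => by
    rw [← Real.exp_add]; congr 1; ring
  simp only [e]
  rw [integral_const_mul, integral_exp_mul_expMeasure_one (by linarith [(abs_le.mp hx).2])]
  exact exp_neg_div_one_sub_le hx

/-! ### Lindeberg replacement -/

/-- Bounded functions with a second order Taylor expansion whose remainder is at most `M |u|³`,
uniformly in the base point. -/
def HasTaylorBound (M : ℝ) (f : ℝ → ℝ) : Prop :=
  ∃ f₁ f₂ : ℝ → ℝ, (Measurable f ∧ Measurable f₁ ∧ Measurable f₂) ∧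
    (∃ C, (∀ x, |f x| ≤ C) ∧ (∀ x, |f₁ x| ≤ C) ∧ ∀ x, |f₂ x| ≤ C) ∧
    ∀ x u, |f (x + u) - f x - f₁ x * u - f₂ x * u ^ 2| ≤ M * |u| ^ 3

theorem integrable_of_abs_le {α : Type*} [MeasurableSpace α] {μ : Measure α} [IsFiniteMeasure μ]
    {f : α → ℝ} (hf : Measurable f) {C : ℝ} (hC : ∀ x, |f x| ≤ C) : Integrable f μ :=
  Integrable.of_bound hf.aestronglyMeasurable C (Eventually.of_forall hC)

theorem abs_integral_le_of_abs_le {α : Type*} [MeasurableSpace α] {μ : Measure α}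
    [IsProbabilityMeasure μ] {f : α → ℝ} {C : ℝ} (hC : ∀ x, |f x| ≤ C) : |∫ x, f x ∂μ| ≤ C := by
  have := norm_integral_le_of_norm_le_const (μ := μ) (f := f) (C := C)
    (Eventually.of_forall fun x => by simpa using hC x)
  simpa using this

theorem measurable_integral_add {ν : Measure ℝ} [IsProbabilityMeasure ν] {f : ℝ → ℝ}
    (hf : Measurable f) : Measurable fun x => ∫ y, f (x + y) ∂ν := by
  have : StronglyMeasurable (Function.uncurry fun x y : ℝ => f (x + y)) :=
    (hf.comp (measurable_fst.add measurable_snd)).stronglyMeasurable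
  exact this.integral_prod_right.measurable

/-- Averaging over translates does not increase `M`. This lets the summands already made Gaussian be
absorbed into the test function. -/
theorem HasTaylorBound.average {M : ℝ} {f : ℝ → ℝ} (h : HasTaylorBound M f) (ν : Measure ℝ)
    [IsProbabilityMeasure ν] : HasTaylorBound M fun x => ∫ y, f (x + y) ∂ν := by
  obtain ⟨f₁, f₂, ⟨m, m₁, m₂⟩, ⟨C, b, b₁, b₂⟩, hT⟩ := h
  have i : ∀ {g : ℝ → ℝ}, Measurable g → (∀ x, |g x| ≤ C) → ∀ x,
      Integrable (fun y => g (x + y)) ν := fun hg hb x =>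
    integrable_of_abs_le (hg.comp (measurable_const.add measurable_id)) fun y => hb _
  refine ⟨fun x => ∫ y, f₁ (x + y) ∂ν, fun x => ∫ y, f₂ (x + y) ∂ν,
    ⟨measurable_integral_add m, measurable_integral_add m₁, measurable_integral_add m₂⟩,
    ⟨C, fun x => abs_integral_le_of_abs_le fun y => b _,
      fun x => abs_integral_le_of_abs_le fun y => b₁ _,
      fun x => abs_integral_le_of_abs_le fun y => b₂ _⟩, fun x u => ?_⟩
  have e : (∫ y, f (x + u + y) ∂ν) - (∫ y, f (x + y) ∂ν) - (∫ y, f₁ (x + y) ∂ν) * u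
      - (∫ y, f₂ (x + y) ∂ν) * u ^ 2
      = ∫ y, (f (x + u + y) - f (x + y) - f₁ (x + y) * u - f₂ (x + y) * u ^ 2) ∂ν := by
    have h0 : Integrable (fun y => f (x + u + y) - f (x + y)) ν := (i m b _).sub (i m b _)
    have h1 : Integrable (fun y => f₁ (x + y) * u) ν := (i m₁ b₁ _).mul_const _
    have h01 : Integrable (fun y => f (x + u + y) - f (x + y) - f₁ (x + y) * u) ν := h0.sub h1
    rw [integral_sub h01 ((i m₂ b₂ _).mul_const _), integral_sub h0 h1,
      integral_sub (i m b _) (i m b _), integral_mul_const, integral_mul_const]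
  simp only [e]
  refine abs_integral_le_of_abs_le fun y => ?_
  have := hT (x + y) u
  rwa [show x + u + y = x + y + u by ring]

/-- A centred law with unit variance and third absolute moment at most `ρ`. -/
structure IsStandardized (ν : Measure ℝ) (ρ : ℝ) : Prop where
  integrable_id : Integrable (fun y => y) ν
  integrable_sq : Integrable (fun y => y ^ 2) ν
  integrable_cube : Integrable (fun y => |y| ^ 3) ν
  integral_id : ∫ y, y ∂ν = 0
  integral_sq : ∫ y, y ^ 2 ∂ν = 1
  integral_cube : ∫ y, |y| ^ 3 ∂ν ≤ ρ

/-- Two centred laws with unit variance give close averages of a function with a Taylor bound. -/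
theorem HasTaylorBound.abs_average_sub_average_le {M ρ : ℝ} {f : ℝ → ℝ} (h : HasTaylorBound M f)
    (hM : 0 ≤ M) {ν ν' : Measure ℝ} [IsProbabilityMeasure ν] [IsProbabilityMeasure ν']
    (hν : IsStandardized ν ρ) (hν' : IsStandardized ν' ρ) (x c : ℝ) :
    |∫ y, f (x + c * y) ∂ν - ∫ y, f (x + c * y) ∂ν'| ≤ 2 * M * ρ * |c| ^ 3 := by
  obtain ⟨f₁, f₂, ⟨m, m₁, m₂⟩, ⟨C, b, b₁, b₂⟩, hT⟩ := h
  -- The comparison value depends only on the first two moments, which the two laws share; the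
  -- factor 2 comes from going through it twice.
  have key : ∀ (μ : Measure ℝ) [IsProbabilityMeasure μ], IsStandardized μ ρ →
      |∫ y, f (x + c * y) ∂μ - (f x + f₂ x * c ^ 2)| ≤ M * ρ * |c| ^ 3 := by
    intro μ _ hμ
    have hi : Integrable (fun y => f (x + c * y)) μ :=
      integrable_of_abs_le (m.comp (by fun_prop)) fun y => b _
    have h1 : Integrable (fun y => f₁ x * c * y) μ := hμ.integrable_id.const_mul _
    have h2 : Integrable (fun y => f₂ x * c ^ 2 * y ^ 2) μ := hμ.integrable_sq.const_mul _
    have h01 : Integrable (fun y => f (x + c * y) - f x) μ := hi.sub (integrable_const _)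
    have h012 : Integrable (fun y => f (x + c * y) - f x - f₁ x * c * y) μ := h01.sub h1
    have e : ∫ y, f (x + c * y) ∂μ - (f x + f₂ x * c ^ 2)
        = ∫ y, (f (x + c * y) - f x - f₁ x * c * y - f₂ x * c ^ 2 * y ^ 2) ∂μ := by
      rw [integral_sub h012 h2, integral_sub h01 h1, integral_sub hi (integrable_const _),
        integral_const_mul, integral_const_mul, hμ.integral_id, hμ.integral_sq]
      simp; ring
    rw [e]
    calc |∫ y, (f (x + c * y) - f x - f₁ x * c * y - f₂ x * c ^ 2 * y ^ 2) ∂μ|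
        ≤ ∫ y, |f (x + c * y) - f x - f₁ x * c * y - f₂ x * c ^ 2 * y ^ 2| ∂μ :=
          abs_integral_le_integral_abs
      _ ≤ ∫ y, M * |c| ^ 3 * |y| ^ 3 ∂μ := by
          refine integral_mono (h012.sub h2).abs (hμ.integrable_cube.const_mul _) fun y => ?_
          have := hT x (c * y)
          simp only
          rw [show f₁ x * c * y = f₁ x * (c * y) by ring,
            show f₂ x * c ^ 2 * y ^ 2 = f₂ x * (c * y) ^ 2 by ring]
          refine this.trans (le_of_eq ?_)
          rw [abs_mul]; ring
      _ = M * |c| ^ 3 * ∫ y, |y| ^ 3 ∂μ := integral_const_mul _ _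
      _ ≤ M * |c| ^ 3 * ρ := mul_le_mul_of_nonneg_left hμ.integral_cube (by positivity)
      _ = M * ρ * |c| ^ 3 := by ring
  have k1 := key ν hν
  have k2 := key ν' hν'
  rw [abs_le] at *
  constructor <;> linarith [k1.1, k1.2, k2.1, k2.2]

theorem gaussianReal_map_mul (c : ℝ) :
    (gaussianReal 0 1).map (fun x => c * x) = gaussianReal 0 (c ^ 2).toNNReal := by
  rw [gaussianReal_map_const_mul, mul_zero, mul_one]
  congr 1
  exact NNReal.eq (Real.coe_toNNReal _ (sq_nonneg c)).symm

/-- Since `N(0, c² + v)` is the convolution of `N(0, c²)` and `N(0, v)`, a Gaussian summand can be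
split off in the same way as a coordinate of a product measure. -/
theorem integral_gaussianReal_add_mul {f : ℝ → ℝ} (hf : Measurable f) {C : ℝ}
    (hC : ∀ x, |f x| ≤ C) (x c : ℝ) (v : ℝ≥0) :
    ∫ y, f (x + y) ∂(gaussianReal 0 ((c ^ 2).toNNReal + v))
      = ∫ w, (∫ y, f (x + c * w + y) ∂(gaussianReal 0 v)) ∂(gaussianReal 0 1) := by
  have h := gaussianReal_conv_gaussianReal (m₁ := 0) (m₂ := 0) (v₁ := (c ^ 2).toNNReal)
    (v₂ := v)
  rw [add_zero, ← gaussianReal_map_mul, Measure.conv] at h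
  have m1 : Measurable fun y => f (x + y) := hf.comp (by fun_prop)
  have m2 : Measurable fun q : ℝ × ℝ => f (x + (q.1 + q.2)) := hf.comp (by fun_prop)
  have := Measure.isProbabilityMeasure_map (μ := gaussianReal 0 1) (f := fun y : ℝ => c * y)
    (by fun_prop)
  rw [← h, integral_map (by fun_prop) m1.aestronglyMeasurable,
    integral_prod _ (integrable_of_abs_le m2 fun y => hC _), integral_map (by fun_prop)]
  · simp only [add_assoc]
  · have : StronglyMeasurable (Function.uncurry fun w y : ℝ => f (x + (w + y))) :=
      (hf.comp (by fun_prop)).stronglyMeasurable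
    exact this.integral_prod_right.aestronglyMeasurable

theorem integral_pi_succ_add_sum {ν : Measure ℝ} [IsProbabilityMeasure ν] {f : ℝ → ℝ}
    (hf : Measurable f) {C : ℝ} (hC : ∀ x, |f x| ≤ C) {n : ℕ} (c : Fin (n + 1) → ℝ) (x : ℝ) :
    ∫ w, f (x + ∑ i, c i * w i) ∂(Measure.pi fun _ : Fin (n + 1) => ν)
      = ∫ a, (∫ w, f (x + c 0 * a + ∑ i : Fin n, c i.succ * w i) ∂(Measure.pi fun _ => ν)) ∂ν := by
  have h := measurePreserving_piFinSuccAbove (fun _ : Fin (n + 1) => ν) 0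
  have m : Measurable fun q : ℝ × (Fin n → ℝ) =>
      f (x + c 0 * q.1 + ∑ i : Fin n, c i.succ * q.2 i) := hf.comp (by fun_prop)
  rw [← integral_prod (fun q : ℝ × (Fin n → ℝ) =>
    f (x + c 0 * q.1 + ∑ i : Fin n, c i.succ * q.2 i))
    (integrable_of_abs_le m fun q => hC _), ← h.integral_comp']
  refine integral_congr_ae (Eventually.of_forall fun w => ?_)
  simp [Fin.sum_univ_succ, add_assoc, MeasurableEquiv.piFinSuccAbove, Fin.tail]

/-- **Lindeberg replacement**: comparison of a linear combination of independent standardized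
variables with a Gaussian variable of the same variance. -/
theorem HasTaylorBound.abs_integral_pi_sub_gaussian_le {M ρ : ℝ} {f : ℝ → ℝ}
    (h : HasTaylorBound M f) (hM : 0 ≤ M) {ν : Measure ℝ} [IsProbabilityMeasure ν]
    (hν : IsStandardized ν ρ) (hg : IsStandardized (gaussianReal 0 1) ρ) {n : ℕ} (c : Fin n → ℝ) :
    ∀ x, |∫ w, f (x + ∑ i, c i * w i) ∂(Measure.pi fun _ => ν)
      - ∫ y, f (x + y) ∂(gaussianReal 0 (∑ i, (c i ^ 2).toNNReal))|
      ≤ 2 * M * ρ * ∑ i, |c i| ^ 3 := by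
  -- The base point `x` stays universally quantified: the induction hypothesis is applied at the
  -- point shifted by the first summand.
  induction n with
  | zero => intro x; simp [gaussianReal_zero_var]
  | succ n ih =>
    intro x
    obtain ⟨f₁, f₂, ⟨m, m₁, m₂⟩, ⟨C, b, b₁, b₂⟩, hT⟩ := id h
    set v : ℝ≥0 := ∑ i : Fin n, (c i.succ ^ 2).toNNReal
    rw [Fin.sum_univ_succ (fun i => (c i ^ 2).toNNReal), Fin.sum_univ_succ (fun i => |c i| ^ 3),
      integral_pi_succ_add_sum m b,
      integral_gaussianReal_add_mul m b]
    -- Two swaps: `hS` replaces the tail by a Gaussian with the first coordinate held fixed, and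
    -- `hG` replaces the first coordinate with the Gaussian tail averaged into the test function.
    have hG := (h.average (gaussianReal 0 v)).abs_average_sub_average_le hM hν hg x (c 0)
    have hS : |∫ a, (∫ w, f (x + c 0 * a + ∑ i : Fin n, c i.succ * w i)
          ∂(Measure.pi fun _ => ν)) ∂ν
        - ∫ a, (∫ y, f (x + c 0 * a + y) ∂(gaussianReal 0 v)) ∂ν|
        ≤ 2 * M * ρ * ∑ i : Fin n, |c i.succ| ^ 3 := by
      have s1 : StronglyMeasurable (Function.uncurry fun (a : ℝ) (w : Fin n → ℝ) =>
          f (x + c 0 * a + ∑ i : Fin n, c i.succ * w i)) :=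
        (m.comp (by fun_prop)).stronglyMeasurable
      have s2 : StronglyMeasurable (Function.uncurry fun (a y : ℝ) => f (x + c 0 * a + y)) :=
        (m.comp (by fun_prop)).stronglyMeasurable
      rw [← integral_sub]
      · exact abs_integral_le_of_abs_le fun a => ih (fun i => c i.succ) (x + c 0 * a)
      · exact integrable_of_abs_le s1.integral_prod_right.measurable
          fun a => abs_integral_le_of_abs_le fun w => b _
      · exact integrable_of_abs_le s2.integral_prod_right.measurable
          fun a => abs_integral_le_of_abs_le fun w => b _
    calc _ ≤ _ := abs_sub_le _ (∫ a, (∫ y, f (x + c 0 * a + y) ∂(gaussianReal 0 v)) ∂ν) _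
      _ ≤ _ := add_le_add hS hG
      _ = _ := by ring

/-! ### Smoothing of bounded Lipschitz functions -/

/-- The average of `f` over `[x, x + h]`. -/
noncomputable def boxSmooth (h : ℝ) (f : ℝ → ℝ) (x : ℝ) : ℝ := h⁻¹ * ∫ t in x..x + h, f t

/-- The difference quotient of `f` with step `h`. -/
noncomputable def diffQuot (h : ℝ) (f : ℝ → ℝ) (x : ℝ) : ℝ := h⁻¹ * (f (x + h) - f x)

theorem hasDerivAt_boxSmooth (h : ℝ) {f : ℝ → ℝ} (hf : Continuous f) (x : ℝ) :
    HasDerivAt (boxSmooth h f) (diffQuot h f x) x := by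
  have e : boxSmooth h f = fun x => h⁻¹ * ((∫ t in (0 : ℝ)..x + h, f t) - ∫ t in (0 : ℝ)..x, f t) := by
    funext y
    rw [boxSmooth, intervalIntegral.integral_interval_sub_left] <;>
      exact hf.intervalIntegrable _ _
  rw [e, diffQuot]
  have d : ∀ y, HasDerivAt (fun u => ∫ t in (0 : ℝ)..u, f t) (f y) y := fun y =>
    (intervalIntegral.integral_hasDerivAt_right (hf.intervalIntegrable _ _)
      (hf.stronglyMeasurableAtFilter _ _) hf.continuousAt)
  refine HasDerivAt.const_mul _ (HasDerivAt.sub ?_ (d x))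
  exact HasDerivAt.comp_add_const x h (d (x + h))

theorem hasDerivAt_diffQuot (h : ℝ) {f f' : ℝ → ℝ} (hf : ∀ x, HasDerivAt f (f' x) x) (x : ℝ) :
    HasDerivAt (diffQuot h f) (diffQuot h f' x) x :=
  HasDerivAt.const_mul _ (HasDerivAt.sub (HasDerivAt.comp_add_const x h (hf (x + h))) (hf x))

theorem continuous_boxSmooth (h : ℝ) {f : ℝ → ℝ} (hf : Continuous f) :
    Continuous (boxSmooth h f) :=
  continuous_iff_continuousAt.mpr fun x => (hasDerivAt_boxSmooth h hf x).continuousAt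

theorem abs_boxSmooth_sub_le {h : ℝ} (hh : 0 < h) {f : ℝ → ℝ} (hf : Continuous f) {x a C : ℝ}
    (hC : ∀ t, x ≤ t → t ≤ x + h → |f t - a| ≤ C) : |boxSmooth h f x - a| ≤ C := by
  have e : boxSmooth h f x - a = h⁻¹ * ∫ t in x..x + h, (f t - a) := by
    rw [intervalIntegral.integral_sub (hf.intervalIntegrable _ _)
      (continuous_const.intervalIntegrable _ _)]
    simp [boxSmooth]; field_simp
  have := intervalIntegral.norm_integral_le_of_norm_le_const (a := x) (b := x + h) (C := C)
    (f := fun t => f t - a) fun t ht => by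
      rw [Set.uIoc_of_le (by linarith)] at ht
      exact hC t ht.1.le ht.2
  rw [e, abs_mul, abs_of_pos (inv_pos.mpr hh), inv_mul_le_iff₀ hh]
  simpa [abs_of_pos hh, mul_comm] using this

theorem abs_diffQuot_le_of_bounded {h : ℝ} (hh : 0 < h) {f : ℝ → ℝ} {C : ℝ} (hC : ∀ x, |f x| ≤ C)
    (x : ℝ) : |diffQuot h f x| ≤ 2 * C / h := by
  rw [diffQuot, abs_mul, abs_of_pos (inv_pos.mpr hh), inv_mul_le_iff₀ hh, mul_div_cancel₀ _ hh.ne']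
  calc _ ≤ |f (x + h)| + |f x| := abs_sub _ _
    _ ≤ _ := by linarith [hC x, hC (x + h)]

theorem abs_diffQuot_sub_le {h : ℝ} (hh : 0 < h) {f : ℝ → ℝ} {C : ℝ}
    (hC : ∀ x y, |f x - f y| ≤ C * |x - y|) (x y : ℝ) :
    |diffQuot h f x - diffQuot h f y| ≤ 2 * C / h * |x - y| := by
  rw [diffQuot, diffQuot, ← mul_sub, abs_mul, abs_of_pos (inv_pos.mpr hh), inv_mul_le_iff₀ hh]
  have h1 := hC (x + h) (y + h)
  rw [show x + h - (y + h) = x - y by ring] at h1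
  have h2 := hC x y
  have e : h * (2 * C / h * |x - y|) = 2 * C * |x - y| := by field_simp
  rw [e, abs_le]
  rw [abs_le] at h1 h2
  constructor <;> linarith [h1.1, h1.2, h2.1, h2.2]

theorem abs_sub_le_of_hasDerivAt {f f' : ℝ → ℝ} (hf : ∀ x, HasDerivAt f (f' x) x) {C x u : ℝ}
    (hC : ∀ t, |t| ≤ |u| → |f' (x + t)| ≤ C) : |f (x + u) - f x| ≤ C * |u| := by
  have := (convex_uIcc (0 : ℝ) u).norm_image_sub_le_of_norm_hasDerivWithin_le
    (f := fun t => f (x + t)) (f' := fun t => f' (x + t)) (C := C)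
    (fun t _ => (HasDerivAt.comp_const_add x t (hf (x + t))).hasDerivWithinAt)
    (fun t ht => hC t ?_) Set.left_mem_uIcc Set.right_mem_uIcc
  · simpa using this
  · rcases le_total 0 u with h | h
    · rw [Set.uIcc_of_le h] at ht
      rw [abs_of_nonneg ht.1, abs_of_nonneg h]; exact ht.2
    · rw [Set.uIcc_of_ge h] at ht
      rw [abs_of_nonpos ht.2, abs_of_nonpos h]; linarith [ht.1]

/-- The mean value inequality, applied first to `f₁` minus its tangent and then to `f` minus its
quadratic expansion. Integrating the remainders would improve the constant, which is not needed. -/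
theorem abs_taylor_two_le {f f₁ f₂ : ℝ → ℝ} (h₁ : ∀ x, HasDerivAt f (f₁ x) x)
    (h₂ : ∀ x, HasDerivAt f₁ (f₂ x) x) {M : ℝ} (hM : 0 ≤ M)
    (hL : ∀ x y, |f₂ x - f₂ y| ≤ M * |x - y|) (x u : ℝ) :
    |f (x + u) - f x - f₁ x * u - f₂ x / 2 * u ^ 2| ≤ M * |u| ^ 3 := by
  have d1 : ∀ u, |f₁ (x + u) - f₁ x - f₂ x * u| ≤ M * |u| ^ 2 := by
    intro u
    have := abs_sub_le_of_hasDerivAt (f := fun t => f₁ t - f₂ x * t)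
      (f' := fun t => f₂ t - f₂ x) (x := x) (u := u) (C := M * |u|)
      (fun t => by
        refine ((h₂ t).sub ((hasDerivAt_id t).const_mul (f₂ x))).congr_deriv ?_
        simp)
      (fun t ht => by
        refine (hL _ _).trans ?_
        rw [add_sub_cancel_left]
        exact mul_le_mul_of_nonneg_left ht hM)
    calc _ = _ := by congr 1; ring
      _ ≤ _ := this
      _ = _ := by ring
  have := abs_sub_le_of_hasDerivAt
    (f := fun t => f t - f₁ x * t - f₂ x / 2 * (t - x) ^ 2)
    (f' := fun t => f₁ t - f₁ x - f₂ x * (t - x)) (x := x) (u := u) (C := M * |u| ^ 2)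
    (fun t => by
      have h3 : HasDerivAt (fun t => (t - x) ^ 2) (2 * (t - x)) t := by
        refine (((hasDerivAt_id t).sub_const x).pow 2).congr_deriv ?_
        simp
      have := ((h₁ t).sub ((hasDerivAt_id t).const_mul (f₁ x))).sub (h3.const_mul (f₂ x / 2))
      refine this.congr_deriv ?_
      simp; ring)
    (fun t ht => by
      have := d1 t
      rw [show x + t - x = t by ring]
      refine this.trans (mul_le_mul_of_nonneg_left ?_ hM)
      gcongr)
  calc _ = _ := by congr 1; ring
    _ ≤ _ := this
    _ = _ := by ring

/-- A bounded Lipschitz function is uniformly close to a function with a Taylor bound. -/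
theorem exists_hasTaylorBound_near {f : ℝ → ℝ} (hb : ∀ x, |f x| ≤ 1)
    (hL : ∀ x y, |f x - f y| ≤ |x - y|) {h : ℝ} (hh : 0 < h) :
    ∃ F, HasTaylorBound (4 / h ^ 2) F ∧ ∀ x, |F x - f x| ≤ 2 * h := by
  have hf : Continuous f :=
    (LipschitzWith.of_dist_le_mul (K := 1) fun x y => by
      simpa [Real.dist_eq] using hL x y).continuous
  -- Box averaging is applied twice. The derivative of a box average is a difference quotient, so
  -- the second derivative of the result is a double difference quotient of `f`. Each quotient
  -- multiplies the Lipschitz constant by `2 / h`, whence `4 / h ^ 2`; each averaging moves the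
  -- function by at most `h`.
  set g := boxSmooth h f with hg
  have hgc : Continuous g := continuous_boxSmooth h hf
  have hdg : ∀ x, HasDerivAt g (diffQuot h f x) x := hasDerivAt_boxSmooth h hf
  have hdF : ∀ x, HasDerivAt (boxSmooth h g) (diffQuot h g x) x := hasDerivAt_boxSmooth h hgc
  have hdF2 : ∀ x, HasDerivAt (diffQuot h g) (diffQuot h (diffQuot h f) x) x :=
    hasDerivAt_diffQuot h hdg
  have hgb : ∀ x, |g x| ≤ 1 := fun x => by
    simpa using abs_boxSmooth_sub_le hh hf (x := x) (a := 0) (C := 1) fun t _ _ => by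
      simpa using hb t
  have hFb : ∀ x, |boxSmooth h g x| ≤ 1 := fun x => by
    simpa using abs_boxSmooth_sub_le hh hgc (x := x) (a := 0) (C := 1) fun t _ _ => by
      simpa using hgb t
  have hDf : ∀ x, |diffQuot h f x| ≤ 1 := fun x => by
    rw [diffQuot, abs_mul, abs_of_pos (inv_pos.mpr hh), inv_mul_le_iff₀ hh]
    simpa [abs_of_pos hh] using hL (x + h) x
  have hDc : Continuous (diffQuot h f) := by unfold diffQuot; fun_prop
  have hgL : ∀ x u, |g (x + u) - g x| ≤ |u| := fun x u => by
    simpa using abs_sub_le_of_hasDerivAt hdg (C := 1) (x := x) (u := u) fun t _ => hDf _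
  have hDDL := abs_diffQuot_sub_le hh (abs_diffQuot_sub_le hh (C := 1) (by simpa using hL))
  refine ⟨boxSmooth h g, ⟨diffQuot h g, fun x => diffQuot h (diffQuot h f) x / 2,
    ⟨(continuous_boxSmooth h hgc).measurable, ?_, ?_⟩, ⟨1 + 2 / h + 2 / h, ?_, ?_, ?_⟩, ?_⟩, ?_⟩
  · exact (by unfold diffQuot; fun_prop : Continuous (diffQuot h g)).measurable
  · exact (by unfold diffQuot at hDc ⊢; fun_prop :
      Continuous fun x => diffQuot h (diffQuot h f) x / 2).measurable
  · intro x
    have : 0 ≤ 2 / h := by positivity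
    linarith [hFb x]
  · intro x
    have := abs_diffQuot_le_of_bounded hh hgb x
    have : 0 ≤ 2 / h := by positivity
    linarith
  · intro x
    have h1 := abs_diffQuot_le_of_bounded hh hDf x
    have : 0 ≤ 2 / h := by positivity
    rw [abs_div, abs_two]
    have : 0 ≤ |diffQuot h (diffQuot h f) x| := abs_nonneg _
    linarith
  · refine abs_taylor_two_le hdF hdF2 (by positivity) fun x y => (hDDL x y).trans (le_of_eq ?_)
    field_simp; ring
  · intro x
    have h1 : |boxSmooth h g x - g x| ≤ h := abs_boxSmooth_sub_le hh hgc fun t h1 h2 => by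
      have := hgL x (t - x)
      rw [show x + (t - x) = t by ring, abs_of_nonneg (by linarith : 0 ≤ t - x)] at this
      linarith
    have h2 : |g x - f x| ≤ h := abs_boxSmooth_sub_le hh hf fun t h1 h2 => by
      refine (hL _ _).trans ?_
      rw [abs_of_nonneg (by linarith : 0 ≤ t - x)]; linarith
    calc _ ≤ _ := abs_sub_le _ (g x) _
      _ ≤ _ := by linarith

/-! ### Quantitative central limit theorem for weighted exponentials -/

/-- The third absolute moment bounding those of the centred exponential and of the standard normal
law. -/
theorem exists_isStandardized :
    ∃ ρ : ℝ, 0 ≤ ρ ∧ IsStandardized ((expMeasure 1).map fun x => x - 1) ρ ∧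
      IsStandardized (gaussianReal 0 1) ρ := by
  have hm : AEMeasurable (fun x : ℝ => x - 1) (expMeasure 1) := by fun_prop
  have hv : ∫ y, y ^ 2 ∂(gaussianReal 0 1) = 1 := by
    have := variance_fun_id_gaussianReal (μ := 0) (v := 1)
    rw [variance_of_integral_eq_zero (by fun_prop) (integral_id_gaussianReal)] at this
    simpa using this
  have L := fun p : ℝ≥0 => memLp_id_gaussianReal (μ := 0) (v := 1) p
  refine ⟨max (∫ x, |x - 1| ^ 3 ∂(expMeasure 1)) (∫ y, |y| ^ 3 ∂(gaussianReal 0 1)),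
    le_max_of_le_left (integral_nonneg fun x => by positivity), ⟨?_, ?_, ?_, ?_, ?_, ?_⟩,
    ⟨?_, ?_, ?_, integral_id_gaussianReal, hv, le_max_right _ _⟩⟩
  · rw [integrable_map_measure (by fun_prop) hm]
    exact integrable_centred_expMeasure_one
  · rw [integrable_map_measure (by fun_prop) hm]
    exact integrable_centred_sq_expMeasure_one
  · rw [integrable_map_measure (by fun_prop) hm]
    exact integrable_abs_centred_cube_expMeasure_one
  · rw [integral_map hm (by fun_prop)]
    exact integral_centred_expMeasure_one
  · rw [integral_map hm (by fun_prop)]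
    exact integral_centred_sq_expMeasure_one
  · rw [integral_map hm (by fun_prop)]
    exact le_max_left _ _
  · exact (L 1).integrable (by simp)
  · simpa using (L 2).integrable_sq
  · simpa using (L 3).integrable_norm_pow (by norm_num)

theorem integral_pi_map_sub_one {n : ℕ} {f : (Fin n → ℝ) → ℝ} (hf : Measurable f) :
    ∫ w, f w ∂(Measure.pi fun _ : Fin n => (expMeasure 1).map fun x => x - 1)
      = ∫ w, f (fun i => w i - 1) ∂(Measure.pi fun _ : Fin n => expMeasure 1) := by
  have : ∀ _ : Fin n, IsProbabilityMeasure ((expMeasure 1).map fun x : ℝ => x - 1) := fun _ =>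
    Measure.isProbabilityMeasure_map (by fun_prop)
  have h : Measure.pi (fun _ : Fin n => (expMeasure 1).map fun x : ℝ => x - 1)
      = (Measure.pi fun _ : Fin n => expMeasure 1).map fun w i => w i - 1 :=
    (Measure.pi_map_pi (μ := fun _ : Fin n => expMeasure 1) (f := fun _ x => x - 1)
      fun _ => by fun_prop).symm
  have m : Measurable fun (w : Fin n → ℝ) i => w i - 1 := by fun_prop
  rw [h, integral_map m.aemeasurable hf.aestronglyMeasurable]

/-- A quantitative central limit theorem for weighted sums of centred exponential variables, in the
bounded Lipschitz metric. -/
theorem exists_abs_integral_exp_sub_gaussian_le :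
    ∃ ρ : ℝ, 0 ≤ ρ ∧ ∀ (n : ℕ) (c : Fin n → ℝ) (f : ℝ → ℝ), (∀ x, |f x| ≤ 1) →
      (∀ x y, |f x - f y| ≤ |x - y|) → ∀ h : ℝ, 0 < h →
      |∫ w, f (∑ i, c i * (w i - 1)) ∂(Measure.pi fun _ : Fin n => expMeasure 1)
        - ∫ y, f y ∂(gaussianReal 0 (∑ i, c i ^ 2).toNNReal)|
        ≤ 4 * h + ρ / h ^ 2 * ∑ i, |c i| ^ 3 := by
  obtain ⟨ρ, hρ, hE, hG⟩ := exists_isStandardized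
  -- Lindeberg replacement with `M = 4 / h ^ 2` costs `2 * M * ρ`, hence `8 * ρ`; passing between
  -- `f` and its smoothing under both laws costs `2 * h` each.
  refine ⟨8 * ρ, by positivity, fun n c f hb hL h hh => ?_⟩
  obtain ⟨F, hF, hFf⟩ := exists_hasTaylorBound_near hb hL hh
  have := Measure.isProbabilityMeasure_map (μ := expMeasure 1) (f := fun x : ℝ => x - 1)
    (by fun_prop)
  have hf : Continuous f :=
    (LipschitzWith.of_dist_le_mul (K := 1) fun x y => by
      simpa [Real.dist_eq] using hL x y).continuous
  obtain ⟨F₁, F₂, ⟨m, -, -⟩, ⟨C, b, -, -⟩, -⟩ := id hF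
  have key := hF.abs_integral_pi_sub_gaussian_le (by positivity) hE hG c 0
  have hv : (∑ i, c i ^ 2).toNNReal = ∑ i, (c i ^ 2).toNNReal :=
    Real.toNNReal_sum_of_nonneg fun i _ => sq_nonneg _
  rw [← hv] at key
  simp only [zero_add] at key
  have mS : Measurable fun w : Fin n → ℝ => F (∑ i, c i * w i) := m.comp (by fun_prop)
  rw [integral_pi_map_sub_one mS] at key
  have near : ∀ {α : Type} [MeasurableSpace α] (μ : Measure α) [IsProbabilityMeasure μ] (T : α → ℝ),
      Measurable T → |∫ x, F (T x) ∂μ - ∫ x, f (T x) ∂μ| ≤ 2 * h := by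
    intro α _ μ _ T hT
    have m1 : Measurable fun x => F (T x) := m.comp hT
    have m2 : Measurable fun x => f (T x) := hf.measurable.comp hT
    rw [← integral_sub (integrable_of_abs_le m1 fun x => b _)
      (integrable_of_abs_le m2 fun x => hb _)]
    exact abs_integral_le_of_abs_le fun x => hFf _
  have n1 := near (Measure.pi fun _ : Fin n => expMeasure 1) (fun w => ∑ i, c i * (w i - 1))
    (by fun_prop)
  have n2 := near (gaussianReal 0 (∑ i, c i ^ 2).toNNReal) (fun y => y) measurable_id
  have e : 2 * (4 / h ^ 2) * ρ * ∑ i, |c i| ^ 3 = 8 * ρ / h ^ 2 * ∑ i, |c i| ^ 3 := by ring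
  rw [e] at key
  rw [abs_le] at *
  constructor <;> linarith [key.1, key.2, n1.1, n1.2, n2.1, n2.2]

/-- Bounded Lipschitz distance of two centred normal laws. -/
theorem abs_integral_gaussianReal_sub_le {f : ℝ → ℝ} (hb : ∀ x, |f x| ≤ 1)
    (hL : ∀ x y, |f x - f y| ≤ |x - y|) {a b : ℝ} (ha : 0 ≤ a) (hab : 0 ≤ b) :
    |∫ y, f y ∂(gaussianReal 0 a.toNNReal) - ∫ y, f y ∂(gaussianReal 0 b.toNNReal)|
      ≤ √|a - b| := by
  have hf : Continuous f :=
    (LipschitzWith.of_dist_le_mul (K := 1) fun x y => by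
      simpa [Real.dist_eq] using hL x y).continuous
  -- Both laws are coupled by scaling one standard normal variable. The resulting bound in terms of
  -- `√|a - b|` needs no lower bound on the variances, so a degenerate limit is allowed.
  have e : ∀ {a : ℝ}, 0 ≤ a → ∫ y, f y ∂(gaussianReal 0 a.toNNReal)
      = ∫ y, f (√a * y) ∂(gaussianReal 0 1) := by
    intro a ha
    have h' := gaussianReal_map_mul (√a)
    rw [Real.sq_sqrt ha] at h'
    rw [← h', integral_map (by fun_prop) hf.aestronglyMeasurable]
  have hv : ∫ y, y ^ 2 ∂(gaussianReal 0 1) = 1 := by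
    have := variance_fun_id_gaussianReal (μ := 0) (v := 1)
    rw [variance_of_integral_eq_zero (by fun_prop) (integral_id_gaussianReal)] at this
    simpa using this
  have i2 : Integrable (fun y : ℝ => y ^ 2) (gaussianReal 0 1) := by
    simpa using (memLp_id_gaussianReal (μ := 0) (v := 1) 2).integrable_sq
  have i1 : Integrable (fun y : ℝ => |y|) (gaussianReal 0 1) := by
    simpa using ((memLp_id_gaussianReal (μ := 0) (v := 1) 1).integrable (by simp)).abs
  have habs : ∫ y, |y| ∂(gaussianReal 0 1) ≤ 1 := by
    calc ∫ y, |y| ∂(gaussianReal 0 1) ≤ ∫ y, (y ^ 2 + 1) / 2 ∂(gaussianReal 0 1) := by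
          refine integral_mono i1 ((i2.add (integrable_const 1)).div_const 2) fun y => ?_
          simp only
          nlinarith [sq_nonneg (|y| - 1), sq_abs y]
      _ = 1 := by
          rw [integral_div, integral_add i2 (integrable_const 1), hv]; simp
  have hs : |√a - √b| ≤ √|a - b| := by
    apply Real.le_sqrt_of_sq_le
    rw [sq_abs]
    have := Real.sq_sqrt ha
    have := Real.sq_sqrt hab
    have p1 := Real.sqrt_nonneg a
    have p2 := Real.sqrt_nonneg b
    rcases le_total b a with h | h
    · rw [abs_of_nonneg (by linarith)]
      nlinarith [Real.sqrt_le_sqrt h, mul_nonneg p2 (sub_nonneg.mpr (Real.sqrt_le_sqrt h))]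
    · rw [abs_of_nonpos (by linarith)]
      nlinarith [Real.sqrt_le_sqrt h, mul_nonneg p1 (sub_nonneg.mpr (Real.sqrt_le_sqrt h))]
  have hi : ∀ c : ℝ, Integrable (fun y => f (c * y)) (gaussianReal 0 1) := fun c =>
    integrable_of_abs_le (hf.measurable.comp (by fun_prop)) fun x => hb _
  rw [e ha, e hab, ← integral_sub (hi _) (hi _)]
  calc _ ≤ ∫ y, |f (√a * y) - f (√b * y)| ∂(gaussianReal 0 1) := abs_integral_le_integral_abs
    _ ≤ ∫ y, |√a - √b| * |y| ∂(gaussianReal 0 1) := by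
        refine integral_mono ?_ (i1.const_mul _) fun y => ?_
        · exact ((hi _).sub (hi _)).abs
        · refine (hL _ _).trans (le_of_eq ?_)
          rw [← sub_mul, abs_mul]
    _ = |√a - √b| * ∫ y, |y| ∂(gaussianReal 0 1) := integral_const_mul _ _
    _ ≤ |√a - √b| * 1 := mul_le_mul_of_nonneg_left habs (abs_nonneg _)
    _ ≤ _ := by rw [mul_one]; exact hs

/-! ### Concentration for i.i.d. sums -/

section Concentration

variable {Ω : Type*} [MeasurableSpace Ω] {μ : Measure Ω} [IsProbabilityMeasure μ]

/-- Chernoff bound for the maximum of finitely many sums of i.i.d. variables. -/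
theorem measureReal_pi_exists_lt_sum_le {ι : Type*} [Fintype ι] {ξ : ι → Ω → ℝ} {lam V : ℝ}
    (hlam : 0 ≤ lam) (hi : ∀ m, Integrable (fun o => Real.exp (lam * ξ m o)) μ)
    (hV : ∀ m, ∫ o, Real.exp (lam * ξ m o) ∂μ ≤ Real.exp V) (n : ℕ) (t : ℝ) :
    (Measure.pi fun _ : Fin n => μ).real {x | ∃ m, t < ∑ i, ξ m (x i)}
      ≤ Fintype.card ι * Real.exp (n * V - lam * t) := by
  have hset : {x : Fin n → Ω | ∃ m, t < ∑ i, ξ m (x i)} = ⋃ m, {x | t < ∑ i, ξ m (x i)} := by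
    ext x; simp
  rw [hset]
  refine (measureReal_iUnion_fintype_le _).trans ?_
  have h1 : ∀ m, (Measure.pi fun _ : Fin n => μ).real {x | t < ∑ i, ξ m (x i)}
      ≤ Real.exp (n * V - lam * t) := by
    intro m
    have e : ∀ x : Fin n → Ω, Real.exp (lam * ∑ i, ξ m (x i)) = ∏ i, Real.exp (lam * ξ m (x i)) :=
      fun x => by rw [Finset.mul_sum, Real.exp_sum]
    have hI : Integrable (fun x : Fin n → Ω => Real.exp (lam * ∑ i, ξ m (x i)))
        (Measure.pi fun _ : Fin n => μ) := by
      simp only [e]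
      exact Integrable.fintype_prod (f := fun _ o => Real.exp (lam * ξ m o)) fun _ => hi m
    have h := measure_ge_le_exp_mul_mgf t hlam hI
    have hm : mgf (fun x : Fin n → Ω => ∑ i, ξ m (x i)) (Measure.pi fun _ : Fin n => μ) lam
        ≤ Real.exp (n * V) := by
      rw [mgf]
      simp only [e]
      rw [integral_fintype_prod_eq_pow (fun o => Real.exp (lam * ξ m o)), Fintype.card_fin,
        Real.exp_nat_mul]
      exact pow_le_pow_left₀ (integral_nonneg fun o => Real.exp_nonneg _) (hV m) n
    calc _ ≤ _ := measureReal_mono (fun x (hx : t < _) => hx.le)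
      _ ≤ _ := h
      _ ≤ Real.exp (-lam * t) * Real.exp (n * V) :=
          mul_le_mul_of_nonneg_left hm (Real.exp_nonneg _)
      _ = _ := by rw [← Real.exp_add]; congr 1; ring
  calc _ ≤ ∑ _m : ι, Real.exp (n * V - lam * t) := Finset.sum_le_sum fun m _ => h1 m
    _ = _ := by simp

/-- Two-sided Chernoff bound for the maximum of finitely many sums of i.i.d. variables. -/
theorem measureReal_pi_exists_lt_abs_sum_le {ι : Type*} [Fintype ι] {ξ : ι → Ω → ℝ} {lam V : ℝ}
    (hlam : 0 ≤ lam)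
    (hi : ∀ m s, |s| ≤ lam → Integrable (fun o => Real.exp (s * ξ m o)) μ)
    (hV : ∀ m s, |s| ≤ lam → ∫ o, Real.exp (s * ξ m o) ∂μ ≤ Real.exp V) (n : ℕ) (t : ℝ) :
    (Measure.pi fun _ : Fin n => μ).real {x | ∃ m, t < |∑ i, ξ m (x i)|}
      ≤ 2 * Fintype.card ι * Real.exp (n * V - lam * t) := by
  have h1 := measureReal_pi_exists_lt_sum_le hlam (fun m => hi m lam (abs_of_nonneg hlam).le)
    (fun m => hV m lam (abs_of_nonneg hlam).le) n t
  have hn : |-lam| ≤ lam := by rw [abs_neg, abs_of_nonneg hlam]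
  have h2 := measureReal_pi_exists_lt_sum_le (ξ := fun m o => -ξ m o) hlam
    (fun m => by simpa using hi m (-lam) hn) (fun m => by simpa using hV m (-lam) hn) n t
  refine (measureReal_mono (fun x hx => ?_)).trans
    ((measureReal_union_le _ _).trans ((add_le_add h1 h2).trans (le_of_eq (by ring))))
  obtain ⟨m, hm⟩ := hx
  rcases lt_abs.mp hm with h | h
  · exact Or.inl ⟨m, h⟩
  · exact Or.inr ⟨m, by simpa using h⟩

/-- Chebyshev's inequality for a sum of i.i.d. centred variables. -/
theorem measureReal_pi_lt_abs_sum_le {g : Ω → ℝ} (hg : MemLp g 2 μ) (h0 : ∫ o, g o ∂μ = 0)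
    {n : ℕ} (hn : 0 < n) {t : ℝ} (ht : 0 < t) :
    (Measure.pi fun _ : Fin n => μ).real {x | t * √n < |∑ i, g (x i)|}
      ≤ (∫ o, g o ^ 2 ∂μ) / t ^ 2 := by
  set S : (Fin n → Ω) → ℝ := fun x => ∑ i, g (x i) with hS
  have hmem : ∀ i : Fin n, MemLp (fun x : Fin n → Ω => g (x i)) 2 (Measure.pi fun _ => μ) :=
    fun i => hg.comp_measurePreserving (measurePreserving_eval (fun _ : Fin n => μ) i)
  have hL : MemLp S 2 (Measure.pi fun _ : Fin n => μ) := memLp_finsetSum _ fun i _ => hmem i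
  have hE : ∫ x, S x ∂(Measure.pi fun _ : Fin n => μ) = 0 := by
    rw [hS, integral_finsetSum _ fun i _ => (hmem i).integrable (by norm_num)]
    refine Finset.sum_eq_zero fun i _ => ?_
    rw [integral_comp_eval (μ := fun _ : Fin n => μ) hg.aestronglyMeasurable, h0]
  have hVar : Var[S; Measure.pi fun _ : Fin n => μ] = n * ∫ o, g o ^ 2 ∂μ := by
    have := variance_sum_pi (μ := fun _ : Fin n => μ) (X := fun _ => g) fun _ => hg
    have e : S = ∑ i, fun x : Fin n → Ω => g (x i) := by funext x; simp [hS]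
    rw [e, this]
    simp [variance_of_integral_eq_zero hg.aestronglyMeasurable.aemeasurable h0]
  have hn' : (0 : ℝ) < √n := Real.sqrt_pos.mpr (by exact_mod_cast hn)
  have h := meas_ge_le_variance_div_sq hL (mul_pos ht hn')
  rw [hE, hVar, mul_pow, Real.sq_sqrt (by positivity)] at h
  have e : (n : ℝ) * (∫ o, g o ^ 2 ∂μ) / (t ^ 2 * n) = (∫ o, g o ^ 2 ∂μ) / t ^ 2 := by
    have : (n : ℝ) ≠ 0 := by positivity
    field_simp
  rw [e] at h
  refine ENNReal.toReal_le_of_le_ofReal (by positivity) ((measure_mono fun x hx => ?_).trans h)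
  simpa using (le_of_lt hx : _ ≤ _)

/-- Markov's inequality for an average of i.i.d. nonnegative variables. -/
theorem measureReal_pi_lt_sum_le {g : Ω → ℝ} (hg : Integrable g μ) (h0 : ∀ o, 0 ≤ g o)
    (n : ℕ) {t : ℝ} (ht : 0 < t) :
    (Measure.pi fun _ : Fin n => μ).real {x | t < ∑ i, g (x i)} ≤ n * (∫ o, g o ∂μ) / t := by
  have hi : ∀ i : Fin n, Integrable (fun x : Fin n → Ω => g (x i)) (Measure.pi fun _ => μ) :=
    fun i => integrable_comp_eval (μ := fun _ : Fin n => μ) hg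
  have h := mul_meas_ge_le_integral_of_nonneg (μ := Measure.pi fun _ : Fin n => μ)
    (f := fun x => ∑ i, g (x i)) (Eventually.of_forall fun x => Finset.sum_nonneg fun i _ => h0 _)
    (integrable_finsetSum _ fun i _ => hi i) t
  rw [integral_finsetSum _ fun i _ => hi i] at h
  simp only [integral_comp_eval (μ := fun _ : Fin n => μ) hg.aestronglyMeasurable] at h
  rw [le_div_iff₀ ht, mul_comm]
  refine le_trans (mul_le_mul_of_nonneg_left (measureReal_mono fun x hx => ?_) ht.le)
    (h.trans (le_of_eq (by simp)))
  exact le_of_lt (show t < ∑ i, g (x i) from hx)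

/-- A weak law of large numbers, uniform over nonnegative variables `ξ²` with a bounded third
absolute moment of `ξ`. -/
theorem exists_measureReal_pi_abs_average_sq_sub_le (K : ℝ) {η τ : ℝ} (hη : 0 < η) (hτ : 0 < τ) :
    ∃ N : ℕ, ∀ n ≥ N, ∀ {Ω : Type} [MeasurableSpace Ω] (μ : Measure Ω) [IsProbabilityMeasure μ]
      (ξ : Ω → ℝ), Measurable ξ → Integrable (fun o => |ξ o| ^ 3) μ → ∫ o, |ξ o| ^ 3 ∂μ ≤ K →
      (Measure.pi fun _ : Fin n => μ).real
        {x | η < |(n : ℝ)⁻¹ * ∑ i, ξ (x i) ^ 2 - ∫ o, ξ o ^ 2 ∂μ|} ≤ τ := by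
  -- `ξ²` need not have a variance, so it is cut at `|ξ| = A`. Chebyshev handles the bounded part
  -- `b`; the tail `c` has mean at most `|K| / A` and is handled by Markov. The first summand of `A`
  -- makes that mean at most `η / 3`, the second makes the Markov bound at most `τ / 2`.
  set A : ℝ := 3 * |K| / η + 6 * |K| / (η * τ) + 1 with hA
  have hA0 : 0 < A := by positivity
  have hA1 : |K| / A ≤ η / 3 := by
    rw [div_le_iff₀ hA0]
    have e : η / 3 * A = |K| + 2 * |K| / τ + η / 3 := by rw [hA]; field_simp; ring
    have : 0 ≤ 2 * |K| / τ := by positivity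
    rw [e]; linarith
  have hA2 : |K| / A / (η / 3) ≤ τ / 2 := by
    rw [div_le_iff₀ (by positivity), div_le_iff₀ hA0]
    have e : τ / 2 * (η / 3) * A = |K| + τ * |K| / 2 + τ * η / 6 := by rw [hA]; field_simp; ring
    have : 0 ≤ τ * |K| / 2 := by positivity
    have : 0 ≤ τ * η / 6 := by positivity
    rw [e]; linarith
  obtain ⟨N, hN⟩ := exists_nat_gt (A ^ 4 / (η / 3) ^ 2 / (τ / 2))
  refine ⟨N + 1, fun n hn Ω _ μ _ ξ hξ hi hK => ?_⟩
  have hn0 : 0 < n := by omega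
  have hnR : (0 : ℝ) < n := by exact_mod_cast hn0
  set b : Ω → ℝ := fun o => if |ξ o| ≤ A then ξ o ^ 2 else 0 with hb
  set c : Ω → ℝ := fun o => if |ξ o| ≤ A then 0 else ξ o ^ 2 with hc
  have hbm : Measurable b :=
    Measurable.ite (measurableSet_le (by fun_prop) measurable_const) (by fun_prop) (by fun_prop)
  have hcm : Measurable c :=
    Measurable.ite (measurableSet_le (by fun_prop) measurable_const) (by fun_prop) (by fun_prop)
  have hbb : ∀ o, 0 ≤ b o ∧ b o ≤ A ^ 2 := fun o => by
    simp only [hb]; split_ifs with h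
    · exact ⟨sq_nonneg _, by rw [← sq_abs]; gcongr⟩
    · exact ⟨le_rfl, by positivity⟩
  have hc0 : ∀ o, 0 ≤ c o := fun o => by
    simp only [hc]; split_ifs
    exacts [le_rfl, sq_nonneg _]
  have hcA : ∀ o, c o ≤ |ξ o| ^ 3 / A := fun o => by
    simp only [hc]; split_ifs with h
    · positivity
    · rw [le_div_iff₀ hA0, ← sq_abs]
      nlinarith [sq_nonneg |ξ o|, not_le.mp h]
  have hsum : ∀ o, ξ o ^ 2 = b o + c o := fun o => by simp only [hb, hc]; split_ifs <;> simp
  have hbi : Integrable b μ := integrable_of_abs_le hbm (C := A ^ 2) fun o => by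
    rw [abs_of_nonneg (hbb o).1]; exact (hbb o).2
  have hci : Integrable c μ := (hi.div_const A).mono' hcm.aestronglyMeasurable
    (Eventually.of_forall fun o => by rw [Real.norm_of_nonneg (hc0 o)]; exact hcA o)
  have hcI : ∫ o, c o ∂μ ≤ |K| / A := by
    calc _ ≤ ∫ o, |ξ o| ^ 3 / A ∂μ := integral_mono hci (hi.div_const A) hcA
      _ = (∫ o, |ξ o| ^ 3 ∂μ) / A := integral_div _ _
      _ ≤ _ := by gcongr; exact hK.trans (le_abs_self K)
  have hcI0 : 0 ≤ ∫ o, c o ∂μ := integral_nonneg hc0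
  have hbI : 0 ≤ ∫ o, b o ∂μ ∧ ∫ o, b o ∂μ ≤ A ^ 2 := by
    refine ⟨integral_nonneg fun o => (hbb o).1, ?_⟩
    calc _ ≤ ∫ _o, A ^ 2 ∂μ := integral_mono hbi (integrable_const _) fun o => (hbb o).2
      _ = _ := by simp
  set g : Ω → ℝ := fun o => b o - ∫ o, b o ∂μ with hg
  have hgb : ∀ o, |g o| ≤ A ^ 2 := fun o => by
    rw [abs_le]; simp only [hg]
    constructor <;> linarith [(hbb o).1, (hbb o).2, hbI.1, hbI.2]
  have hgm : Measurable g := hbm.sub_const _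
  have hgL : MemLp g 2 μ := MemLp.of_bound hgm.aestronglyMeasurable (A ^ 2)
    (Eventually.of_forall hgb)
  have hg0 : ∫ o, g o ∂μ = 0 := by
    rw [hg, integral_sub hbi (integrable_const _)]; simp
  have hg2 : ∫ o, g o ^ 2 ∂μ ≤ A ^ 4 := by
    calc _ ≤ ∫ _o, A ^ 4 ∂μ := integral_mono hgL.integrable_sq (integrable_const _) fun o => by
          have := hgb o
          simp only
          rw [← sq_abs]
          calc |g o| ^ 2 ≤ (A ^ 2) ^ 2 := by gcongr
            _ = A ^ 4 := by ring
      _ = _ := by simp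
  have hs : √(n : ℝ) * √n = n := Real.mul_self_sqrt hnR.le
  have hsp : 0 < √(n : ℝ) := Real.sqrt_pos.mpr hnR
  have p1 := measureReal_pi_lt_abs_sum_le hgL hg0 hn0 (t := η / 3 * √n) (by positivity)
  have p2 := measureReal_pi_lt_sum_le hci hc0 n (t := n * (η / 3)) (by positivity)
  have q1 : (∫ o, g o ^ 2 ∂μ) / (η / 3 * √n) ^ 2 ≤ τ / 2 := by
    rw [mul_pow, Real.sq_sqrt hnR.le, div_le_iff₀ (by positivity)]
    refine hg2.trans ?_
    have : A ^ 4 / (η / 3) ^ 2 / (τ / 2) < n :=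
      hN.trans (by exact_mod_cast (by omega : N < n))
    rw [div_lt_iff₀ (by positivity), div_lt_iff₀ (by positivity)] at this
    linarith
  have q2 : n * (∫ o, c o ∂μ) / (n * (η / 3)) ≤ τ / 2 := by
    rw [mul_div_mul_left _ _ hnR.ne']
    refine le_trans ?_ hA2
    gcongr
  refine (measureReal_mono (fun x hx => ?_)).trans ((measureReal_union_le _ _).trans
    ((add_le_add (p1.trans q1) (p2.trans q2)).trans (le_of_eq (by ring))))
  by_contra hcon
  simp only [Set.mem_union, Set.mem_ofPred_eq, not_or, not_lt] at hcon hx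
  obtain ⟨c1, c2⟩ := hcon
  refine absurd hx (not_lt.mpr ?_)
  have hI : ∫ o, ξ o ^ 2 ∂μ = ∫ o, b o ∂μ + ∫ o, c o ∂μ := by
    simp only [hsum]; exact integral_add hbi hci
  have hS : ∑ i, ξ (x i) ^ 2 = ∑ i, g (x i) + n * ∫ o, b o ∂μ + ∑ i, c (x i) := by
    simp only [hsum, hg, Finset.sum_add_distrib, Finset.sum_sub_distrib]
    simp
  have hS0 : 0 ≤ ∑ i, c (x i) := Finset.sum_nonneg fun i _ => hc0 _
  have e : (n : ℝ)⁻¹ * ∑ i, ξ (x i) ^ 2 - ∫ o, ξ o ^ 2 ∂μ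
      = (n : ℝ)⁻¹ * ∑ i, g (x i) + (n : ℝ)⁻¹ * ∑ i, c (x i) - ∫ o, c o ∂μ := by
    rw [hI, hS]; field_simp; ring
  have k1 : |(n : ℝ)⁻¹ * ∑ i, g (x i)| ≤ η / 3 := by
    rw [abs_mul, abs_of_pos (inv_pos.mpr hnR), inv_mul_le_iff₀ hnR]
    refine c1.trans (le_of_eq ?_)
    rw [mul_assoc, hs]; ring
  have k2 : (n : ℝ)⁻¹ * ∑ i, c (x i) ≤ η / 3 := by
    rw [inv_mul_le_iff₀ hnR]; exact c2
  have k3 : 0 ≤ (n : ℝ)⁻¹ * ∑ i, c (x i) := by positivity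
  rw [e, abs_le]
  rw [abs_le] at k1
  constructor <;> linarith [k1.1, k1.2]

/-- The measurable function `a` has the exponential moment `E exp (|a| / κ) ≤ 2`. -/
structure HasExpMoment (μ : Measure Ω) (κ : ℝ) (a : Ω → ℝ) : Prop where
  measurable : Measurable a
  integrable : Integrable (fun o => Real.exp (|a o| / κ)) μ
  integral_le : ∫ o, Real.exp (|a o| / κ) ∂μ ≤ 2

theorem HasExpMoment.integrable_abs_pow {ν : Measure Ω} {κ : ℝ} {a : Ω → ℝ}
    (h : HasExpMoment ν κ a) (hκ : 0 < κ) (k : ℕ) : Integrable (fun o => |a o| ^ k) ν := by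
  have hm := h.measurable
  refine (h.integrable.const_mul (κ ^ k * k.factorial)).mono'
    (by fun_prop) (Eventually.of_forall fun o => ?_)
  rw [Real.norm_of_nonneg (by positivity)]
  have := Real.pow_div_factorial_le_exp (|a o| / κ) (by positivity) k
  rw [div_le_iff₀ (by positivity), div_pow, div_le_iff₀ (by positivity)] at this
  linarith

theorem HasExpMoment.integral_sq_le {ν : Measure Ω} {κ : ℝ} {a : Ω → ℝ} (h : HasExpMoment ν κ a)
    (hκ : 0 < κ) : ∫ o, a o ^ 2 ∂ν ≤ 4 * κ ^ 2 := by
  have i2 : Integrable (fun o => a o ^ 2) ν := by simpa using h.integrable_abs_pow hκ 2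
  calc _ ≤ ∫ o, 2 * κ ^ 2 * Real.exp (|a o| / κ) ∂ν := by
        refine integral_mono i2 (h.integrable.const_mul _) fun o => ?_
        have := Real.pow_div_factorial_le_exp (|a o| / κ) (by positivity) 2
        rw [div_le_iff₀ (by positivity), div_pow, div_le_iff₀ (by positivity)] at this
        simp only [Nat.factorial] at this
        simp only
        rw [← sq_abs]
        push_cast at this
        linarith
    _ = 2 * κ ^ 2 * ∫ o, Real.exp (|a o| / κ) ∂ν := integral_const_mul _ _
    _ ≤ 2 * κ ^ 2 * 2 := mul_le_mul_of_nonneg_left h.integral_le (by positivity)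
    _ = _ := by ring

theorem exp_le_one_add_add_sq_mul_exp_abs (x : ℝ) :
    Real.exp x ≤ 1 + x + x ^ 2 * Real.exp |x| := by
  rcases le_or_gt |x| 1 with h | h
  · have h1 := Real.norm_exp_sub_one_sub_id_le (x := x) (by simpa using h)
    have h2 : x ^ 2 ≤ x ^ 2 * Real.exp |x| :=
      le_mul_of_one_le_right (sq_nonneg _) (Real.one_le_exp (abs_nonneg x))
    rw [Real.norm_eq_abs, Real.norm_eq_abs, sq_abs] at h1
    linarith [le_of_abs_le h1]
  · rcases lt_abs.mp h with h' | h'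
    · have h2 : Real.exp x ≤ x ^ 2 * Real.exp |x| := by
        rw [abs_of_pos (by linarith)]
        exact le_mul_of_one_le_left (Real.exp_nonneg _) (by nlinarith)
      linarith
    · have h1 : Real.exp x ≤ 1 := Real.exp_le_one_iff.mpr (by linarith)
      have h2 : x ^ 2 ≤ x ^ 2 * Real.exp |x| :=
        le_mul_of_one_le_right (sq_nonneg _) (Real.one_le_exp (abs_nonneg x))
      nlinarith

/-- A Bernstein estimate: the linear term integrates to zero. As `|s a| ≤ |a| / (2κ)`, half of the
exponential moment pays for `exp |s a|` and the other half for the factor `(s a)²`. -/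
theorem HasExpMoment.exp_mul_centred {κ : ℝ} {a : Ω → ℝ} (h : HasExpMoment μ κ a) (hκ : 0 < κ)
    (h0 : ∫ o, a o ∂μ = 0) {s lam : ℝ} (hs : |s| ≤ lam) (hlam : lam ≤ 1 / (2 * κ)) :
    Integrable (fun o => Real.exp (s * a o)) μ ∧
      ∫ o, Real.exp (s * a o) ∂μ ≤ Real.exp (16 * κ ^ 2 * lam ^ 2) := by
  have hm := h.measurable
  have hsa : ∀ o, |s * a o| ≤ |a o| / κ / 2 := fun o => by
    rw [abs_mul]
    calc |s| * |a o| ≤ 1 / (2 * κ) * |a o| :=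
          mul_le_mul_of_nonneg_right (hs.trans hlam) (abs_nonneg _)
      _ = _ := by field_simp
  have hI : Integrable (fun o => Real.exp (s * a o)) μ := by
    refine h.integrable.mono' (by fun_prop) (Eventually.of_forall fun o => ?_)
    rw [Real.norm_of_nonneg (Real.exp_nonneg _)]
    apply Real.exp_le_exp.mpr
    have : 0 ≤ |a o| / κ := by positivity
    linarith [hsa o, le_abs_self (s * a o)]
  have i1 : Integrable a μ := by
    have := h.integrable_abs_pow hκ 1
    simp only [pow_one] at this
    exact (integrable_norm_iff hm.aestronglyMeasurable).mp this
  refine ⟨hI, ?_⟩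
  have hb : ∀ o, Real.exp (s * a o) ≤ 1 + s * a o + 8 * κ ^ 2 * lam ^ 2 * Real.exp (|a o| / κ) := by
    intro o
    refine (exp_le_one_add_add_sq_mul_exp_abs _).trans (add_le_add_right ?_ _)
    set y := |a o| / κ with hy
    have hy0 : 0 ≤ y := by positivity
    have h1 := Real.quadratic_le_exp_of_nonneg (by linarith : 0 ≤ y / 2)
    have h2 : y ^ 2 ≤ 8 * Real.exp (y / 2) := by nlinarith
    have h3 : (s * a o) ^ 2 ≤ κ ^ 2 * lam ^ 2 * y ^ 2 := by
      have e : κ ^ 2 * lam ^ 2 * y ^ 2 = (lam * |a o|) ^ 2 := by rw [hy]; field_simp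
      rw [e, ← sq_abs, abs_mul]
      gcongr
    calc (s * a o) ^ 2 * Real.exp |s * a o|
        ≤ (κ ^ 2 * lam ^ 2 * (8 * Real.exp (y / 2))) * Real.exp (y / 2) := by
          refine mul_le_mul (h3.trans (by gcongr)) (Real.exp_le_exp.mpr (hsa o))
            (Real.exp_nonneg _) (by positivity)
      _ = 8 * κ ^ 2 * lam ^ 2 * (Real.exp (y / 2) * Real.exp (y / 2)) := by ring
      _ = _ := by rw [← Real.exp_add, add_halves]
  have i3 := h.integrable.const_mul (8 * κ ^ 2 * lam ^ 2)
  have i4 : Integrable (fun o => 1 + s * a o) μ := (integrable_const _).add (i1.const_mul s)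
  calc _ ≤ ∫ o, (1 + s * a o + 8 * κ ^ 2 * lam ^ 2 * Real.exp (|a o| / κ)) ∂μ :=
        integral_mono hI (i4.add i3) hb
    _ = 1 + 8 * κ ^ 2 * lam ^ 2 * ∫ o, Real.exp (|a o| / κ) ∂μ := by
        rw [integral_add i4 i3, integral_add (integrable_const _) (i1.const_mul s),
          integral_const_mul, integral_const_mul, h0]
        simp
    _ ≤ 1 + 8 * κ ^ 2 * lam ^ 2 * 2 := by gcongr; exact h.integral_le
    _ ≤ Real.exp (16 * κ ^ 2 * lam ^ 2) := by
        linarith [Real.add_one_le_exp (16 * κ ^ 2 * lam ^ 2)]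

/-- The value of `a` if it is at most `B` in absolute value, and zero otherwise. -/
noncomputable def truncate (B : ℝ) (a : Ω → ℝ) (o : Ω) : ℝ := if |a o| ≤ B then a o else 0

theorem measurable_truncate (B : ℝ) {a : Ω → ℝ} (ha : Measurable a) : Measurable (truncate B a) :=
  Measurable.ite (measurableSet_le (by fun_prop) measurable_const) ha measurable_const

/-- Truncation keeps the exponent within the range of the exponential generating function once `a`
is fixed. Integrating the weight first leaves only the second moment of `a`. Centring comes from the
weight, so `a` need not have mean zero. The constant 16 is that of `HasExpMoment.exp_mul_centred`,
so one Chernoff computation serves both. -/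
theorem HasExpMoment.exp_mul_multiplier {κ : ℝ} {a : Ω → ℝ} (h : HasExpMoment μ κ a) (hκ : 0 < κ)
    {s lam B : ℝ} (hB : 0 ≤ B) (hs : |s| ≤ lam) (hlam : lam * B ≤ 1 / 2) :
    Integrable (fun q : Ω × ℝ => Real.exp (s * (truncate B a q.1 * (q.2 - 1))))
        (μ.prod (expMeasure 1)) ∧
      ∫ q, Real.exp (s * (truncate B a q.1 * (q.2 - 1))) ∂(μ.prod (expMeasure 1))
        ≤ Real.exp (16 * κ ^ 2 * lam ^ 2) := by
  have hm := measurable_truncate B h.measurable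
  have hlam0 : 0 ≤ lam := (abs_nonneg s).trans hs
  have htB : ∀ o, |truncate B a o| ≤ B := fun o => by
    unfold truncate; split_ifs with h1
    · exact h1
    · simpa using hB
  have hta : ∀ o, truncate B a o ^ 2 ≤ a o ^ 2 := fun o => by
    unfold truncate; split_ifs with h1
    · exact le_rfl
    · simpa using sq_nonneg (a o)
  have hx : ∀ o, |s * truncate B a o| ≤ 1 / 2 := fun o => by
    rw [abs_mul]
    exact (mul_le_mul hs (htB o) (abs_nonneg _) hlam0).trans hlam
  have hI : Integrable (fun q : Ω × ℝ => Real.exp (s * (truncate B a q.1 * (q.2 - 1))))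
      (μ.prod (expMeasure 1)) := by
    -- One summand dominates for `w ≥ 1`, the other for `w ≤ 1`.
    have d1 : Integrable (fun w : ℝ => Real.exp (1 / 2 * w) + Real.exp 1 * Real.exp (-1 / 2 * w))
        (expMeasure 1) := (integrable_exp_mul_expMeasure_one (by norm_num)).add
      ((integrable_exp_mul_expMeasure_one (by norm_num)).const_mul _)
    refine (d1.comp_snd μ).mono' (by fun_prop) (Eventually.of_forall fun q => ?_)
    rw [Real.norm_of_nonneg (Real.exp_nonneg _), ← mul_assoc]
    have h1 := abs_le.mp (hx q.1)
    rcases le_total 1 q.2 with h2 | h2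
    · have : Real.exp (s * truncate B a q.1 * (q.2 - 1)) ≤ Real.exp (1 / 2 * q.2) :=
        Real.exp_le_exp.mpr (by nlinarith)
      have : 0 ≤ Real.exp 1 * Real.exp (-1 / 2 * q.2) := by positivity
      linarith
    · have : Real.exp (s * truncate B a q.1 * (q.2 - 1)) ≤ Real.exp 1 * Real.exp (-1 / 2 * q.2) := by
        rw [← Real.exp_add]
        exact Real.exp_le_exp.mpr (by nlinarith)
      have : 0 ≤ Real.exp (1 / 2 * q.2) := by positivity
      linarith
  refine ⟨hI, ?_⟩
  rw [integral_prod _ hI]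
  have i2 : Integrable (fun o => a o ^ 2) μ := by simpa using h.integrable_abs_pow hκ 2
  have hin : ∀ o, ∫ w, Real.exp (s * (truncate B a o * (w - 1))) ∂(expMeasure 1)
      ≤ 1 + 2 * lam ^ 2 * a o ^ 2 := by
    intro o
    simp only [← mul_assoc]
    refine (integral_exp_mul_centred_le (hx o)).trans ?_
    set y := (s * truncate B a o) ^ 2 with hy
    have hy0 : 0 ≤ y := sq_nonneg _
    have hy1 : y ≤ 1 / 4 := by
      rw [hy, ← sq_abs]
      calc _ ≤ (1 / 2 : ℝ) ^ 2 := by gcongr; exact hx o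
        _ = _ := by norm_num
    have hy2 : y ≤ lam ^ 2 * a o ^ 2 := by
      rw [hy, mul_pow, ← sq_abs s]
      exact mul_le_mul (by gcongr) (hta o) (sq_nonneg _) (by positivity)
    have h1 := Real.norm_exp_sub_one_sub_id_le (x := y) (by
      rw [Real.norm_of_nonneg hy0]; linarith)
    rw [Real.norm_eq_abs, Real.norm_of_nonneg hy0] at h1
    nlinarith [le_of_abs_le h1]
  calc _ ≤ ∫ o, (1 + 2 * lam ^ 2 * a o ^ 2) ∂μ :=
        integral_mono hI.integral_prod_left ((integrable_const _).add (i2.const_mul _)) hin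
    _ = 1 + 2 * lam ^ 2 * ∫ o, a o ^ 2 ∂μ := by
        rw [integral_add (integrable_const _) (i2.const_mul _), integral_const_mul]; simp
    _ ≤ 1 + 2 * lam ^ 2 * (4 * κ ^ 2) := by gcongr; exact h.integral_sq_le hκ
    _ ≤ Real.exp (16 * κ ^ 2 * lam ^ 2) := by
        have := Real.add_one_le_exp (16 * κ ^ 2 * lam ^ 2)
        have : 0 ≤ κ ^ 2 * lam ^ 2 := by positivity
        linarith

theorem HasExpMoment.measureReal_pi_exists_lt {ι : Type*} [Fintype ι] {κ : ℝ} {a : ι → Ω → ℝ}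
    (h : ∀ m, HasExpMoment μ κ (a m)) (hκ : 0 < κ) (n : ℕ) (B : ℝ) :
    (Measure.pi fun _ : Fin n => μ).real {x | ∃ m i, B < |a m (x i)|}
      ≤ Fintype.card ι * (n * (2 * Real.exp (-B / κ))) := by
  have hset : {x : Fin n → Ω | ∃ m i, B < |a m (x i)|}
      ⊆ ⋃ m, {x | Real.exp (B / κ) < ∑ i, Real.exp (|a m (x i)| / κ)} := by
    rintro x ⟨m, i, hx⟩
    refine Set.mem_iUnion.mpr ⟨m, lt_of_lt_of_le (b := Real.exp (|a m (x i)| / κ)) ?_ ?_⟩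
    · exact Real.exp_lt_exp.mpr (by gcongr)
    · exact Finset.single_le_sum (f := fun i => Real.exp (|a m (x i)| / κ))
        (fun i _ => Real.exp_nonneg _) (Finset.mem_univ i)
  refine (measureReal_mono hset).trans ((measureReal_iUnion_fintype_le _).trans ?_)
  calc _ ≤ ∑ _m : ι, n * (2 * Real.exp (-B / κ)) := by
        refine Finset.sum_le_sum fun m _ => ?_
        refine (measureReal_pi_lt_sum_le (h m).integrable (fun o => Real.exp_nonneg _) n
          (Real.exp_pos _)).trans ?_
        rw [neg_div, Real.exp_neg, div_eq_mul_inv, mul_assoc]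
        gcongr
        exact (h m).integral_le
    _ = _ := by simp

end Concentration

/-! ### Maximal inequalities at the rate `maxRate` -/

/-- The rate of the maximum of `exp (2 L)` averages over a sample of size `n`. -/
noncomputable def maxRate (n : ℕ) (L : ℝ) : ℝ := √(L / n) + Real.log n ^ 2 * L ^ 2 / n

theorem maxRate_nonneg (n : ℕ) (L : ℝ) : 0 ≤ maxRate n L := by
  unfold maxRate; positivity

theorem one_le_log_of_three_le {n : ℕ} (hn : 3 ≤ n) : 1 ≤ Real.log n := by
  rw [Real.le_log_iff_exp_le (by positivity)]
  have : (3 : ℝ) ≤ n := by exact_mod_cast hn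
  linarith [Real.exp_one_lt_d9]

theorem sqrt_mul_le_mul_maxRate {n : ℕ} (hn : 0 < n) (L : ℝ) :
    √(n * L) ≤ n * maxRate n L := by
  have hnR : (0 : ℝ) < n := by exact_mod_cast hn
  have e : (n : ℝ) * √(L / n) = √(n * L) := by
    nth_rewrite 1 [← Real.sqrt_sq hnR.le]
    rw [← Real.sqrt_mul (sq_nonneg _)]
    congr 1; field_simp
  rw [maxRate, mul_add, e]
  have : 0 ≤ (n : ℝ) * (Real.log n ^ 2 * L ^ 2 / n) := by positivity
  linarith

theorem sq_mul_sq_le_mul_maxRate {n : ℕ} (hn : 0 < n) (L : ℝ) :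
    Real.log n ^ 2 * L ^ 2 ≤ n * maxRate n L := by
  have hnR : (0 : ℝ) < n := by exact_mod_cast hn
  have e : (n : ℝ) * (Real.log n ^ 2 * L ^ 2 / n) = Real.log n ^ 2 * L ^ 2 := by field_simp
  rw [maxRate, mul_add, e]
  have : 0 ≤ (n : ℝ) * √(L / n) := by positivity
  linarith

/-- The exponent used in the Chernoff bounds. -/
noncomputable def chernoffExponent (κ : ℝ) (n : ℕ) (L : ℝ) : ℝ :=
  min (√(L / n)) (1 / (4 * κ * (Real.log n + L)))

section

variable {κ L : ℝ} {n : ℕ}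

theorem chernoffExponent_nonneg (hκ : 0 ≤ κ) (hL : 0 ≤ L) : 0 ≤ chernoffExponent κ n L := by
  unfold chernoffExponent
  have := Real.log_natCast_nonneg n
  positivity

theorem chernoffExponent_mul_le (hκ : 1 ≤ κ) (hn : 3 ≤ n) (hL : 1 / 2 ≤ L) :
    chernoffExponent κ n L * (2 * κ * (Real.log n + L)) ≤ 1 / 2 := by
  have h1 := one_le_log_of_three_le hn
  have h2 : chernoffExponent κ n L ≤ _ := min_le_right _ _
  calc _ ≤ 1 / (4 * κ * (Real.log n + L)) * (2 * κ * (Real.log n + L)) := by gcongr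
    _ = _ := by field_simp; norm_num

theorem chernoffExponent_le (hκ : 1 ≤ κ) (hn : 3 ≤ n) (hL : 1 / 2 ≤ L) :
    chernoffExponent κ n L ≤ 1 / (2 * κ) := by
  have h1 := one_le_log_of_three_le hn
  refine (min_le_right _ _).trans (one_div_le_one_div_of_le (by positivity) ?_)
  nlinarith

theorem mul_chernoffExponent_sq_le (hκ : 1 ≤ κ) (hn : 3 ≤ n) (hL : 1 / 2 ≤ L) :
    n * chernoffExponent κ n L ^ 2 ≤ L := by
  have h0 := chernoffExponent_nonneg (n := n) (by linarith : 0 ≤ κ) (by linarith : 0 ≤ L)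
  have hnR : (0 : ℝ) < n := by positivity
  calc _ ≤ n * √(L / n) ^ 2 := by gcongr; exact min_le_left _ _
    _ = L := by rw [Real.sq_sqrt (by positivity)]; field_simp

/-- Each branch of the minimum is matched with one summand of `maxRate`: `√(L / n)` with the
Gaussian one, and the reciprocal of `log n + L` with the other. The second case uses `log n + L ≤ 3
L log n`, which explains the 12. -/
theorem le_chernoffExponent_mul (hκ : 1 ≤ κ) (hn : 3 ≤ n) (hL : 1 / 2 ≤ L) :
    L / (12 * κ) ≤ chernoffExponent κ n L * (n * maxRate n L) := by
  have h1 := one_le_log_of_three_le hn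
  have hn0 : 0 < n := by omega
  have hnR : (0 : ℝ) < n := by exact_mod_cast hn0
  have hL0 : 0 < L := by linarith
  have hr := maxRate_nonneg n L
  unfold chernoffExponent
  rcases min_choice (√(L / n)) (1 / (4 * κ * (Real.log n + L))) with h | h <;> rw [h]
  · calc L / (12 * κ) ≤ L := div_le_self hL0.le (by linarith)
      _ = √(L / n) * √(n * L) := by
          rw [← Real.sqrt_mul (by positivity)]
          have : L / n * (n * L) = L ^ 2 := by field_simp
          rw [this, Real.sqrt_sq hL0.le]
      _ ≤ _ := mul_le_mul_of_nonneg_left (sqrt_mul_le_mul_maxRate hn0 L) (by positivity)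
  · have h2 : Real.log n + L ≤ 3 * (L * Real.log n) := by nlinarith
    calc L / (12 * κ) ≤ 1 / (4 * κ * (3 * (L * Real.log n))) * (Real.log n ^ 2 * L ^ 2) := by
          have e : 1 / (4 * κ * (3 * (L * Real.log n))) * (Real.log n ^ 2 * L ^ 2)
            = L / (12 * κ) * Real.log n := by field_simp; norm_num
          rw [e]
          exact le_mul_of_one_le_right (by positivity) h1
      _ ≤ _ := by
          refine mul_le_mul ?_ (sq_mul_sq_le_mul_maxRate hn0 L) (by positivity) (by positivity)
          exact one_div_le_one_div_of_le (by positivity) (by gcongr)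

/-- In the lower bound on `M`, `12 κ` undoes the loss in `le_chernoffExponent_mul`, `16 κ ^ 2` beats
the generating function, `2` pays for the union over `N ≤ exp (2 L)` sums, and `A` is the decay that
remains. -/
theorem exp_chernoff_le {N M A : ℝ} (hκ : 1 ≤ κ) (hn : 3 ≤ n) (hL : 1 / 2 ≤ L)
    (hN : N ≤ Real.exp (2 * L)) (hM : 12 * κ * (16 * κ ^ 2 + 2 + A) ≤ M) (hA : 0 ≤ A) :
    2 * N * Real.exp (n * (16 * κ ^ 2 * chernoffExponent κ n L ^ 2)
      - chernoffExponent κ n L * (M * (n * maxRate n L))) ≤ 2 * Real.exp (-A * L) := by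
  have h1 := mul_chernoffExponent_sq_le hκ hn hL
  have h2 := le_chernoffExponent_mul hκ hn hL
  have hL0 : 0 < L := by linarith
  have hr := maxRate_nonneg n L
  have h0 := chernoffExponent_nonneg (n := n) (by linarith : 0 ≤ κ) hL0.le
  have h3 : L / (12 * κ) * (12 * κ * (16 * κ ^ 2 + 2 + A))
      ≤ chernoffExponent κ n L * (n * maxRate n L) * M := by
    have hM0 : 0 ≤ M := le_trans (by positivity) hM
    exact mul_le_mul h2 hM (by positivity) ((by positivity : 0 ≤ L / (12 * κ)).trans h2)
  have e : L / (12 * κ) * (12 * κ * (16 * κ ^ 2 + 2 + A)) = L * (16 * κ ^ 2 + 2 + A) := by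
    field_simp
  rw [e] at h3
  have h4 : n * (16 * κ ^ 2 * chernoffExponent κ n L ^ 2) ≤ 16 * κ ^ 2 * L := by
    calc _ = 16 * κ ^ 2 * (n * chernoffExponent κ n L ^ 2) := by ring
      _ ≤ _ := by gcongr
  calc _ ≤ 2 * Real.exp (2 * L) * Real.exp (n * (16 * κ ^ 2 * chernoffExponent κ n L ^ 2)
      - chernoffExponent κ n L * (M * (n * maxRate n L))) := by gcongr
    _ = 2 * Real.exp (2 * L + (n * (16 * κ ^ 2 * chernoffExponent κ n L ^ 2)
      - chernoffExponent κ n L * (M * (n * maxRate n L)))) := by rw [mul_assoc, ← Real.exp_add]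
    _ ≤ _ := by gcongr; nlinarith

end

section

variable {Ω : Type*} [MeasurableSpace Ω] {μ : Measure Ω} [IsProbabilityMeasure μ]
  {ι : Type*} [Fintype ι]

/-- Transport of an event of i.i.d. pairs to a product of two samples. -/
theorem prod_pi_apply_pairs {α : Type*} [MeasurableSpace α] (ν : Measure α)
    [IsProbabilityMeasure ν] (n : ℕ) (A : Set (Fin n → Ω × α)) :
    ((Measure.pi fun _ : Fin n => μ).prod (Measure.pi fun _ : Fin n => ν))
      {q | (fun i => (q.1 i, q.2 i)) ∈ A} = (Measure.pi fun _ : Fin n => μ.prod ν) A := by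
  have h := measurePreserving_arrowProdEquivProdArrow Ω α (Fin n) (fun _ => μ) (fun _ => ν)
  exact (h.symm _).measure_preimage_equiv A

/-- Unless some `|a m|` exceeds `B` in the sample, truncation changes nothing and the Chernoff bound
applies. With `B = 2 κ (log n + L)` the exceptional event costs at most `exp (2 L) * n * 2 * exp (-B
/ κ) = 2 / n`. -/
theorem HasExpMoment.measureReal_multiplier_le {κ L M A : ℝ} {a : ι → Ω → ℝ} {n : ℕ}
    (h : ∀ m, HasExpMoment μ κ (a m)) (hκ : 1 ≤ κ) (hn : 3 ≤ n) (hL : 1 / 2 ≤ L)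
    (hN : (Fintype.card ι : ℝ) ≤ Real.exp (2 * L))
    (hM : 12 * κ * (16 * κ ^ 2 + 2 + A) ≤ M) (hA : 0 ≤ A) :
    ((Measure.pi fun _ : Fin n => μ).prod (Measure.pi fun _ : Fin n => expMeasure 1)).real
      {q | ∃ m, M * (n * maxRate n L) < |∑ i, a m (q.1 i) * (q.2 i - 1)|}
      ≤ 2 / n + 2 * Real.exp (-A * L) := by
  have hκ0 : 0 < κ := by linarith
  have hlog := one_le_log_of_three_le hn
  have hnR : (0 : ℝ) < n := by positivity
  set B := 2 * κ * (Real.log n + L) with hB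
  have hB0 : 0 ≤ B := by positivity
  have hlam0 := chernoffExponent_nonneg (n := n) hκ0.le (by linarith : 0 ≤ L)
  have hc := fun m s (hs : |s| ≤ chernoffExponent κ n L) =>
    (h m).exp_mul_multiplier hκ0 hB0 hs (chernoffExponent_mul_le hκ hn hL)
  have p1 := (measureReal_pi_exists_lt_abs_sum_le (μ := μ.prod (expMeasure 1)) hlam0
    (fun m s hs => (hc m s hs).1)
    (fun m s hs => (hc m s hs).2) n (M * (n * maxRate n L))).trans
    (exp_chernoff_le hκ hn hL hN hM hA)
  have p2 := HasExpMoment.measureReal_pi_exists_lt h hκ0 n B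
  have q2 : Fintype.card ι * (n * (2 * Real.exp (-B / κ))) ≤ 2 / n := by
    have e : Real.exp (-B / κ) = Real.exp (-(2 * L)) * ((n : ℝ) ^ 2)⁻¹ := by
      rw [← Real.exp_log (by positivity : 0 < (n : ℝ) ^ 2), ← Real.exp_neg, ← Real.exp_add,
        Real.log_pow, hB]
      congr 1; push_cast; field_simp; ring
    rw [e]
    calc _ ≤ Real.exp (2 * L) * (n * (2 * (Real.exp (-(2 * L)) * ((n : ℝ) ^ 2)⁻¹))) := by gcongr
      _ = (Real.exp (2 * L) * Real.exp (-(2 * L))) * (2 * (n * ((n : ℝ) ^ 2)⁻¹)) := by ring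
      _ = 2 / n := by rw [← Real.exp_add]; simp; field_simp
  set E1 : Set (Fin n → Ω × ℝ) := {x | ∃ m, M * (n * maxRate n L)
    < |∑ i, truncate B (a m) (x i).1 * ((x i).2 - 1)|}
  set E2 : Set (Fin n → Ω) := {x | ∃ m i, B < |a m (x i)|}
  have t1 : ((Measure.pi fun _ : Fin n => μ).prod (Measure.pi fun _ : Fin n => expMeasure 1)).real
      {q | (fun i => (q.1 i, q.2 i)) ∈ E1} ≤ 2 * Real.exp (-A * L) := by
    rw [measureReal_def, prod_pi_apply_pairs]; exact p1
  have t2 : ((Measure.pi fun _ : Fin n => μ).prod (Measure.pi fun _ : Fin n => expMeasure 1)).real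
      (Prod.fst ⁻¹' E2) ≤ 2 / n := by
    have : Prod.fst ⁻¹' E2 = E2 ×ˢ (Set.univ : Set (Fin n → ℝ)) := by ext; simp
    rw [this, measureReal_def, Measure.prod_prod, measure_univ, mul_one]
    exact p2.trans q2
  refine (measureReal_mono (fun q hq => ?_)).trans
    ((measureReal_union_le _ _).trans (add_le_add t2 t1))
  by_cases hE : q.1 ∈ E2
  · exact Or.inl hE
  · refine Or.inr ?_
    obtain ⟨m, hm⟩ := hq
    refine ⟨m, ?_⟩
    have : ∀ i, truncate B (a m) (q.1 i) = a m (q.1 i) := fun i => by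
      refine if_pos ?_
      by_contra hcon
      exact hE ⟨m, i, not_le.mp hcon⟩
    simpa only [this] using hm

theorem HasExpMoment.measureReal_centred_le {κ L M A : ℝ} {a : ι → Ω → ℝ} {n : ℕ}
    (h : ∀ m, HasExpMoment μ κ (a m)) (h0 : ∀ m, ∫ o, a m o ∂μ = 0) (hκ : 1 ≤ κ) (hn : 3 ≤ n)
    (hL : 1 / 2 ≤ L) (hN : (Fintype.card ι : ℝ) ≤ Real.exp (2 * L))
    (hM : 12 * κ * (16 * κ ^ 2 + 2 + A) ≤ M) (hA : 0 ≤ A) :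
    (Measure.pi fun _ : Fin n => μ).real {x | ∃ m, M * (n * maxRate n L) < |∑ i, a m (x i)|}
      ≤ 2 * Real.exp (-A * L) := by
  have hκ0 : 0 < κ := by linarith
  have hlam0 := chernoffExponent_nonneg (n := n) hκ0.le (by linarith : 0 ≤ L)
  have hc := fun m s (hs : |s| ≤ chernoffExponent κ n L) =>
    (h m).exp_mul_centred hκ0 (h0 m) hs (chernoffExponent_le hκ hn hL)
  exact (measureReal_pi_exists_lt_abs_sum_le hlam0 (fun m s hs => (hc m s hs).1)
    (fun m s hs => (hc m s hs).2) n (M * (n * maxRate n L))).trans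
    (exp_chernoff_le hκ hn hL hN hM hA)

/-- Without centring only the order `n (1 + r)` is claimed, so the fixed exponent `1 / κ` suffices:
the generating function costs `n log 2`, and `n * maxRate n L ≥ L / 2` absorbs the union bound. -/
theorem HasExpMoment.measureReal_sum_abs_le {κ L M A : ℝ} {a : ι → Ω → ℝ} {n : ℕ}
    (h : ∀ m, HasExpMoment μ κ (a m)) (hκ : 1 ≤ κ) (hn : 3 ≤ n)
    (hL : 1 / 2 ≤ L) (hN : (Fintype.card ι : ℝ) ≤ Real.exp (2 * L))
    (hM : 12 * κ * (16 * κ ^ 2 + 2 + A) ≤ M) (hA : 0 ≤ A) :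
    (Measure.pi fun _ : Fin n => μ).real
      {x | ∃ m, M * (n * (1 + maxRate n L)) < |∑ i, a m (x i)|} ≤ Real.exp (-A * L) := by
  have hκ0 : 0 < κ := by linarith
  have hlog := one_le_log_of_three_le hn
  have hn0 : 0 < n := by omega
  have hexp : ∀ o m, Real.exp (κ⁻¹ * |a m o|) = Real.exp (|a m o| / κ) := fun o m => by
    rw [div_eq_inv_mul]
  have p := measureReal_pi_exists_lt_sum_le (ξ := fun m o => |a m o|) (inv_nonneg.mpr hκ0.le)
    (fun m => by simpa only [hexp] using (h m).integrable) (V := Real.log 2)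
    (fun m => by rw [Real.exp_log two_pos]; simpa only [hexp] using (h m).integral_le) n
    (M * (n * (1 + maxRate n L)))
  refine (measureReal_mono (fun q hq => ?_)).trans (p.trans ?_)
  · obtain ⟨m, hm⟩ := hq
    exact ⟨m, hm.trans_le (Finset.abs_sum_le_sum_abs _ _)⟩
  · have hr : L / 2 ≤ n * maxRate n L := by
      refine le_trans ?_ (sq_mul_sq_le_mul_maxRate hn0 L)
      nlinarith [mul_nonneg (sq_nonneg L) (by nlinarith : 0 ≤ Real.log n ^ 2 - 1)]
    have hM' : κ * (1 + 2 * (2 + A)) ≤ M := by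
      refine le_trans ?_ hM
      rw [mul_comm 12 κ, mul_assoc]
      gcongr
      nlinarith
    have hMκ : 1 + 2 * (2 + A) ≤ κ⁻¹ * M := by
      rw [le_inv_mul_iff₀ hκ0]; exact hM'
    have hl2 : Real.log 2 ≤ 1 := by linarith [Real.log_two_lt_d9]
    have hnR : (0 : ℝ) < n := by exact_mod_cast hn0
    have k : n * Real.log 2 + (2 + A) * L ≤ κ⁻¹ * (M * (n * (1 + maxRate n L))) := by
      calc _ ≤ (1 + 2 * (2 + A)) * (n + n * maxRate n L) := by nlinarith
        _ ≤ κ⁻¹ * M * (n + n * maxRate n L) :=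
          mul_le_mul_of_nonneg_right hMκ (by linarith)
        _ = _ := by ring
    calc _ ≤ Real.exp (2 * L) * Real.exp (n * Real.log 2 - κ⁻¹ * (M * (n * (1 + maxRate n L)))) := by
          gcongr
      _ = Real.exp (2 * L + (n * Real.log 2 - κ⁻¹ * (M * (n * (1 + maxRate n L))))) := by
          rw [Real.exp_add]
      _ ≤ _ := Real.exp_le_exp.mpr (by linarith)

end

/-! ### Expansion of the debiased draw -/

section Norms

variable {p : ℕ}

theorem abs_le_maxNorm (A : Matrix (Fin p) (Fin p) ℝ) (k l : Fin p) : |A k l| ≤ maxNorm A :=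
  (le_ciSup (Set.finite_range fun l => |A k l|).bddAbove l).trans
    (le_ciSup (f := fun k => ⨆ l, |A k l|) (Set.finite_range _).bddAbove k)

theorem abs_mulVec_le_of_abs_le {A : Matrix (Fin p) (Fin p) ℝ} {c : ℝ} (hA : ∀ k l, |A k l| ≤ c)
    (v : Fin p → ℝ) (k : Fin p) : |(A *ᵥ v) k| ≤ c * l1Norm v := by
  rw [Matrix.mulVec, dotProduct, l1Norm, Finset.mul_sum]
  refine (Finset.abs_sum_le_sum_abs _ _).trans (Finset.sum_le_sum fun l _ => ?_)
  rw [abs_mul]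
  exact mul_le_mul_of_nonneg_right (hA k l) (abs_nonneg _)

theorem norm_mulVec_le (A : Matrix (Fin p) (Fin p) ℝ) (v : Fin p → ℝ) :
    ‖A *ᵥ v‖ ≤ opNormInf A * ‖v‖ :=
  (LinearMap.toContinuousLinearMap (Matrix.mulVecLin A)).le_opNorm v

theorem opNormInf_nonneg (A : Matrix (Fin p) (Fin p) ℝ) : 0 ≤ opNormInf A := norm_nonneg _

theorem abs_mulVec_le (A : Matrix (Fin p) (Fin p) ℝ) {v : Fin p → ℝ} {c : ℝ} (hc : 0 ≤ c)
    (hv : ∀ k, |v k| ≤ c) (j : Fin p) : |(A *ᵥ v) j| ≤ opNormInf A * c :=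
  (norm_le_pi_norm (A *ᵥ v) j).trans ((norm_mulVec_le A v).trans
    (mul_le_mul_of_nonneg_left ((pi_norm_le_iff_of_nonneg hc).mpr hv) (opNormInf_nonneg A)))

theorem opNormInf_le_add (A B : Matrix (Fin p) (Fin p) ℝ) :
    opNormInf A ≤ opNormInf (A - B) + opNormInf B := by
  refine ContinuousLinearMap.opNorm_le_bound _
    (add_nonneg (opNormInf_nonneg _) (opNormInf_nonneg _)) fun v => ?_
  have e : A *ᵥ v = (A - B) *ᵥ v + B *ᵥ v := by rw [Matrix.sub_mulVec]; abel
  change ‖A *ᵥ v‖ ≤ _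
  rw [e, add_mul]
  exact (norm_add_le _ _).trans (add_le_add (norm_mulVec_le _ _) (norm_mulVec_le _ _))

end Norms

/-- The `j`-th coordinate of the influence function `Θ₀ X ε`. -/
noncomputable def influence {p : ℕ} (P : Measure (Obs p)) (β : Fin p → ℝ) (j : Fin p)
    (o : Obs p) : ℝ :=
  (precision P *ᵥ o.1) j * err β o

section Decomposition

variable {n p : ℕ}

theorem err_eq (β β' : Fin p → ℝ) (o : Obs p) : err β o = err β' o - o.1 ⬝ᵥ (β - β') := by
  simp only [err, dotProduct_sub]; ring

/-- The weighted score `∑ᵢ wᵢ Xᵢ εᵢ`. -/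
def weightedScore (β : Fin p → ℝ) (z : Data n p) (w : Fin n → ℝ) : Fin p → ℝ :=
  fun k => ∑ i, w i * ((z i).1 k * err β (z i))

/-- The weighted second moment matrix `∑ᵢ wᵢ Xᵢ Xᵢᵀ`. -/
def weightedCov (z : Data n p) (w : Fin n → ℝ) : Matrix (Fin p) (Fin p) ℝ :=
  Matrix.of fun k l => ∑ i, w i * ((z i).1 k * (z i).1 l)

theorem debias_eq (z : Data n p) (Θ : Matrix (Fin p) (Fin p) ℝ) (β β₀ : Fin p → ℝ)
    (w : Fin n → ℝ) :
    debias z Θ β w = β + Θ *ᵥ (weightedScore β₀ z w - weightedCov z w *ᵥ (β - β₀)) := by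
  rw [debias]
  congr 2
  funext k
  have h2 : (weightedCov z w *ᵥ (β - β₀)) k
      = ∑ i, w i * ((z i).1 k * ((z i).1 ⬝ᵥ (β - β₀))) := by
    simp only [Matrix.mulVec, dotProduct, weightedCov, Matrix.of_apply, Finset.sum_mul,
      Finset.mul_sum]
    rw [Finset.sum_comm]
    exact Finset.sum_congr rfl fun i _ => Finset.sum_congr rfl fun l _ => by ring
  rw [Pi.sub_apply, h2, weightedScore, ← Finset.sum_sub_distrib]
  exact Finset.sum_congr rfl fun i _ => by rw [err_eq β β₀]; ring

/-- The expansion of a debiased draw around a centering estimator. -/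
theorem debias_sub_eq (z : Data n p) (Θ Θ₀ : Matrix (Fin p) (Fin p) ℝ) (β β₀ b : Fin p → ℝ)
    (w : Fin n → ℝ) :
    debias z Θ β w - b = Θ₀ *ᵥ (weightedScore β₀ z w - sampleScore β₀ z)
      + ((Θ - Θ₀) *ᵥ weightedScore β₀ z w - (Θ * sampleCov z - 1) *ᵥ (β - β₀)
        - Θ *ᵥ ((weightedCov z w - sampleCov z) *ᵥ (β - β₀))
        - (b - (β₀ + Θ₀ *ᵥ sampleScore β₀ z))) := by
  rw [debias_eq z Θ β β₀ w]
  simp only [Matrix.mulVec_sub, Matrix.sub_mulVec, Matrix.mulVec_mulVec, Matrix.one_mulVec]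
  abel

/-- Each remainder is bounded by duality: matrices acting on `β - β₀` entrywise against the `ℓ¹`
norm, and precision matrices by their sup-norm operator norm. Since `u` and `g` do not involve `β`,
one event of data and weights serves all draws. -/
theorem abs_debias_sub_le (z : Data n p) (Θ Θ₀ : Matrix (Fin p) (Fin p) ℝ) (β β₀ b : Fin p → ℝ)
    (w : Fin n → ℝ) (j : Fin p) {u g : ℝ} (hu : ∀ k, |weightedScore β₀ z w k| ≤ u)
    (hg : ∀ k l, |(weightedCov z w - sampleCov z) k l| ≤ g) :
    |(debias z Θ β w j - b j) - (Θ₀ *ᵥ (weightedScore β₀ z w - sampleScore β₀ z)) j|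
      ≤ opNormInf (Θ - Θ₀) * u + maxNorm (Θ * sampleCov z - 1) * l1Norm (β - β₀)
        + (opNormInf (Θ - Θ₀) + opNormInf Θ₀) * (g * l1Norm (β - β₀))
        + ‖b - (β₀ + Θ₀ *ᵥ sampleScore β₀ z)‖ := by
  have hl : 0 ≤ l1Norm (β - β₀) := Finset.sum_nonneg fun k _ => abs_nonneg _
  have e := congrFun (debias_sub_eq z Θ Θ₀ β β₀ b w) j
  simp only [Pi.sub_apply, Pi.add_apply] at e
  rw [e, add_sub_cancel_left]
  have h1 := abs_mulVec_le (Θ - Θ₀) ((abs_nonneg _).trans (hu j)) hu j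
  have h2 := abs_mulVec_le_of_abs_le (fun k l => abs_le_maxNorm (Θ * sampleCov z - 1) k l)
    (β - β₀) j
  have h3 := abs_mulVec_le Θ (mul_nonneg ((abs_nonneg _).trans (hg j j)) hl)
    (abs_mulVec_le_of_abs_le hg (β - β₀)) j
  have h4 := norm_le_pi_norm (b - (β₀ + Θ₀ *ᵥ sampleScore β₀ z)) j
  have h5 := mul_le_mul_of_nonneg_right (opNormInf_le_add Θ Θ₀)
    (mul_nonneg ((abs_nonneg _).trans (hg j j)) hl)
  rw [Real.norm_eq_abs] at h4
  simp only [Pi.sub_apply, Pi.add_apply] at h4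
  refine (abs_sub _ _).trans (add_le_add ((abs_sub _ _).trans (add_le_add ((abs_sub _ _).trans
    (add_le_add h1 h2)) (h3.trans h5))) h4)

theorem precision_mulVec_score_sub (P : Measure (Obs p)) (β : Fin p → ℝ) (j : Fin p)
    (z : Data n p) (w : Fin n → ℝ) :
    (precision P *ᵥ (weightedScore β z w - sampleScore β z)) j
      = ∑ i, w i * influence P β j (z i) - (n : ℝ)⁻¹ * ∑ i, influence P β j (z i) := by
  have h : ∀ c : Fin n → ℝ, (precision P *ᵥ weightedScore β z c) j
      = ∑ i, c i * influence P β j (z i) := fun c => by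
    simp only [Matrix.mulVec, dotProduct, weightedScore, influence, Finset.sum_mul,
      Finset.mul_sum]
    rw [Finset.sum_comm]
    exact Finset.sum_congr rfl fun i _ => Finset.sum_congr rfl fun l _ => by ring
  have h2 : sampleScore β z = weightedScore β z fun _ => (n : ℝ)⁻¹ := by
    funext k; simp [sampleScore, weightedScore, Finset.mul_sum]
  rw [Matrix.mulVec_sub, Pi.sub_apply, h2, h, h, Finset.mul_sum]

end Decomposition

/-! ### Normalized against centred weights -/

section Normalization

variable {n : ℕ} {M : ℝ} {ω : Fin n → ℝ}

theorem half_le_sum_weights (hn : 0 < n) (hM : 4 * M ^ 2 ≤ n)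
    (hω : |∑ i, (ω i - 1)| ≤ M * √n) : (n : ℝ) / 2 ≤ ∑ i, ω i := by
  have hnR : (0 : ℝ) < n := by exact_mod_cast hn
  have h1 : 2 * M ≤ √n := Real.le_sqrt_of_sq_le (by linarith)
  have h2 : √(n : ℝ) * √n = n := Real.mul_self_sqrt hnR.le
  rw [Finset.sum_sub_distrib] at hω
  simp only [Finset.sum_const, Finset.card_univ, Fintype.card_fin, nsmul_eq_mul, mul_one] at hω
  nlinarith [(abs_le.mp hω).1, Real.sqrt_nonneg (n : ℝ)]

theorem sum_normalized_eq (hn : 0 < n) (hS : ∑ i, ω i ≠ 0) (a : Fin n → ℝ) :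
    ∑ i, ω i / (∑ k, ω k) * a i - (n : ℝ)⁻¹ * ∑ i, a i
      = (∑ i, a i * (ω i - 1) - (∑ i, (ω i - 1)) * ((n : ℝ)⁻¹ * ∑ i, a i)) / ∑ i, ω i := by
  have hnR : (n : ℝ) ≠ 0 := by positivity
  have e1 : ∑ i, ω i / (∑ k, ω k) * a i = (∑ i, a i * ω i) / ∑ k, ω k := by
    rw [Finset.sum_div]; exact Finset.sum_congr rfl fun i _ => by ring
  have e2 : ∑ i, a i * (ω i - 1) = ∑ i, a i * ω i - ∑ i, a i := by
    rw [← Finset.sum_sub_distrib]; exact Finset.sum_congr rfl fun i _ => by ring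
  have e3 : ∑ i, (ω i - 1) = ∑ i, ω i - n := by simp
  rw [e1, e2, e3]
  field_simp
  ring

theorem abs_sum_normalized_sub_le (hn : 0 < n) (hM : 4 * M ^ 2 ≤ n) (hM0 : 0 ≤ M)
    (hω : |∑ i, (ω i - 1)| ≤ M * √n) {a : Fin n → ℝ} {A B : ℝ}
    (hA : |∑ i, a i * (ω i - 1)| ≤ n * A) (hB : |∑ i, a i| ≤ n * B) :
    |∑ i, ω i / (∑ k, ω k) * a i - (n : ℝ)⁻¹ * ∑ i, a i| ≤ 2 * (A + M * (B / √n)) := by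
  have hnR : (0 : ℝ) < n := by exact_mod_cast hn
  have hS := half_le_sum_weights hn hM hω
  have hS0 : 0 < ∑ i, ω i := by linarith
  have hs : √(n : ℝ) * √n = n := Real.mul_self_sqrt hnR.le
  have hsp : 0 < √(n : ℝ) := Real.sqrt_pos.mpr hnR
  have hB0 : 0 ≤ B := by
    have := (abs_nonneg _).trans hB
    exact nonneg_of_mul_nonneg_right this hnR
  have hA0 : 0 ≤ A := nonneg_of_mul_nonneg_right ((abs_nonneg _).trans hA) hnR
  rw [sum_normalized_eq hn hS0.ne', abs_div, abs_of_pos hS0, div_le_iff₀ hS0]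
  have h1 : |(n : ℝ)⁻¹ * ∑ i, a i| ≤ B := by
    rw [abs_mul, abs_of_pos (inv_pos.mpr hnR), inv_mul_le_iff₀ hnR]; exact hB
  have h2 : |(∑ i, (ω i - 1)) * ((n : ℝ)⁻¹ * ∑ i, a i)| ≤ M * √n * B := by
    rw [abs_mul]; exact mul_le_mul hω h1 (abs_nonneg _) (by positivity)
  have h3 : n * (A + M * (B / √n)) = n * A + M * √n * B := by
    have : (n : ℝ) * (B / √n) = √n * B := by
      nth_rewrite 1 [← hs]; field_simp
    linear_combination M * this
  calc _ ≤ n * A + M * √n * B := (abs_sub _ _).trans (add_le_add hA h2)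
    _ = 2 * (A + M * (B / √n)) * (n / 2) := by rw [← h3]; ring
    _ ≤ _ := by gcongr

/-- With `S = ∑ ωᵢ`, the difference equals `-(S - n)(∑ aᵢ(ωᵢ - 1) + ∑ aᵢ) / (√n S)`. The numerator
is a product of two terms of order `√n`, and `S ≥ n / 2`. -/
theorem abs_sqrt_mul_sum_normalized_sub_le (hn : 0 < n) (hM : 4 * M ^ 2 ≤ n) (hM0 : 0 ≤ M)
    (hω : |∑ i, (ω i - 1)| ≤ M * √n) {a : Fin n → ℝ}
    (hA : |∑ i, a i * (ω i - 1)| ≤ M * √n) (hB : |∑ i, a i| ≤ M * √n) :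
    |√n * (∑ i, ω i / (∑ k, ω k) * a i - (n : ℝ)⁻¹ * ∑ i, a i)
      - ∑ i, a i / √n * (ω i - 1)| ≤ 4 * M ^ 2 / √n := by
  have hnR : (0 : ℝ) < n := by exact_mod_cast hn
  have hS := half_le_sum_weights hn hM hω
  have hS0 : 0 < ∑ i, ω i := by linarith
  have hs : √(n : ℝ) * √n = n := Real.mul_self_sqrt hnR.le
  have hsp : 0 < √(n : ℝ) := Real.sqrt_pos.mpr hnR
  have e1 : ∑ i, a i / √n * (ω i - 1) = (∑ i, a i * (ω i - 1)) / √n := by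
    rw [Finset.sum_div]; exact Finset.sum_congr rfl fun i _ => by ring
  have e3 : ∑ i, (ω i - 1) = ∑ i, ω i - n := by simp
  have e : √n * (∑ i, ω i / (∑ k, ω k) * a i - (n : ℝ)⁻¹ * ∑ i, a i)
      - ∑ i, a i / √n * (ω i - 1)
      = -((∑ i, (ω i - 1)) * (∑ i, a i * (ω i - 1) + ∑ i, a i)) / (√n * ∑ i, ω i) := by
    rw [sum_normalized_eq hn hS0.ne', e1, e3]
    have : (n : ℝ)⁻¹ = (√n * √n)⁻¹ := by rw [hs]
    rw [this]
    generalize ∑ i, a i * (ω i - 1) = Q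
    field_simp
    rw [Real.sq_sqrt hnR.le]
    ring
  rw [e, abs_div, abs_neg, abs_mul, abs_of_pos (mul_pos hsp hS0), div_le_div_iff₀ (by positivity) hsp]
  have h1 : |∑ i, a i * (ω i - 1) + ∑ i, a i| ≤ 2 * (M * √n) :=
    (abs_add_le _ _).trans (by linarith)
  calc _ ≤ M * √n * (2 * (M * √n)) * √n := by gcongr
    _ = 4 * M ^ 2 * (√n * (√n * √n / 2)) := by ring
    _ ≤ _ := by rw [hs]; gcongr

end Normalization

/-! ### Regular samples and weights -/

/-- The sample and the raw bootstrap weights are such that the sums in the expansion of the debiased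
draw have their typical sizes. -/
structure IsRegular {n p : ℕ} (P : Measure (Obs p)) (β : Fin p → ℝ) (j : Fin p) (M r : ℝ)
    (z : Data n p) (ω : Fin n → ℝ) : Prop where
  weights : |∑ i, (ω i - 1)| ≤ M * √n
  weighted_influence : |∑ i, influence P β j (z i) * (ω i - 1)| ≤ M * √n
  influence : |∑ i, influence P β j (z i)| ≤ M * √n
  weighted_cov : ∀ k l, |∑ i, (z i).1 k * (z i).1 l * (ω i - 1)| ≤ M * (n * r)
  weighted_score : ∀ k, |∑ i, (z i).1 k * err β (z i) * (ω i - 1)| ≤ M * (n * r)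
  cov : ∀ k l, |∑ i, (z i).1 k * (z i).1 l| ≤ M * (n * (1 + r))
  score : ∀ k, |∑ i, (z i).1 k * err β (z i)| ≤ M * (n * r)

/-- On regular samples and weights, the scaled debiased draw is close to a linear combination of the
centred weights. -/
theorem IsRegular.abs_debias_sub_le {n p : ℕ} {P : Measure (Obs p)} {β₀ : Fin p → ℝ} {j : Fin p}
    {M r : ℝ} {z : Data n p} {ω : Fin n → ℝ} (h : IsRegular P β₀ j M r z ω) (hn : 0 < n)
    (hM : 4 * M ^ 2 ≤ n) (hM1 : 1 ≤ M) (hr : (√(n : ℝ))⁻¹ ≤ 2 * r)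
    (Θ : Matrix (Fin p) (Fin p) ℝ) (β b : Fin p → ℝ) :
    |√n * (debias z Θ β (fun i => ω i / ∑ k, ω k) j - b j)
        - ∑ i, DebiasedBayes.influence P β₀ j (z i) / √n * (ω i - 1)|
      ≤ √n * (opNormInf (Θ - precision P) * (5 * M ^ 2 * r)
        + maxNorm (Θ * sampleCov z - 1) * l1Norm (β - β₀)
        + (opNormInf (Θ - precision P) + opNormInf (precision P)) *
          (8 * M ^ 2 * r * l1Norm (β - β₀))
        + ‖b - (β₀ + precision P *ᵥ sampleScore β₀ z)‖) + 4 * M ^ 2 / √n := by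
  have hnR : (0 : ℝ) < n := by exact_mod_cast hn
  have hsp : 0 < √(n : ℝ) := Real.sqrt_pos.mpr hnR
  have hr0 : 0 < r := by have := inv_pos.mpr hsp; linarith
  have hM0 : 0 ≤ M := by linarith
  have hMM : M ≤ M ^ 2 := by nlinarith
  have hs1 : 1 ≤ √(n : ℝ) := Real.one_le_sqrt.mpr (by exact_mod_cast hn)
  have hs1' : (√(n : ℝ))⁻¹ ≤ 1 := inv_le_one_of_one_le₀ hs1
  -- The normalization error is at most `2 M r + 2 M² r`, and the unweighted mean adds `M r`.
  have hu : ∀ k, |weightedScore β₀ z (fun i => ω i / ∑ k, ω k) k| ≤ 5 * M ^ 2 * r := by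
    intro k
    have h1 := abs_sum_normalized_sub_le hn hM hM0 h.weights (A := M * r) (B := M * r)
      ((h.weighted_score k).trans (le_of_eq (by ring))) ((h.score k).trans (le_of_eq (by ring)))
    have h2 : |(n : ℝ)⁻¹ * ∑ i, (z i).1 k * err β₀ (z i)| ≤ M * r := by
      rw [abs_mul, abs_of_pos (inv_pos.mpr hnR), inv_mul_le_iff₀ hnR]
      exact (h.score k).trans (le_of_eq (by ring))
    have h3 : M * (M * r / √n) ≤ M ^ 2 * r := by
      rw [pow_two, mul_assoc]
      exact mul_le_mul_of_nonneg_left (div_le_self (by positivity) hs1) hM0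
    have h4 := mul_le_mul_of_nonneg_right hMM hr0.le
    have h5 := abs_add_le (weightedScore β₀ z (fun i => ω i / ∑ k, ω k) k
      - (n : ℝ)⁻¹ * ∑ i, (z i).1 k * err β₀ (z i)) ((n : ℝ)⁻¹ * ∑ i, (z i).1 k * err β₀ (z i))
    rw [sub_add_cancel] at h5
    refine h5.trans ((add_le_add h1 h2).trans ?_)
    linarith
  -- Here the unweighted mean is not small, only at most `M (1 + r)`; the fluctuation of the weights
  -- supplies `1 / √n ≤ 2 r`, so `(1 + r) / √n ≤ 3 r` and the total is `2 M r + 6 M² r`.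
  have hg : ∀ k l, |(weightedCov z (fun i => ω i / ∑ k, ω k) - sampleCov z) k l|
      ≤ 8 * M ^ 2 * r := by
    intro k l
    have := abs_sum_normalized_sub_le hn hM hM0 h.weights (A := M * r) (B := M * (1 + r))
      ((h.weighted_cov k l).trans (le_of_eq (by ring))) ((h.cov k l).trans (le_of_eq (by ring)))
    refine this.trans ?_
    have e : M * (1 + r) / √n ≤ M * (3 * r) := by
      rw [mul_div_assoc, div_eq_mul_inv]
      refine mul_le_mul_of_nonneg_left ?_ hM0
      nlinarith
    nlinarith [mul_le_mul_of_nonneg_left e hM0, mul_le_mul_of_nonneg_right hMM hr0.le]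
  have h1 := DebiasedBayes.abs_debias_sub_le z Θ (precision P) β β₀ b _ j hu hg
  have h2 := abs_sqrt_mul_sum_normalized_sub_le hn hM hM0 h.weights h.weighted_influence h.influence
  rw [← precision_mulVec_score_sub P β₀ j z fun i => ω i / ∑ k, ω k] at h2
  refine (abs_sub_le _ _ _).trans (add_le_add ?_ h2)
  rw [← mul_sub, abs_mul, abs_of_pos hsp]
  exact mul_le_mul_of_nonneg_left h1 hsp.le

/-! ### Exponential moments and the influence function -/

section SubGaussian

variable {Ω : Type*} [MeasurableSpace Ω] {μ : Measure Ω}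

/-- The strict inequality `K < κ` provides an admissible `t < κ`, so the infimum need not be
attained. -/
theorem lintegral_exp_sq_le_of_psi2Norm_le {Z : Ω → ℝ} {K : ℝ≥0} (h : psi2Norm μ Z ≤ K) {κ : ℝ}
    (hκ : K < κ) : ∫⁻ ω, ENNReal.ofReal (Real.exp (Z ω ^ 2 / κ ^ 2)) ∂μ ≤ 2 := by
  have hκ0 : 0 < κ := lt_of_le_of_lt K.coe_nonneg hκ
  have h1 : psi2Norm μ Z < ENNReal.ofReal κ := by
    refine h.trans_lt ?_
    rw [← ENNReal.ofReal_coe_nnreal]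
    exact (ENNReal.ofReal_lt_ofReal_iff hκ0).mpr hκ
  rw [psi2Norm, iInf_lt_iff] at h1
  obtain ⟨t, h1⟩ := h1
  rw [iInf_lt_iff] at h1
  obtain ⟨⟨ht0, ht⟩, h1⟩ := h1
  have h2 : t < κ := (ENNReal.ofReal_lt_ofReal_iff hκ0).mp h1
  refine le_trans (lintegral_mono fun ω => ENNReal.ofReal_le_ofReal (Real.exp_le_exp.mpr ?_)) ht
  gcongr

theorem psi2Norm_coord_le {p : ℕ} (Z : Ω → Fin p → ℝ) (k : Fin p) :
    psi2Norm μ (fun ω => Z ω k) ≤ psi2NormVec μ Z := by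
  have := le_iSup₂ (f := fun (u : Fin p → ℝ) (_ : ∑ k, u k ^ 2 = 1) =>
    psi2Norm μ fun ω => Z ω ⬝ᵥ u) (Pi.single k 1) (by simp [Pi.single_apply])
  simpa [psi2NormVec] using this

/-- The arithmetic-geometric mean inequality twice: `|AB| ≤ (A² + B²) / 2`, then `exp ((x + y) / 2)
≤ (exp x + exp y) / 2`. -/
theorem hasExpMoment_mul {A B : Ω → ℝ} (hA : Measurable A) (hB : Measurable B) {κ : ℝ}
    (hκ : 0 < κ) (h₁ : ∫⁻ ω, ENNReal.ofReal (Real.exp (A ω ^ 2 / κ)) ∂μ ≤ 2)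
    (h₂ : ∫⁻ ω, ENNReal.ofReal (Real.exp (B ω ^ 2 / κ)) ∂μ ≤ 2) :
    HasExpMoment μ κ fun ω => A ω * B ω := by
  have hp : ∀ ω, Real.exp (|A ω * B ω| / κ)
      ≤ 1 / 2 * Real.exp (A ω ^ 2 / κ) + 1 / 2 * Real.exp (B ω ^ 2 / κ) := by
    intro ω
    have e : |A ω * B ω| / κ ≤ A ω ^ 2 / κ / 2 + B ω ^ 2 / κ / 2 := by
      rw [← add_div, ← add_div, div_right_comm]
      gcongr
      rw [abs_mul, ← sq_abs (A ω), ← sq_abs (B ω)]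
      nlinarith [sq_nonneg (|A ω| - |B ω|)]
    refine (Real.exp_le_exp.mpr e).trans ?_
    rw [Real.exp_add]
    have e1 : ∀ x : ℝ, Real.exp x = Real.exp (x / 2) * Real.exp (x / 2) := fun x => by
      rw [← Real.exp_add, add_halves]
    rw [e1 (A ω ^ 2 / κ), e1 (B ω ^ 2 / κ)]
    nlinarith [sq_nonneg (Real.exp (A ω ^ 2 / κ / 2) - Real.exp (B ω ^ 2 / κ / 2))]
  have hl : ∫⁻ ω, ENNReal.ofReal (Real.exp (|A ω * B ω| / κ)) ∂μ ≤ ENNReal.ofReal 2 := by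
    calc _ ≤ ∫⁻ ω, (ENNReal.ofReal (1 / 2) * ENNReal.ofReal (Real.exp (A ω ^ 2 / κ))
          + ENNReal.ofReal (1 / 2) * ENNReal.ofReal (Real.exp (B ω ^ 2 / κ))) ∂μ := by
          refine lintegral_mono fun ω => ?_
          rw [← ENNReal.ofReal_mul (by norm_num), ← ENNReal.ofReal_mul (by norm_num),
            ← ENNReal.ofReal_add (by positivity) (by positivity)]
          exact ENNReal.ofReal_le_ofReal (hp ω)
      _ = ENNReal.ofReal (1 / 2) * ∫⁻ ω, ENNReal.ofReal (Real.exp (A ω ^ 2 / κ)) ∂μ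
          + ENNReal.ofReal (1 / 2) * ∫⁻ ω, ENNReal.ofReal (Real.exp (B ω ^ 2 / κ)) ∂μ := by
          rw [lintegral_add_left (by fun_prop), lintegral_const_mul _ (by fun_prop),
            lintegral_const_mul _ (by fun_prop)]
      _ ≤ ENNReal.ofReal (1 / 2) * ENNReal.ofReal 2 + ENNReal.ofReal (1 / 2) * ENNReal.ofReal 2 := by
          rw [ENNReal.ofReal_ofNat]
          gcongr
      _ = ENNReal.ofReal 2 := by
          rw [← ENNReal.ofReal_mul (by norm_num), ← ENNReal.ofReal_add (by norm_num) (by norm_num)]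
          norm_num
  have hm : AEStronglyMeasurable (fun ω => Real.exp (|A ω * B ω| / κ)) μ := by fun_prop
  refine ⟨by fun_prop, ⟨hm, ?_⟩, ?_⟩
  · rw [hasFiniteIntegral_iff_ofReal (Eventually.of_forall fun ω => Real.exp_nonneg _)]
    exact hl.trans_lt ENNReal.ofReal_lt_top
  · rw [integral_eq_lintegral_of_nonneg_ae (Eventually.of_forall fun ω => Real.exp_nonneg _) hm]
    exact ENNReal.toReal_le_of_le_ofReal (by norm_num) hl

theorem memLp_of_hasExpMoment {κ : ℝ} {a : Ω → ℝ} (h : HasExpMoment μ κ a) (hκ : 0 < κ) :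
    MemLp a 2 μ :=
  (memLp_two_iff_integrable_sq h.measurable.aestronglyMeasurable).mpr
    (by simpa using h.integrable_abs_pow hκ 2)

end SubGaussian

/-- Moment bounds for one observation. -/
structure HasMomentBounds {p : ℕ} (P : Measure (Obs p)) (β : Fin p → ℝ) (j : Fin p) (κ K : ℝ) :
    Prop where
  cov : ∀ k l, HasExpMoment P κ fun o => o.1 k * o.1 l
  score : ∀ k, HasExpMoment P κ fun o => o.1 k * err β o
  integral_score : ∀ k, ∫ o, o.1 k * err β o ∂P = 0
  integrable_cube : Integrable (fun o => |influence P β j o| ^ 3) P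
  integral_cube : ∫ o, |influence P β j o| ^ 3 ∂P ≤ K

section Influence

variable {p : ℕ} {P : Measure (Obs p)} {β : Fin p → ℝ} {j : Fin p} {κ K : ℝ}

@[fun_prop]
theorem measurable_err : Measurable (err β) := by
  unfold err dotProduct; fun_prop

theorem influence_eq_sum (o : Obs p) :
    influence P β j o = ∑ k, precision P j k * (o.1 k * err β o) := by
  simp only [influence, Matrix.mulVec, dotProduct, Finset.sum_mul, mul_assoc]

@[fun_prop]
theorem measurable_influence : Measurable (influence P β j) := by
  have : influence P β j = fun o => ∑ k, precision P j k * (o.1 k * err β o) :=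
    funext influence_eq_sum
  rw [this]; fun_prop

theorem HasMomentBounds.memLp_influence (h : HasMomentBounds P β j κ K) (hκ : 0 < κ) :
    MemLp (influence P β j) 2 P := by
  have : influence P β j = fun o => ∑ k, precision P j k * (o.1 k * err β o) :=
    funext influence_eq_sum
  rw [this]
  exact memLp_finsetSum _ fun k _ => (memLp_of_hasExpMoment (h.score k) hκ).const_mul _

theorem HasMomentBounds.integral_influence [IsFiniteMeasure P] (h : HasMomentBounds P β j κ K)
    (hκ : 0 < κ) : ∫ o, influence P β j o ∂P = 0 := by
  simp only [influence_eq_sum]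
  rw [integral_finsetSum _ fun k _ =>
    ((memLp_of_hasExpMoment (h.score k) hκ).integrable (by norm_num)).const_mul _]
  simp only [integral_const_mul, h.integral_score, mul_zero, Finset.sum_const_zero]

theorem HasMomentBounds.integral_influence_sq_le [IsProbabilityMeasure P]
    (h : HasMomentBounds P β j κ K) (hκ : 0 < κ) : ∫ o, influence P β j o ^ 2 ∂P ≤ 1 + K := by
  calc _ ≤ ∫ o, (1 + |influence P β j o| ^ 3) ∂P := by
        refine integral_mono (h.memLp_influence hκ).integrable_sq
          ((integrable_const _).add h.integrable_cube) fun o => ?_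
        simp only
        rw [← sq_abs]
        have := abs_nonneg (influence P β j o)
        generalize |influence P β j o| = x at *
        rcases le_total x 1 with hx | hx
        · nlinarith [pow_nonneg this 3]
        · nlinarith [sq_nonneg x]
    _ = 1 + ∫ o, |influence P β j o| ^ 3 ∂P := by
        rw [integral_add (integrable_const _) h.integrable_cube]; simp
    _ ≤ _ := by linarith [h.integral_cube]

/-- Expand the square; symmetry of the precision matrix turns its `j`-th column into its `j`-th row.
The cross moments exist because score coordinates are square integrable. -/
theorem HasMomentBounds.sandwichVar_eq (h : HasMomentBounds P β j κ K) (hκ : 0 < κ) :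
    sandwichVar P β j = ∫ o, influence P β j o ^ 2 ∂P := by
  have hsymm : ∀ k l, precision P k l = precision P l k := by
    have h1 : (popCov P)ᵀ = popCov P := by
      ext k l; simp [popCov, mul_comm]
    have h2 : (precision P)ᵀ = precision P := by
      rw [precision, Matrix.transpose_nonsing_inv, h1]
    intro k l
    conv_lhs => rw [← h2]
    rfl
  have hi : ∀ k l, Integrable (fun o : Obs p => (o.1 k * err β o) * (o.1 l * err β o)) P :=
    fun k l => (memLp_of_hasExpMoment (h.score k) hκ).integrable_mul
      (memLp_of_hasExpMoment (h.score l) hκ)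
  have e : ∀ o, influence P β j o ^ 2 = ∑ k, ∑ l, precision P j k * precision P j l *
      ((o.1 k * err β o) * (o.1 l * err β o)) := fun o => by
    rw [influence_eq_sum, pow_two, Finset.sum_mul_sum]
    exact Finset.sum_congr rfl fun k _ => Finset.sum_congr rfl fun l _ => by ring
  simp only [e]
  rw [integral_finsetSum _ fun k _ => integrable_finsetSum _ fun l _ => (hi k l).const_mul _]
  simp only [integral_finsetSum _ fun l _ => (hi _ l).const_mul _, integral_const_mul]
  rw [sandwichVar, Matrix.mul_apply]
  simp only [Matrix.mul_apply, Finset.sum_mul, scoreCov, Matrix.of_apply]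
  rw [Finset.sum_comm]
  refine Finset.sum_congr rfl fun k _ => Finset.sum_congr rfl fun l _ => ?_
  rw [hsymm l j]
  have : ∀ o : Obs p, o.1 k * o.1 l * err β o ^ 2 = o.1 k * err β o * (o.1 l * err β o) :=
    fun o => by ring
  simp only [this]
  ring

end Influence

/-! ### Probability of regularity -/

section Regularity

variable {n p : ℕ}

theorem measurableSet_isRegular (P : Measure (Obs p)) (β : Fin p → ℝ) (j : Fin p) (M r : ℝ) :
    MeasurableSet {q : Data n p × (Fin n → ℝ) | IsRegular P β j M r q.1 q.2} := by
  have e : {q : Data n p × (Fin n → ℝ) | IsRegular P β j M r q.1 q.2} =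
      {q | |∑ i, (q.2 i - 1)| ≤ M * √n} ∩
      {q | |∑ i, influence P β j (q.1 i) * (q.2 i - 1)| ≤ M * √n} ∩
      {q | |∑ i, influence P β j (q.1 i)| ≤ M * √n} ∩
      (⋂ k, ⋂ l, {q | |∑ i, (q.1 i).1 k * (q.1 i).1 l * (q.2 i - 1)| ≤ M * (n * r)}) ∩
      (⋂ k, {q | |∑ i, (q.1 i).1 k * err β (q.1 i) * (q.2 i - 1)| ≤ M * (n * r)}) ∩
      (⋂ k, ⋂ l, {q | |∑ i, (q.1 i).1 k * (q.1 i).1 l| ≤ M * (n * (1 + r))}) ∩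
      (⋂ k, {q | |∑ i, (q.1 i).1 k * err β (q.1 i)| ≤ M * (n * r)}) := by
    ext q
    simp only [Set.mem_inter_iff, Set.mem_iInter, Set.mem_ofPred_eq]
    exact ⟨fun h => ⟨⟨⟨⟨⟨⟨h.1, h.2⟩, h.3⟩, h.4⟩, h.5⟩, h.6⟩, h.7⟩,
      fun ⟨⟨⟨⟨⟨⟨h1, h2⟩, h3⟩, h4⟩, h5⟩, h6⟩, h7⟩ => ⟨h1, h2, h3, h4, h5, h6, h7⟩⟩
  rw [e]
  refine MeasurableSet.inter (MeasurableSet.inter (MeasurableSet.inter (MeasurableSet.inter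
    (MeasurableSet.inter (MeasurableSet.inter ?_ ?_) ?_) ?_) ?_) ?_) ?_
  · exact measurableSet_le (by fun_prop) measurable_const
  · exact measurableSet_le (by fun_prop) measurable_const
  · exact measurableSet_le (by fun_prop) measurable_const
  · exact .iInter fun k => .iInter fun l => measurableSet_le (by fun_prop) measurable_const
  · exact .iInter fun k => measurableSet_le (by fun_prop) measurable_const
  · exact .iInter fun k => .iInter fun l => measurableSet_le (by fun_prop) measurable_const
  · exact .iInter fun k => measurableSet_le (by fun_prop) measurable_const

theorem measureReal_prod_fst {α γ : Type*} [MeasurableSpace α] [MeasurableSpace γ]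
    {μ : Measure α} {ν : Measure γ} [IsProbabilityMeasure ν] (s : Set α) :
    (μ.prod ν).real {q | q.1 ∈ s} = μ.real s := by
  have : {q : α × γ | q.1 ∈ s} = s ×ˢ Set.univ := by ext; simp
  rw [this, measureReal_def, Measure.prod_prod, measure_univ, mul_one, measureReal_def]

theorem measureReal_prod_snd {α γ : Type*} [MeasurableSpace α] [MeasurableSpace γ]
    {μ : Measure α} {ν : Measure γ} [IsProbabilityMeasure μ] [SFinite ν] (s : Set γ) :
    (μ.prod ν).real {q | q.2 ∈ s} = ν.real s := by
  have : {q : α × γ | q.2 ∈ s} = Set.univ ×ˢ s := by ext; simp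
  rw [this, measureReal_def, Measure.prod_prod, measure_univ, one_mul, measureReal_def]

theorem memLp_two_centred_expMeasure_one : MemLp (fun w : ℝ => w - 1) 2 (expMeasure 1) :=
  (memLp_two_iff_integrable_sq (by fun_prop)).mpr integrable_centred_sq_expMeasure_one

instance {P : Measure (Obs p)} [IsProbabilityMeasure P] : IsProbabilityMeasure (sampleLaw n P) := by
  unfold sampleLaw; infer_instance

/-- A union over the seven fields of `IsRegular`: three Chebyshev bounds with second moments at most
`1`, `1 + K`, `1 + K`; two multiplier bounds, each giving `2 / n` and two exponentials; one
exponential for `cov` and two for `score`. -/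
theorem measureReal_not_isRegular_le {P : Measure (Obs p)} [IsProbabilityMeasure P]
    {β : Fin p → ℝ} {j : Fin p} {κ K A M : ℝ} (h : HasMomentBounds P β j κ K) (hκ : 1 ≤ κ)
    (hn : 3 ≤ n) (hM : 12 * κ * (16 * κ ^ 2 + 2 + A) ≤ M) (hA : 0 ≤ A) (hM1 : 1 ≤ M) :
    ((sampleLaw n P).prod (Measure.pi fun _ : Fin n => expMeasure 1)).real
      {q | ¬ IsRegular P β j M (maxRate n (Real.log (p + 1))) q.1 q.2}
      ≤ (3 + 2 * K) / M ^ 2 + 4 / n + 7 * Real.exp (-A / 2) := by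
  have hκ0 : 0 < κ := by linarith
  have hn0 : 0 < n := by omega
  have hM0 : 0 < M := by linarith
  have hp : 1 ≤ p := by have := j.isLt; omega
  have hpR : (1 : ℝ) ≤ p := by exact_mod_cast hp
  -- Unlike `log p`, this is at least `1 / 2` also for `p = 1`, and `exp (2 L) = (p + 1) ^ 2` covers
  -- all `p ^ 2` pairs of coordinates.
  set L := Real.log (p + 1) with hLdef
  have hL : 1 / 2 ≤ L := by
    have : Real.log 2 ≤ L := Real.log_le_log (by norm_num) (by linarith)
    linarith [Real.log_two_gt_d9]
  have hexpL : Real.exp (2 * L) = (p + 1 : ℝ) ^ 2 := by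
    rw [two_mul, Real.exp_add, Real.exp_log (by positivity)]; ring
  have hN2 : (Fintype.card (Fin p × Fin p) : ℝ) ≤ Real.exp (2 * L) := by
    rw [hexpL]; simp only [Fintype.card_prod, Fintype.card_fin]; push_cast; nlinarith
  have hN1 : (Fintype.card (Fin p) : ℝ) ≤ Real.exp (2 * L) := by
    rw [hexpL]; simp only [Fintype.card_fin]; nlinarith
  have hAL : Real.exp (-A * L) ≤ Real.exp (-A / 2) := Real.exp_le_exp.mpr (by nlinarith)
  set r := maxRate n L
  set J := (sampleLaw n P).prod (Measure.pi fun _ : Fin n => expMeasure 1) with hJ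
  have hσ := h.integral_influence_sq_le hκ0
  have hξ0 := h.integral_influence hκ0
  have hξ2 := h.memLp_influence hκ0
  have b1 : J.real {q | q.2 ∈ {ω | M * √n < |∑ i, (ω i - 1)|}} ≤ 1 / M ^ 2 := by
    rw [hJ, measureReal_prod_snd]
    have := measureReal_pi_lt_abs_sum_le memLp_two_centred_expMeasure_one
      integral_centred_expMeasure_one hn0 hM0
    rwa [integral_centred_sq_expMeasure_one] at this
  have b2 : J.real {q | (fun i => (q.1 i, q.2 i)) ∈
      {x : Fin n → Obs p × ℝ | M * √n < |∑ i, influence P β j (x i).1 * ((x i).2 - 1)|}}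
      ≤ (1 + K) / M ^ 2 := by
    rw [hJ, sampleLaw, measureReal_def, prod_pi_apply_pairs]
    have hmem : MemLp (fun q : Obs p × ℝ => influence P β j q.1 * (q.2 - 1)) 2
        (P.prod (expMeasure 1)) := by
      rw [memLp_two_iff_integrable_sq (by fun_prop)]
      simp only [mul_pow]
      exact hξ2.integrable_sq.mul_prod integrable_centred_sq_expMeasure_one
    have h0 : ∫ q, influence P β j q.1 * (q.2 - 1) ∂(P.prod (expMeasure 1)) = 0 := by
      rw [integral_prod_mul (influence P β j) fun w => w - 1, hξ0, zero_mul]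
    have := measureReal_pi_lt_abs_sum_le hmem h0 hn0 hM0
    refine this.trans ?_
    simp only [mul_pow]
    rw [integral_prod_mul (fun o => influence P β j o ^ 2) fun w => (w - 1) ^ 2,
      integral_centred_sq_expMeasure_one, mul_one]
    gcongr
  have b3 : J.real {q | q.1 ∈ {z : Data n p | M * √n < |∑ i, influence P β j (z i)|}}
      ≤ (1 + K) / M ^ 2 := by
    rw [hJ, measureReal_prod_fst]
    refine (measureReal_pi_lt_abs_sum_le hξ2 hξ0 hn0 hM0).trans ?_
    gcongr
  have b4 := HasExpMoment.measureReal_multiplier_le (μ := P) (ι := Fin p × Fin p) (n := n)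
    (a := fun m o => o.1 m.1 * o.1 m.2) (fun m => h.cov m.1 m.2) hκ hn hL hN2 hM hA
  have b5 := HasExpMoment.measureReal_multiplier_le (μ := P) (n := n)
    (a := fun k o => o.1 k * err β o) h.score hκ hn hL hN1 hM hA
  have b6 : J.real {q | q.1 ∈ {z : Data n p | ∃ m : Fin p × Fin p,
      M * (n * (1 + r)) < |∑ i, (z i).1 m.1 * (z i).1 m.2|}} ≤ Real.exp (-A * L) := by
    rw [hJ, measureReal_prod_fst]
    exact HasExpMoment.measureReal_sum_abs_le (μ := P) (n := n)
      (a := fun (m : Fin p × Fin p) o => o.1 m.1 * o.1 m.2) (fun m => h.cov m.1 m.2) hκ hn hL hN2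
      hM hA
  have b7 : J.real {q | q.1 ∈ {z : Data n p | ∃ k,
      M * (n * r) < |∑ i, (z i).1 k * err β (z i)|}} ≤ 2 * Real.exp (-A * L) := by
    rw [hJ, measureReal_prod_fst]
    exact HasExpMoment.measureReal_centred_le (μ := P) (n := n)
      (a := fun k o => o.1 k * err β o) h.score h.integral_score hκ hn hL hN1 hM hA
  have B := (measureReal_union_le _ _).trans (add_le_add b1
    ((measureReal_union_le _ _).trans (add_le_add b2
    ((measureReal_union_le _ _).trans (add_le_add b3
    ((measureReal_union_le _ _).trans (add_le_add b4
    ((measureReal_union_le _ _).trans (add_le_add b5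
    ((measureReal_union_le _ _).trans (add_le_add b6 b7)))))))))))
  refine le_trans (le_trans (measureReal_mono fun q hq => ?_) B) ?_
  · by_contra hcon
    simp only [Set.mem_union, Set.mem_ofPred_eq, not_or, not_lt, not_exists, Prod.forall] at hcon
    obtain ⟨c1, c2, c3, c4, c5, c6, c7⟩ := hcon
    exact hq ⟨c1, c2, c3, c4, c5, c6, c7⟩
  · have e : (3 + 2 * K) / M ^ 2 = 1 / M ^ 2 + (1 + K) / M ^ 2 + (1 + K) / M ^ 2 := by ring
    have e' : (4 : ℝ) / n = 2 / n + 2 / n := by ring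
    rw [e, e']
    linarith

theorem exists_measureReal_not_isRegular_le {κ : ℝ} (hκ : 1 ≤ κ) {K : ℝ} (hK : 0 ≤ K) {η : ℝ}
    (hη : 0 < η) :
    ∃ M : ℝ, 1 ≤ M ∧ ∃ N : ℕ, ∀ n ≥ N, ∀ {p : ℕ} (P : Measure (Obs p)) [IsProbabilityMeasure P]
      (β : Fin p → ℝ) (j : Fin p), HasMomentBounds P β j κ K →
      ((sampleLaw n P).prod (Measure.pi fun _ : Fin n => expMeasure 1)).real
        {q | ¬ IsRegular P β j M (maxRate n (Real.log (p + 1))) q.1 q.2} ≤ η := by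
  -- Each of the three error terms gets `η / 3`; here `7 * exp (-A / 2) ≤ 7 * (2 / A) = η / 3`.
  -- Neither `M` nor `N` depends on the dimension or on the law.
  set A : ℝ := 42 / η with hA
  have hA0 : 0 < A := by positivity
  set M : ℝ := 12 * κ * (16 * κ ^ 2 + 2 + A) + (3 + 2 * K) * 3 / η + 1 with hM
  have h1 : 0 ≤ 12 * κ * (16 * κ ^ 2 + 2 + A) := by positivity
  have h2 : 0 ≤ (3 + 2 * K) * 3 / η := by positivity
  have hM1 : 1 ≤ M := by linarith
  obtain ⟨N, hN⟩ := exists_nat_gt (12 / η)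
  refine ⟨M, hM1, N + 3, fun n hn p P _ β j h => ?_⟩
  refine (measureReal_not_isRegular_le h hκ (by omega) (by linarith : _ ≤ M) hA0.le hM1).trans ?_
  have t1 : (3 + 2 * K) / M ^ 2 ≤ η / 3 := by
    rw [div_le_iff₀ (by positivity)]
    have h3 : (3 + 2 * K) * 3 / η ≤ M ^ 2 := by nlinarith
    rw [div_le_iff₀ hη] at h3
    linarith
  have t2 : (4 : ℝ) / n ≤ η / 3 := by
    have hn' : 12 / η < n := hN.trans (by exact_mod_cast (by omega : N < n))
    have hn0 : (0 : ℝ) < n := lt_trans (by positivity) hn'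
    rw [div_lt_iff₀ hη] at hn'
    rw [div_le_iff₀ hn0]
    linarith
  have t3 : 7 * Real.exp (-A / 2) ≤ η / 3 := by
    have h3 : A / 2 ≤ Real.exp (A / 2) := by linarith [Real.add_one_le_exp (A / 2)]
    have h4 : Real.exp (-A / 2) ≤ (A / 2)⁻¹ := by
      rw [neg_div, Real.exp_neg]; exact inv_anti₀ (by positivity) h3
    have h5 : 7 * (A / 2)⁻¹ = η / 3 := by rw [hA]; field_simp; norm_num
    linarith
  linarith

end Regularity

/-! ### From approximation to bounded Lipschitz distance -/

section BoundedLipschitz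

theorem abs_le_one_of_blNorm_le {f : ℝ → ℝ} (h : blNorm f ≤ 1) (x : ℝ) : |f x| ≤ 1 := by
  have h1 : ‖f x‖ₑ ≤ 1 := (le_iSup (fun x => ‖f x‖ₑ) x).trans (le_self_add.trans h)
  rwa [← enorm_one (G := ℝ), enorm_le_iff_norm_le, norm_one] at h1

theorem abs_sub_le_of_blNorm_le {f : ℝ → ℝ} (h : blNorm f ≤ 1) (x y : ℝ) :
    |f x - f y| ≤ |x - y| := by
  rcases eq_or_ne x y with rfl | hxy
  · simp
  have h1 : ‖f x - f y‖ₑ / edist x y ≤ 1 :=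
    (le_iSup₂_of_le x y (le_iSup (fun _ : x ≠ y => ‖f x - f y‖ₑ / edist x y) hxy)).trans
      (le_add_self.trans h)
  have h2 := ENNReal.div_le_iff_le_mul (b := edist x y) (c := 1) (a := ‖f x - f y‖ₑ)
    (Or.inl (edist_pos.mpr hxy).ne') (Or.inl (edist_ne_top _ _))
  rw [h2, one_mul, edist_eq_enorm_sub] at h1
  exact enorm_le_iff_norm_le.mp h1

theorem abs_integral_comp_sub_le {α : Type*} [MeasurableSpace α] {μ : Measure α}
    [IsProbabilityMeasure μ] {f : ℝ → ℝ} (hm : Measurable f) (hb : ∀ x, |f x| ≤ 1)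
    (hL : ∀ x y, |f x - f y| ≤ |x - y|) {U V : α → ℝ} (hU : Measurable U) (hV : Measurable V)
    {S : Set α} {τ : ℝ} (hτ : 0 ≤ τ) (h : ∀ x ∉ S, |U x - V x| ≤ τ) :
    |∫ x, f (U x) ∂μ - ∫ x, f (V x) ∂μ| ≤ τ + 2 * μ.real S := by
  have mU : Measurable fun x => f (U x) := hm.comp hU
  have mV : Measurable fun x => f (V x) := hm.comp hV
  have iU := integrable_of_abs_le (μ := μ) mU fun x => hb _
  have iV := integrable_of_abs_le (μ := μ) mV fun x => hb _
  -- `S` is not assumed measurable, so its measurable hull is used; on it the integrand is at most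
  -- 2.
  have hS := measurableSet_toMeasurable μ S
  have iS : Integrable ((toMeasurable μ S).indicator fun _ => (2 : ℝ)) μ :=
    (integrable_const _).indicator hS
  rw [← integral_sub iU iV]
  calc _ ≤ ∫ x, |f (U x) - f (V x)| ∂μ := abs_integral_le_integral_abs
    _ ≤ ∫ x, (τ + (toMeasurable μ S).indicator (fun _ => (2 : ℝ)) x) ∂μ := by
        refine integral_mono (iU.sub iV).abs ((integrable_const _).add iS) fun x => ?_
        by_cases hx : x ∈ toMeasurable μ S
        · simp only [hx, Set.indicator_of_mem]
          have := abs_sub (f (U x)) (f (V x))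
          linarith [hb (U x), hb (V x)]
        · simp only [hx, not_false_eq_true, Set.indicator_of_notMem, add_zero]
          exact (hL _ _).trans (h x fun hxS => hx (subset_toMeasurable μ S hxS))
    _ = τ + 2 * μ.real S := by
        rw [integral_add (integrable_const _) iS, integral_indicator_const _ hS]
        simp [measureReal_def, measure_toMeasurable, mul_comm]

variable {n p : ℕ}

theorem measurable_debias_pair (z : Data n p) (Θ : Matrix (Fin p) (Fin p) ℝ) (b : Fin p → ℝ)
    (j : Fin p) : Measurable fun q : (Fin p → ℝ) × (Fin n → ℝ) =>
      √(n : ℝ) * (debias z Θ q.1 q.2 j - b j) := by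
  simp only [debias, Pi.add_apply, Matrix.mulVec, dotProduct, err]
  fun_prop

theorem debiasedLaw_eq (post : Kernel (Data n p) (Fin p → ℝ)) [IsMarkovKernel post]
    (Θ : Matrix (Fin p) (Fin p) ℝ) (b : Fin p → ℝ) (j : Fin p) (z : Data n p) :
    debiasedLaw post Θ b j z = ((post z).prod (Measure.pi fun _ : Fin n => expMeasure 1)).map
      fun q => √(n : ℝ) * (debias z Θ q.1 (fun i => q.2 i / ∑ k, q.2 k) j - b j) := by
  have hm : Measurable fun (ω : Fin n → ℝ) i => ω i / ∑ k, ω k := by fun_prop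
  have h := Measure.map_prod_map (post z) (Measure.pi fun _ : Fin n => expMeasure 1)
    measurable_id hm
  rw [Measure.map_id] at h
  rw [debiasedLaw, bootstrapLaw, h,
    Measure.map_map (measurable_debias_pair z Θ b j) (measurable_id.prodMap hm)]
  rfl

/-- A bound on the bounded Lipschitz distance of the debiased posterior and a normal law, in terms
of an approximation of the debiased draw by a weighted sum of centred exponential variables. -/
theorem exists_dBL_debiasedLaw_le :
    ∃ ρ : ℝ, 0 ≤ ρ ∧ ∀ {n p : ℕ} (post : Kernel (Data n p) (Fin p → ℝ)) [IsMarkovKernel post]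
      (Θ : Matrix (Fin p) (Fin p) ℝ) (b : Fin p → ℝ) (j : Fin p) (z : Data n p)
      (c : Fin n → ℝ) (v τ : ℝ) (E : Set (Fin n → ℝ)) (F : Set (Fin p → ℝ)), 0 ≤ v → 0 < τ →
      (∀ ω ∉ E, ∀ β ∉ F, |√(n : ℝ) * (debias z Θ β (fun i => ω i / ∑ k, ω k) j - b j)
        - ∑ i, c i * (ω i - 1)| ≤ τ) →
      (Measure.pi fun _ : Fin n => expMeasure 1).real E ≤ τ → (post z).real F ≤ τ →
      |∑ i, c i ^ 2 - v| ≤ τ ^ 2 → ∑ i, |c i| ^ 3 ≤ τ ^ 3 →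
      dBL (debiasedLaw post Θ b j z) (gaussianReal 0 v.toNNReal) ≤ (10 + ρ) * τ := by
  obtain ⟨ρ, hρ, H⟩ := exists_abs_integral_exp_sub_gaussian_le
  refine ⟨ρ, hρ, fun {n p} post _ Θ b j z c v τ E F hv hτ hEF hE hF h2 h3 => ?_⟩
  refine Real.sSup_le ?_ (by positivity)
  rintro x ⟨f, hm, hbl, rfl⟩
  have hb := abs_le_one_of_blNorm_le hbl
  have hL := abs_sub_le_of_blNorm_le hbl
  have mU : Measurable fun q : (Fin p → ℝ) × (Fin n → ℝ) =>
      √(n : ℝ) * (debias z Θ q.1 (fun i => q.2 i / ∑ k, q.2 k) j - b j) :=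
    (measurable_debias_pair z Θ b j).comp (f := fun q : (Fin p → ℝ) × (Fin n → ℝ) =>
      (q.1, fun i => q.2 i / ∑ k, q.2 k)) (by fun_prop)
  have mV : Measurable fun q : (Fin p → ℝ) × (Fin n → ℝ) => ∑ i, c i * (q.2 i - 1) := by fun_prop
  set J := (post z).prod (Measure.pi fun _ : Fin n => expMeasure 1) with hJ
  have d1 := abs_integral_comp_sub_le (μ := J) hm hb hL mU mV
    (S := {q | q.1 ∈ F} ∪ {q | q.2 ∈ E}) hτ.le fun q hq => by
      simp only [Set.mem_union, Set.mem_ofPred_eq, not_or] at hq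
      exact hEF _ hq.2 _ hq.1
  have d1' : J.real ({q | q.1 ∈ F} ∪ {q | q.2 ∈ E}) ≤ τ + τ := by
    refine (measureReal_union_le _ _).trans (add_le_add ?_ ?_)
    · rw [hJ, measureReal_prod_fst]; exact hF
    · rw [hJ, measureReal_prod_snd]; exact hE
  -- The smoothing scale is `τ`, which explains the tolerances `τ ^ 2` and `τ ^ 3`. The errors are
  -- `τ + 2 * (2 * τ)` for the approximation, `(4 + ρ) * τ` for the central limit theorem and `τ`
  -- for the variance.
  have d2 := H n c f hb hL τ hτ
  have e2 : ∫ q, f (∑ i, c i * (q.2 i - 1)) ∂J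
      = ∫ ω, f (∑ i, c i * (ω i - 1)) ∂(Measure.pi fun _ : Fin n => expMeasure 1) := by
    rw [hJ, integral_fun_snd (fun ω : Fin n → ℝ => f (∑ i, c i * (ω i - 1)))]
    simp
  have d3 := abs_integral_gaussianReal_sub_le hb hL
    (a := ∑ i, c i ^ 2)
    (Finset.sum_nonneg fun i _ => sq_nonneg (c i)) hv
  have d3' : √|∑ i, c i ^ 2 - v| ≤ τ := Real.sqrt_le_iff.mpr ⟨hτ.le, h2⟩
  have d4 : ρ / τ ^ 2 * ∑ i, |c i| ^ 3 ≤ ρ * τ := by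
    calc _ ≤ ρ / τ ^ 2 * τ ^ 3 := by gcongr
      _ = _ := by field_simp
  rw [debiasedLaw_eq, integral_map mU.aemeasurable hm.aestronglyMeasurable]
  rw [e2] at d1
  rw [abs_le] at *
  constructor <;> linarith [d1.1, d1.2, d2.1, d2.2, d3.1, d3.2]

end BoundedLipschitz

/-! ### Uniform constants and rates from the hypotheses -/

theorem exists_hasMomentBounds {p : ℕ → ℕ} {P : ∀ n, Measure (Obs (p n))}
    {β₀ : ∀ n, Fin (p n) → ℝ} {j : ∀ n, Fin (p n)}
    (hmodel : ∀ n k, ∫ o, o.1 k * err (β₀ n) o ∂(P n) = 0)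
    (hsubX : ∃ K : ℝ≥0, ∀ n, psi2NormVec (P n) (fun o => o.1) ≤ K)
    (hsubE : ∃ K : ℝ≥0, ∀ n, psi2Norm (P n) (err (β₀ n)) ≤ K)
    (hmom : ∃ K : ℝ≥0, ∀ n,
      ∫⁻ o, ‖(precision (P n) *ᵥ o.1) (j n) * err (β₀ n) o‖ₑ ^ 3 ∂(P n) ≤ K) :
    ∃ κ K : ℝ, 1 ≤ κ ∧ 0 ≤ K ∧ ∀ n, HasMomentBounds (P n) (β₀ n) (j n) κ K := by
  obtain ⟨KX, hX⟩ := hsubX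
  obtain ⟨KE, hE⟩ := hsubE
  obtain ⟨K, hK⟩ := hmom
  -- The `+ 1` makes `k` strictly larger than both bounds and at least 1.
  set k : ℝ := KX + KE + 1 with hk
  have hkX : (KX : ℝ) < k := by have := KE.coe_nonneg; linarith
  have hkE : (KE : ℝ) < k := by have := KX.coe_nonneg; linarith
  have hk1 : 1 ≤ k := by have := KX.coe_nonneg; have := KE.coe_nonneg; linarith
  refine ⟨k ^ 2, K, by nlinarith, K.coe_nonneg, fun n => ?_⟩
  have eX := fun l => lintegral_exp_sq_le_of_psi2Norm_le
    ((psi2Norm_coord_le (μ := P n) (fun o => o.1) l).trans (hX n)) hkX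
  have eE := lintegral_exp_sq_le_of_psi2Norm_le (hE n) hkE
  have e3 : ∀ o, ENNReal.ofReal (|influence (P n) (β₀ n) (j n) o| ^ 3)
      = ‖(precision (P n) *ᵥ o.1) (j n) * err (β₀ n) o‖ₑ ^ 3 := fun o => by
    rw [ENNReal.ofReal_pow (abs_nonneg _), Real.enorm_eq_ofReal_abs]; rfl
  have hl : ∫⁻ o, ENNReal.ofReal (|influence (P n) (β₀ n) (j n) o| ^ 3) ∂(P n) ≤ K := by
    simp only [e3]; exact hK n
  have hm : AEStronglyMeasurable (fun o => |influence (P n) (β₀ n) (j n) o| ^ 3) (P n) := by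
    fun_prop
  have hnn : 0 ≤ᵐ[P n] fun o => |influence (P n) (β₀ n) (j n) o| ^ 3 :=
    Eventually.of_forall fun o => by positivity
  refine ⟨fun l m => hasExpMoment_mul (by fun_prop) (by fun_prop) (by positivity) (eX l) (eX m),
    fun l => hasExpMoment_mul (by fun_prop) (by fun_prop) (by positivity) (eX l) eE, hmodel n,
    ⟨hm, ?_⟩, ?_⟩
  · rw [hasFiniteIntegral_iff_ofReal hnn]
    exact hl.trans_lt ENNReal.coe_lt_top
  · rw [integral_eq_lintegral_of_nonneg_ae hnn hm]
    exact ENNReal.toReal_le_of_le_ofReal K.coe_nonneg (by simpa using hl)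

theorem maxRate_two_mul_le {n : ℕ} {L L' : ℝ} (h0 : 0 ≤ L') (h : L' ≤ 2 * L) :
    maxRate n L' ≤ 4 * maxRate n L := by
  have h1 : √(L' / n) ≤ 4 * √(L / n) := by
    have e : (4 : ℝ) * √(L / n) = √(16 * (L / n)) := by
      rw [Real.sqrt_mul (by norm_num), show (16 : ℝ) = 4 ^ 2 by norm_num,
        Real.sqrt_sq (by norm_num)]
    rw [e, ← mul_div_assoc]
    apply Real.sqrt_le_sqrt
    gcongr
    linarith
  have h2 : Real.log n ^ 2 * L' ^ 2 / n ≤ 4 * (Real.log n ^ 2 * L ^ 2 / n) := by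
    calc _ ≤ Real.log n ^ 2 * (2 * L) ^ 2 / n := by gcongr
      _ = _ := by ring
  unfold maxRate
  linarith

theorem sqrt_mul_maxRate_log_two_le {n : ℕ} (hn : 0 < n) :
    √(n : ℝ) * maxRate n (Real.log 2) ≤ 17 := by
  have hnR : (0 : ℝ) < n := by exact_mod_cast hn
  have hsp : 0 < √(n : ℝ) := Real.sqrt_pos.mpr hnR
  have hs : √(n : ℝ) * √n = n := Real.mul_self_sqrt hnR.le
  have l0 : 0 ≤ Real.log 2 := Real.log_nonneg (by norm_num)
  have l1 : Real.log 2 ≤ 1 := by linarith [Real.log_two_lt_d9]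
  have h1 : √(n : ℝ) * √(Real.log 2 / n) ≤ 1 := by
    rw [← Real.sqrt_mul hnR.le, mul_div_cancel₀ _ hnR.ne']
    exact Real.sqrt_le_one.mpr l1
  have h2 : Real.log n ^ 2 ≤ 16 * √(n : ℝ) := by
    have := Real.log_le_rpow_div hnR.le (by norm_num : (0 : ℝ) < 1 / 4)
    have e : ((n : ℝ) ^ (1 / 4 : ℝ) / (1 / 4)) ^ 2 = 16 * √(n : ℝ) := by
      rw [div_pow, ← Real.rpow_natCast, ← Real.rpow_mul hnR.le, Real.sqrt_eq_rpow]
      norm_num; ring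
    rw [← e]
    have := Real.log_natCast_nonneg n
    gcongr
  have h3 : √(n : ℝ) * (Real.log n ^ 2 * Real.log 2 ^ 2 / n) ≤ 16 := by
    rw [← mul_div_assoc, div_le_iff₀ hnR]
    calc _ ≤ √(n : ℝ) * (16 * √n * 1) := by
          gcongr
          exact pow_le_one₀ l0 l1
      _ = _ := by rw [mul_one, mul_left_comm, hs]
  rw [maxRate, mul_add]
  linarith

/-- Passes from `log p` in the hypothesis to `log (p + 1)`. For `p ≥ 2`, `p + 1 ≤ p ^ 2` costs a
factor 4. For `p = 1` the hypothesis is void, but `√n * maxRate n (log 2)` is bounded and `ε a + δ`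
is small because `a` is bounded there. -/
theorem tendsto_rate {p : ℕ → ℕ} (hp : ∀ n, 1 ≤ p n) {ε δ a : ℕ → ℝ} (ha : ∀ n, 0 ≤ a n)
    (hε_pos : ∀ n, 0 < ε n) (hε : Tendsto ε atTop (𝓝 0))
    (hδ_pos : ∀ n, 0 < δ n) (hδ : Tendsto δ atTop (𝓝 0))
    (hrate : Tendsto (fun n : ℕ => √(n : ℝ) * (ε n * a n + δ n) *
      (√(Real.log (p n) / n) + Real.log n ^ 2 * Real.log (p n) ^ 2 / n)) atTop (𝓝 0))
    (hone : ∃ K : ℝ, ∀ n, p n = 1 → a n ≤ K) :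
    Tendsto (fun n : ℕ => √(n : ℝ) * (ε n * a n + δ n) * maxRate n (Real.log (p n + 1)))
      atTop (𝓝 0) := by
  obtain ⟨K, hK⟩ := hone
  have hlim : Tendsto (fun n : ℕ => 4 * (√(n : ℝ) * (ε n * a n + δ n) *
      maxRate n (Real.log (p n))) + (ε n * |K| + δ n) * 17) atTop (𝓝 0) := by
    have h1 := (hrate.const_mul 4).add (((hε.mul_const |K|).add hδ).mul_const 17)
    rw [mul_zero, zero_mul, add_zero, zero_mul, add_zero] at h1
    exact h1
  have hD : ∀ n, 0 ≤ ε n * a n + δ n := fun n =>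
    add_nonneg (mul_nonneg (hε_pos n).le (ha n)) (hδ_pos n).le
  refine squeeze_zero' (Eventually.of_forall fun n => ?_) ?_ hlim
  · exact mul_nonneg (mul_nonneg (Real.sqrt_nonneg _) (hD n)) (maxRate_nonneg _ _)
  filter_upwards [eventually_gt_atTop 0] with n hn
  have hA : 0 ≤ (ε n * |K| + δ n) * 17 := by
    have := (hε_pos n).le; have := (hδ_pos n).le; positivity
  have hB : 0 ≤ √(n : ℝ) * (ε n * a n + δ n) * maxRate n (Real.log (p n)) :=
    mul_nonneg (mul_nonneg (Real.sqrt_nonneg _) (hD n)) (maxRate_nonneg _ _)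
  rcases (hp n).eq_or_lt with h1 | h1
  · have e : Real.log ((p n : ℝ) + 1) = Real.log 2 := by rw [← h1]; norm_num
    have h2 : ε n * a n + δ n ≤ ε n * |K| + δ n := by
      have := (hK n h1.symm).trans (le_abs_self K)
      have := (hε_pos n).le
      gcongr
    rw [e]
    calc _ = (ε n * a n + δ n) * (√(n : ℝ) * maxRate n (Real.log 2)) := by ring
      _ ≤ (ε n * |K| + δ n) * 17 := by
        refine mul_le_mul h2 (sqrt_mul_maxRate_log_two_le hn)
          (mul_nonneg (Real.sqrt_nonneg _) (maxRate_nonneg _ _)) ((hD n).trans h2)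
      _ ≤ _ := by linarith
  · have hpR : (2 : ℝ) ≤ p n := by exact_mod_cast h1
    have h2 : Real.log ((p n : ℝ) + 1) ≤ 2 * Real.log (p n) := by
      rw [← Real.log_rpow (by linarith)]
      apply Real.log_le_log (by linarith)
      norm_num
      nlinarith
    have h3 := maxRate_two_mul_le (n := n) (Real.log_nonneg (by linarith)) h2
    calc _ ≤ √(n : ℝ) * (ε n * a n + δ n) * (4 * maxRate n (Real.log (p n))) :=
          mul_le_mul_of_nonneg_left h3 (mul_nonneg (Real.sqrt_nonneg _) (hD n))
      _ ≤ _ := by linarith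

theorem inv_sqrt_le_two_mul_maxRate {n p : ℕ} (hn : 3 ≤ n) (hp : 1 ≤ p) :
    (√(n : ℝ))⁻¹ ≤ 2 * maxRate n (Real.log (p + 1)) := by
  have hnR : (0 : ℝ) < n := by positivity
  have hpR : (1 : ℝ) ≤ p := by exact_mod_cast hp
  have hL : 1 / 4 ≤ Real.log ((p : ℝ) + 1) := by
    have : Real.log 2 ≤ Real.log ((p : ℝ) + 1) := Real.log_le_log (by norm_num) (by linarith)
    linarith [Real.log_two_gt_d9]
  have h1 : √(1 / 4 / (n : ℝ)) ≤ √(Real.log ((p : ℝ) + 1) / n) := Real.sqrt_le_sqrt (by gcongr)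
  have h2 : √(1 / 4 / (n : ℝ)) = (√(n : ℝ))⁻¹ / 2 := by
    rw [Real.sqrt_div (by norm_num), show (1 / 4 : ℝ) = (1 / 2) ^ 2 by norm_num,
      Real.sqrt_sq (by norm_num)]
    field_simp
  have h3 : 0 ≤ Real.log n ^ 2 * Real.log ((p : ℝ) + 1) ^ 2 / n := by positivity
  unfold maxRate
  linarith

theorem dBL_nonneg {E : Type*} [MetricSpace E] [MeasurableSpace E] (P Q : Measure E) :
    0 ≤ dBL P Q := by
  refine Real.sSup_nonneg ?_
  rintro x ⟨f, -, -, rfl⟩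
  exact abs_nonneg _

theorem measurableSet_l1Norm_le {p : ℕ} (β : Fin p → ℝ) (c : ℝ) :
    MeasurableSet {b : Fin p → ℝ | c ≤ l1Norm (b - β)} := by
  refine measurableSet_le measurable_const ?_
  unfold l1Norm
  simp only [Pi.sub_apply]
  fun_prop

theorem meas_ofReal_le_le {α : Type*} [MeasurableSpace α] {μ : Measure α} {f : α → ℝ≥0∞}
    (hf : Measurable f) {τ a : ℝ} (hτ : 0 < τ)
    (h : ∫⁻ x, f x ∂μ ≤ ENNReal.ofReal (τ * a)) :
    μ {x | ENNReal.ofReal τ ≤ f x} ≤ ENNReal.ofReal a := by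
  have hτ' : ENNReal.ofReal τ ≠ 0 := by simpa using hτ
  refine (meas_ge_le_lintegral_div hf.aemeasurable hτ' ENNReal.ofReal_ne_top).trans ?_
  refine ENNReal.div_le_of_le_mul (h.trans (le_of_eq ?_))
  rw [ENNReal.ofReal_mul hτ.le, mul_comm]

end DebiasedBayes

/-! ### The theorem -/

theorem theorem1
    -- dimension, law of one observation, and true coefficient vector at sample size `n`
    (p : ℕ → ℕ) (P : ∀ n, Measure (Obs (p n))) [∀ n, IsProbabilityMeasure (P n)]
    (β₀ : ∀ n, Fin (p n) → ℝ)
    -- initial (exact or approximate) posterior, precision matrix estimator, centering estimator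
    (post : ∀ n, Kernel (Data n (p n)) (Fin (p n) → ℝ)) [∀ n, IsMarkovKernel (post n)]
    (Θhat : ∀ n, Data n (p n) → Matrix (Fin (p n)) (Fin (p n)) ℝ)
    (hΘhat : ∀ n k l, Measurable fun z => Θhat n z k l)
    (βhat : ∀ n, Data n (p n) → Fin (p n) → ℝ) (hβhat : ∀ n, Measurable (βhat n))
    -- the coordinate, which may change with `n`
    (j : ∀ n, Fin (p n))
    -- the precision matrix exists
    (hΩ : ∀ n, IsUnit (popCov (P n)).det)
    -- contraction rate of the initial posterior
    (ε : ℕ → ℝ) (hε_pos : ∀ n, 0 < ε n) (hε : Tendsto ε atTop (𝓝 0))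
    (hpost : ∃ C : ℝ, 0 < C ∧ Tendsto (fun n => ∫⁻ z, post n z
      {b | C * ε n ≤ l1Norm (b - β₀ n)} ∂(sampleLaw n (P n))) atTop (𝓝 0))
    -- convergence rates of the precision matrix estimator
    (γ : ℕ → ℝ) (hγ_pos : ∀ n, 0 < γ n) (hγ : Tendsto γ atTop (𝓝 0))
    (δ : ℕ → ℝ) (hδ_pos : ∀ n, 0 < δ n) (hδ : Tendsto δ atTop (𝓝 0))
    (hprec_max : IsBigOP (fun n => sampleLaw n (P n))
      (fun n z => maxNorm (Θhat n z * sampleCov z - 1)) γ)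
    (hprec_inf : IsBigOP (fun n => sampleLaw n (P n))
      (fun n z => opNormInf (Θhat n z - precision (P n))) δ)
    -- linear expansion of the centering estimator
    (hcenter : IsLittleOP (fun n => sampleLaw n (P n))
      (fun n z => ‖βhat n z - (β₀ n + precision (P n) *ᵥ sampleScore (β₀ n) z)‖)
      (fun n => (√(n : ℝ))⁻¹))
    -- the model, and the moment conditions
    (hmodel : ∀ n k, ∫ o, o.1 k * err (β₀ n) o ∂(P n) = 0)
    (hsubX : ∃ K : ℝ≥0, ∀ n, psi2NormVec (P n) (fun o => o.1) ≤ K)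
    (hsubE : ∃ K : ℝ≥0, ∀ n, psi2Norm (P n) (err (β₀ n)) ≤ K)
    (hmom : ∃ K : ℝ≥0, ∀ n,
      ∫⁻ o, ‖(precision (P n) *ᵥ o.1) (j n) * err (β₀ n) o‖ₑ ^ 3 ∂(P n) ≤ K)
    -- rate conditions
    (hrate₁ : Tendsto (fun n : ℕ => √(n : ℝ) * ε n * γ n) atTop (𝓝 0))
    (hrate₂ : Tendsto (fun n : ℕ => √(n : ℝ) * (ε n * opNormInf (precision (P n)) + δ n) *
      (√(Real.log (p n) / n) + Real.log n ^ 2 * Real.log (p n) ^ 2 / n)) atTop (𝓝 0))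
    -- only for dimension one, where `log p = 0` and the last condition is void
    (hone : ∃ K : ℝ, ∀ n, p n = 1 → opNormInf (precision (P n)) ≤ K) :
    IsLittleOP (fun n => sampleLaw n (P n))
      (fun n z => dBL (debiasedLaw (post n) (Θhat n z) (βhat n z) (j n) z)
        (gaussianReal 0 (sandwichVar (P n) (β₀ n) (j n)).toNNReal))
      (fun _ => 1) := by
  have hp : ∀ n, 1 ≤ p n := fun n => by have := (j n).isLt; omega
  obtain ⟨κ, K, hκ, hK, hmb⟩ := exists_hasMomentBounds (j := j) hmodel hsubX hsubE hmom
  have hκ0 : 0 < κ := by linarith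
  obtain ⟨C, hC, hpost⟩ := hpost
  obtain ⟨ρ, hρ, hdBL⟩ := exists_dBL_debiasedLaw_le
  intro η hη
  rw [ENNReal.tendsto_nhds_zero]
  intro e he
  obtain ⟨e₀, he₀, he₁⟩ := ENNReal.lt_iff_exists_nnreal_btwn.mp he
  -- Seven exceptional data events share the allowed probability.
  set a : ℝ := e₀ / 7 with ha
  have he₀' : 0 < (e₀ : ℝ) := by exact_mod_cast he₀
  have ha0 : 0 < a := by positivity
  have hA0 : 0 < ENNReal.ofReal a := by simpa using ha0
  set τ : ℝ := η / (10 + ρ) with hτdef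
  have hτ : 0 < τ := by positivity
  obtain ⟨M₁, hM₁⟩ := hprec_inf (ENNReal.ofReal a) hA0
  obtain ⟨M₂, hM₂⟩ := hprec_max (ENNReal.ofReal a) hA0
  have hcen := ENNReal.tendsto_nhds_zero.mp (hcenter (τ / 2) (by positivity)) _ hA0
  -- An expectation below `τ * a` means, by Markov, conditional mass below `τ` outside data of
  -- probability `a`. The same split is used for regularity.
  have hpo := ENNReal.tendsto_nhds_zero.mp hpost (ENNReal.ofReal (τ * a))
    (by simpa using mul_pos hτ ha0)
  obtain ⟨M, hM1, N₁, hreg⟩ := exists_measureReal_not_isRegular_le hκ hK (mul_pos hτ ha0)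
  obtain ⟨N₂, hLLN⟩ := exists_measureReal_pi_abs_average_sq_sub_le K (pow_pos hτ 2) ha0
  set r : ℕ → ℝ := fun n => maxRate n (Real.log (p n + 1)) with hr
  have hrate := tendsto_rate hp (fun n => opNormInf_nonneg (precision (P n))) hε_pos hε hδ_pos hδ
    hrate₂ hone
  have hsqrt : Tendsto (fun n : ℕ => (√(n : ℝ))⁻¹) atTop (𝓝 0) :=
    (Real.tendsto_sqrt_atTop.comp tendsto_natCast_atTop_atTop).inv_tendsto_atTop
  have hrem : Tendsto (fun n : ℕ =>
      √(n : ℝ) * (|M₁| * δ n * (5 * M ^ 2 * r n) + |M₂| * γ n * (C * ε n)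
        + (|M₁| * δ n + opNormInf (precision (P n))) * (8 * M ^ 2 * r n * (C * ε n)))
        + 4 * M ^ 2 / √n) atTop (𝓝 0) := by
    have hub : Tendsto (fun n : ℕ => (5 * M ^ 2 * |M₁| + 8 * M ^ 2 * C * |M₁| * ε n + 8 * M ^ 2 * C) *
        (√(n : ℝ) * (ε n * opNormInf (precision (P n)) + δ n) * maxRate n (Real.log (p n + 1)))
        + |M₂| * C * (√(n : ℝ) * ε n * γ n) + 4 * M ^ 2 * (√(n : ℝ))⁻¹) atTop (𝓝 0) := by
      simpa using (((((hε.const_mul (8 * M ^ 2 * C * |M₁|)).const_add (5 * M ^ 2 * |M₁|)).add_const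
        (8 * M ^ 2 * C)).mul hrate).add (hrate₁.const_mul (|M₂| * C))).add
        (hsqrt.const_mul (4 * M ^ 2))
    have hnn : ∀ n : ℕ, 0 ≤ √(n : ℝ) * (ε n * opNormInf (precision (P n)) * r n) ∧
        0 ≤ √(n : ℝ) * (δ n * r n) := fun n => by
      have h1 := opNormInf_nonneg (precision (P n))
      have h2 : 0 ≤ r n := maxRate_nonneg _ _
      have h3 := (hε_pos n).le
      have h4 := (hδ_pos n).le
      constructor <;> positivity
    refine squeeze_zero (fun n => ?_) (fun n => ?_) hub
    · have h1 := opNormInf_nonneg (precision (P n))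
      have h2 : 0 ≤ r n := maxRate_nonneg _ _
      have h3 := (hε_pos n).le
      have h4 := (hδ_pos n).le
      have h5 := (hγ_pos n).le
      positivity
    -- With `u` the `ε ‖Θ₀‖` part and `v` the `δ` part of the rate, every term containing `r` is a
    -- coefficient times `u` or `v`; multiplying the full coefficient by `u + v` adds only
    -- nonnegative terms.
    · obtain ⟨h1, h2⟩ := hnn n
      have h3 := (hε_pos n).le
      set u := √(n : ℝ) * (ε n * opNormInf (precision (P n)) * r n) with hu
      set v := √(n : ℝ) * (δ n * r n) with hv
      have e1 : √(n : ℝ) * (|M₁| * δ n * (5 * M ^ 2 * r n) + |M₂| * γ n * (C * ε n)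
          + (|M₁| * δ n + opNormInf (precision (P n))) * (8 * M ^ 2 * r n * (C * ε n)))
          + 4 * M ^ 2 / √n = 5 * M ^ 2 * |M₁| * v + 8 * M ^ 2 * C * |M₁| * ε n * v
            + 8 * M ^ 2 * C * u + |M₂| * C * (√(n : ℝ) * ε n * γ n) + 4 * M ^ 2 * (√(n : ℝ))⁻¹ := by
        rw [hu, hv, div_eq_mul_inv]; ring
      have e2 : √(n : ℝ) * (ε n * opNormInf (precision (P n)) + δ n) *
          maxRate n (Real.log (p n + 1)) = u + v := by rw [hu, hv]; simp only [hr]; ring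
      rw [e1, e2]
      have k1 : 0 ≤ 5 * M ^ 2 * |M₁| * u := by positivity
      have k2 : 0 ≤ 8 * M ^ 2 * C * |M₁| * ε n * u := by positivity
      have k3 : 0 ≤ 8 * M ^ 2 * C * v := by positivity
      nlinarith
  have hthird : ∀ᶠ n : ℕ in atTop, K / (τ ^ 3 * √(n : ℝ)) ≤ a := by
    have : Tendsto (fun n : ℕ => K / τ ^ 3 * (√(n : ℝ))⁻¹) atTop (𝓝 0) := by
      simpa using hsqrt.const_mul (K / τ ^ 3)
    filter_upwards [this.eventually (eventually_le_nhds ha0)] with n hn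
    rwa [← div_eq_mul_inv, div_div] at hn
  obtain ⟨N₃, hN₃⟩ := exists_nat_ge (4 * M ^ 2)
  filter_upwards [hM₁, hM₂, hcen, hpo, hrem.eventually (eventually_le_nhds (half_pos hτ)), hthird,
    eventually_ge_atTop (N₁ + N₂ + N₃ + 3)] with n h₁ h₂ h₃ hpo hremn hthirdn hn
  have hn3 : 3 ≤ n := by omega
  have hn0 : 0 < n := by omega
  have hnR : (0 : ℝ) < n := by exact_mod_cast hn0
  have hsp : 0 < √(n : ℝ) := Real.sqrt_pos.mpr hnR
  have hs : √(n : ℝ) * √n = n := Real.mul_self_sqrt hnR.le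
  have h4M : 4 * M ^ 2 ≤ n := hN₃.trans (by exact_mod_cast (by omega : N₃ ≤ n))
  set F : Set (Fin (p n) → ℝ) := {b | C * ε n ≤ l1Norm (b - β₀ n)} with hF
  set E : Data n (p n) → Set (Fin n → ℝ) := fun z =>
    {ω | ¬ IsRegular (P n) (β₀ n) (j n) M (r n) z ω} with hE
  have hEm := (measurableSet_isRegular (n := n) (P n) (β₀ n) (j n) M (r n)).compl
  have h₄ : sampleLaw n (P n) {z | ENNReal.ofReal τ ≤ post n z F} ≤ ENNReal.ofReal a :=
    meas_ofReal_le_le ((post n).measurable_coe (measurableSet_l1Norm_le _ _)) hτ hpo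
  -- By Fubini, the joint probability of irregularity is the mean over the data of its conditional
  -- probability over the weights.
  have h₅ : sampleLaw n (P n) {z | ENNReal.ofReal τ ≤
      (Measure.pi fun _ : Fin n => expMeasure 1) (E z)} ≤ ENNReal.ofReal a := by
    refine meas_ofReal_le_le (measurable_measure_prodMk_left hEm) hτ ?_
    have := hreg n (by omega) (P n) (β₀ n) (j n) (hmb n)
    rw [← ENNReal.ofReal_le_ofReal_iff (mul_pos hτ ha0).le, ofReal_measureReal] at this
    refine le_trans (le_of_eq ?_) this
    exact (Measure.prod_apply hEm).symm
  have h₆ : sampleLaw n (P n) {z | τ ^ 2 < |(n : ℝ)⁻¹ * ∑ i, influence (P n) (β₀ n) (j n) (z i) ^ 2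
      - ∫ o, influence (P n) (β₀ n) (j n) o ^ 2 ∂(P n)|} ≤ ENNReal.ofReal a := by
    have := hLLN n (by omega) (P n) (influence (P n) (β₀ n) (j n)) measurable_influence
      (hmb n).integrable_cube (hmb n).integral_cube
    rwa [← ENNReal.ofReal_le_ofReal_iff ha0.le, ofReal_measureReal] at this
  have h₇ : sampleLaw n (P n) {z | τ ^ 3 * (n * √n) < ∑ i, |influence (P n) (β₀ n) (j n) (z i)| ^ 3}
      ≤ ENNReal.ofReal a := by
    have := measureReal_pi_lt_sum_le (hmb n).integrable_cube (fun o => by positivity) n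
      (t := τ ^ 3 * (n * √n)) (by positivity)
    have h8 : n * (∫ o, |influence (P n) (β₀ n) (j n) o| ^ 3 ∂(P n)) / (τ ^ 3 * (n * √n)) ≤ a := by
      refine le_trans ?_ hthirdn
      rw [mul_left_comm, mul_div_mul_left _ _ hnR.ne']
      gcongr
      exact (hmb n).integral_cube
    have h9 := this.trans h8
    rwa [← ENNReal.ofReal_le_ofReal_iff ha0.le, ofReal_measureReal] at h9
  have hsum : ENNReal.ofReal a + (ENNReal.ofReal a + (ENNReal.ofReal a + (ENNReal.ofReal a
      + (ENNReal.ofReal a + (ENNReal.ofReal a + ENNReal.ofReal a))))) ≤ e := by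
    refine le_trans (le_of_eq ?_) he₁.le
    repeat rw [← ENNReal.ofReal_add (by positivity) (by positivity)]
    rw [← ENNReal.ofReal_coe_nnreal]
    congr 1
    rw [ha]; ring
  -- Only monotonicity and subadditivity are used, so measurability of the distance in the data is
  -- not needed.
  have hunion := (measure_union_le _ _).trans (add_le_add h₁ ((measure_union_le _ _).trans
    (add_le_add h₂ ((measure_union_le _ _).trans (add_le_add h₃ ((measure_union_le _ _).trans
    (add_le_add h₄ ((measure_union_le _ _).trans (add_le_add h₅ ((measure_union_le _ _).trans
    (add_le_add h₆ h₇)))))))))))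
  refine le_trans (le_trans (measure_mono fun z hz => ?_) hunion) hsum
  by_contra hcon
  simp only [Set.mem_union, Set.mem_ofPred_eq, not_or, not_lt, not_le, mul_one] at hcon hz
  obtain ⟨c1, c2, c3, c4, c5, c6, c7⟩ := hcon
  rw [abs_of_nonneg (dBL_nonneg _ _)] at hz
  rw [abs_of_nonneg (norm_nonneg _)] at c3
  have c1' : opNormInf (Θhat n z - precision (P n)) ≤ |M₁| * δ n :=
    (le_abs_self _).trans (c1.trans (mul_le_mul_of_nonneg_right (le_abs_self _) (hδ_pos n).le))
  have c2' : maxNorm (Θhat n z * sampleCov z - 1) ≤ |M₂| * γ n :=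
    (le_abs_self _).trans (c2.trans (mul_le_mul_of_nonneg_right (le_abs_self _) (hγ_pos n).le))
  refine absurd hz (not_lt.mpr ?_)
  have hη' : η = (10 + ρ) * τ := by rw [hτdef]; field_simp
  have hr0 : 0 ≤ r n := maxRate_nonneg _ _
  rw [hη', (hmb n).sandwichVar_eq hκ0]
  refine hdBL (post n) (Θhat n z) (βhat n z) (j n) z
    (fun i => influence (P n) (β₀ n) (j n) (z i) / √n) _ τ (E z) F
    (integral_nonneg fun o => sq_nonneg _) hτ (fun ω hω β hβ => ?_)
    (ENNReal.toReal_le_of_le_ofReal hτ.le c5.le) (ENNReal.toReal_le_of_le_ofReal hτ.le c4.le) ?_ ?_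
  · have hω' : IsRegular (P n) (β₀ n) (j n) M (r n) z ω := not_not.mp hω
    have hβ' : l1Norm (β - β₀ n) ≤ C * ε n := (not_le.mp hβ).le
    have hl0 : 0 ≤ l1Norm (β - β₀ n) := Finset.sum_nonneg fun k _ => abs_nonneg _
    refine (hω'.abs_debias_sub_le hn0 h4M hM1 (inv_sqrt_le_two_mul_maxRate hn3 (hp n)) (Θhat n z) β
      (βhat n z)).trans ?_
    have k0 : √(n : ℝ) * ‖βhat n z - (β₀ n + precision (P n) *ᵥ sampleScore (β₀ n) z)‖ ≤ τ / 2 := by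
      calc _ ≤ √(n : ℝ) * (τ / 2 * (√(n : ℝ))⁻¹) := by gcongr
        _ = τ / 2 := by field_simp
    have k1 : √(n : ℝ) * (opNormInf (Θhat n z - precision (P n)) * (5 * M ^ 2 * r n)
        + maxNorm (Θhat n z * sampleCov z - 1) * l1Norm (β - β₀ n)
        + (opNormInf (Θhat n z - precision (P n)) + opNormInf (precision (P n))) *
          (8 * M ^ 2 * r n * l1Norm (β - β₀ n)))
        ≤ √(n : ℝ) * (|M₁| * δ n * (5 * M ^ 2 * r n) + |M₂| * γ n * (C * ε n)
          + (|M₁| * δ n + opNormInf (precision (P n))) * (8 * M ^ 2 * r n * (C * ε n))) := by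
      have h1 := opNormInf_nonneg (precision (P n))
      have h2 := opNormInf_nonneg (Θhat n z - precision (P n))
      have h5 := (hγ_pos n).le
      have h6 := (hδ_pos n).le
      gcongr
    rw [mul_add]
    linarith
  · have e2 : ∑ i, (influence (P n) (β₀ n) (j n) (z i) / √n) ^ 2
        = (n : ℝ)⁻¹ * ∑ i, influence (P n) (β₀ n) (j n) (z i) ^ 2 := by
      rw [Finset.mul_sum]
      refine Finset.sum_congr rfl fun i _ => ?_
      rw [div_pow, Real.sq_sqrt hnR.le, div_eq_inv_mul]
    rw [e2]; exact c6
  · have e3 : ∑ i, |influence (P n) (β₀ n) (j n) (z i) / √n| ^ 3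
        = (∑ i, |influence (P n) (β₀ n) (j n) (z i)| ^ 3) / (n * √n) := by
      rw [Finset.sum_div]
      refine Finset.sum_congr rfl fun i _ => ?_
      rw [abs_div, div_pow, abs_of_pos hsp]
      congr 1
      rw [pow_succ, pow_two, hs]
    rw [e3, div_le_iff₀ (by positivity)]
    exact c7
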